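/- Let $D\ge 1$, $L_1,\dots,L_D>0$ and $\mathcal D=(0,L_1)\times\cdots\times(0,L_D)$. For $\mathbf i\in\mathbb N^D$ ($0\in\mathbb N$) let $$\Lambda_{\mathbf i}=\sum_{d=1}^D\Big(\frac{i_d\pi}{L_d}\Big)^2,\qquad \Psi_{\mathbf i}(\mathbf x)=C_{\mathbf i}\prod_{d=1}^D\cos\Big(\frac{i_d\pi x_d}{L_d}\Big)$$ be the Neumann eigenvalues and eigenfunctions of $-\Delta$ on $\mathcal D$, where $C_{\mathbf i}>0$ is such that $\|\Psi_{\mathbf i}\|_{L^2(\mathcal D)}=1$. Let $(\xi_{\mathbf i})_{\mathbf i\in\mathbb N^D}$ be i.i.d. $\mathcal N(0,1)$, and for $\kappa>0$ and $s>D/2$ let $$u=\kappa^{s-D/2}\sum_{\mathbf i\in\mathbb N^D}(\kappa^2+\Lambda_{\mathbf i})^{-s/2}\,\xi_{\mathbf i}\,\Psi_{\mathbf i}$$ (sum in $L^2(\mathcal D)$) be the Matérn-type Gaussian field. Given integers $K_1,\dots,K_D\ge1$, put $h_d=L_d/K_d$ and $h=\max_d h_d$. For $0\le i\le K_d$ let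 $$\lambda_{h_d,i}=\frac{6}{h_d^2}\,\frac{1-\cos(i\pi h_d/L_d)}{2+\cos(i\pi h_d/L_d)},\qquad \psi_{h_d,i}=c_{d,i}\sum_{k=0}^{K_d}\cos\Big(\frac{ki\pi h_d}{L_d}\Big)e_{h_d,k},$$ where $e_{h_d,k}$ is the continuous piecewise linear nodal hat function on $[0,L_d]$ at the node $kh_d$, and $c_{d,i}>0$ is such that $\|\psi_{h_d,i}\|_{L^2(0,L_d)}=1$; these are the eigenpairs of the piecewise linear Galerkin discretization of $-\frac{d^2}{dx^2}$ with Neumann boundary condition. With $\Lambda_{\mathbf h,\mathbf i}=\sum_d\lambda_{h_d,i_d}$ and $\Psi_{\mathbf h,\mathbf i}(\mathbf x)=\prod_d\psi_{h_d,i_d}(x_d)$, let $$u_{\mathbf h}=\kappa^{s-D/2}\sum_{\mathbf i:\,0\le i_d\le K_d}(\kappa^2+\Lambda_{\mathbf h,\mathbf i})^{-s/2}\,\xi_{\mathbf i}\,\Psi_{\mathbf h,\mathbf i}$$ be the finite element representation of $u$, with the same $\xi_{\mathbf i}$. Fix $\rho$ and consider only grids with $h_j\le\rho\,h_k$ for all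 $j,k$. Let $s>D/2$. Then: 1. For every $\kappa>0$, the series defining $u$ converges unconditionally in $L^2(\mathcal D)$ almost surely. 2. There is a constant $C$, independent of $\kappa>0$ and of the grid (hence of $h$), such that, if $s\ne D/2+2$, $$\mathbb E\|u_{\mathbf h}-u\|_{L^2(\mathcal D)}^2\le C\,\kappa^{2s-D}\,h^{(2s-D)\wedge 4},$$ and, if $s=D/2+2$ (so that $(2s-D)\wedge4=4$), $$\mathbb E\|u_{\mathbf h}-u\|_{L^2(\mathcal D)}^2\le C\,\kappa^{2s-D}\,h^{4}\,(1+|\log h|).$$ 3. For every $\kappa>0$, almost surely $u$ coincides almost everywhere with a function that belongs to $\mathcal C^\beta(\mathcal D)$ for every $0<\beta<1\wedge(s-D/2)$. 4. If moreover $s>D$, there is a constant $C$, independent of $\kappa>0$ and of the grid (hence of $h$), such that $$\mathbb E\|u_{\mathbf h}-u\|_{L^\infty(\mathcal D)}^2\le C\,\kappa^{2s-D}\,h^{(2s-2D)\wedge 4}.$$ -/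

import Mathlib

open MeasureTheory ProbabilityTheory Real Set

noncomputable section

namespace MaternFEM

/-- The hyperrectangle `(0, L_1) × ⋯ × (0, L_D)`. -/
def domain {D : ℕ} (L : Fin D → ℝ) : Set (Fin D → ℝ) :=
  Set.univ.pi fun d => Ioo 0 (L d)

/-- Lebesgue measure on the hyperrectangle. -/
abbrev domainMeasure {D : ℕ} (L : Fin D → ℝ) : Measure (Fin D → ℝ) :=
  volume.restrict (domain L)

/-! ### Neumann eigenpairs of the negative Laplacian on the hyperrectangle -/

/-- The Neumann eigenvalue `Λ_i = ∑_d (i_d π / L_d)^2` of `-Δ`. -/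
def eigval {D : ℕ} (L : Fin D → ℝ) (i : Fin D → ℕ) : ℝ :=
  ∑ d, ((i d : ℝ) * π / L d) ^ 2

/-- The unnormalized Neumann eigenfunction `∏_d cos (i_d π x_d / L_d)`. -/
def cosProd {D : ℕ} (L : Fin D → ℝ) (i : Fin D → ℕ) (x : Fin D → ℝ) : ℝ :=
  ∏ d, cos ((i d : ℝ) * π * x d / L d)

/-- The `L²`-normalized Neumann eigenfunction `Ψ_i`. -/
def eigfun {D : ℕ} (L : Fin D → ℝ) (i : Fin D → ℕ) (x : Fin D → ℝ) : ℝ :=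
  (√(∫ y in domain L, cosProd L i y ^ 2))⁻¹ * cosProd L i x

theorem volume_domain_lt_top {D : ℕ} (L : Fin D → ℝ) : volume (domain L) < ⊤ := by
  rw [domain, Real.volume_pi_Ioo]
  exact ENNReal.prod_lt_top fun _ _ => ENNReal.ofReal_lt_top

instance {D : ℕ} (L : Fin D → ℝ) : IsFiniteMeasure (domainMeasure L) :=
  ⟨by simpa using volume_domain_lt_top L⟩

theorem eigfun_memLp {D : ℕ} (L : Fin D → ℝ) (i : Fin D → ℕ) :
    MemLp (eigfun L i) 2 (domainMeasure L) := by
  have hc : Continuous (eigfun L i) := by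
    unfold eigfun cosProd
    fun_prop
  refine MemLp.of_bound hc.aestronglyMeasurable
    ‖(√(∫ y in domain L, cosProd L i y ^ 2))⁻¹‖ (Filter.Eventually.of_forall fun x => ?_)
  rw [eigfun, norm_mul]
  refine mul_le_of_le_one_right (norm_nonneg _) ?_
  rw [cosProd, norm_prod]
  exact Finset.prod_le_one (fun _ _ => norm_nonneg _) fun d _ => by
    rw [Real.norm_eq_abs]; exact abs_cos_le_one _

/-- `Ψ_i` as an element of `L²` of the hyperrectangle. -/
def eigfunLp {D : ℕ} (L : Fin D → ℝ) (i : Fin D → ℕ) : Lp ℝ 2 (domainMeasure L) :=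
  (eigfun_memLp L i).toLp (eigfun L i)

/-! ### Linear finite elements on one interval `[0, ℓ]` with `K` cells, `h = ℓ / K` -/

/-- The nodal hat function `e_{h,k}` centred at `k h`; on `[0, ℓ]` the functions with `k = 0` and
`k = K` are the boundary half-hats. -/
def hat (h : ℝ) (k : ℕ) (x : ℝ) : ℝ :=
  max 0 (1 - |x - k * h| / h)

/-- The `i`-th eigenvalue of the Galerkin discretization of `-d²/dx²` (Neumann condition). -/
def feEigval₁ (ℓ : ℝ) (K i : ℕ) : ℝ :=
  6 / (ℓ / K) ^ 2 * ((1 - cos (i * π * (ℓ / K) / ℓ)) / (2 + cos (i * π * (ℓ / K) / ℓ)))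

/-- The nodal values (before normalization) of the `i`-th discrete eigenfunction. -/
def feNodal (ℓ : ℝ) (K i k : ℕ) : ℝ :=
  cos (k * i * π * (ℓ / K) / ℓ)

/-- The unnormalized `i`-th discrete eigenfunction. -/
def feShape (ℓ : ℝ) (K i : ℕ) (x : ℝ) : ℝ :=
  ∑ k ∈ Finset.range (K + 1), feNodal ℓ K i k * hat (ℓ / K) k x

/-- The `L²(0, ℓ)`-normalized `i`-th discrete eigenfunction `ψ_{h,i}`. -/
def feEigfun₁ (ℓ : ℝ) (K i : ℕ) (x : ℝ) : ℝ :=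
  (√(∫ y in Ioo 0 ℓ, feShape ℓ K i y ^ 2))⁻¹ * feShape ℓ K i x

/-- The stiffness matrix of the hat functions. -/
def stiffness (h : ℝ) (K : ℕ) : Matrix (Fin (K + 1)) (Fin (K + 1)) ℝ := fun j k =>
  h⁻¹ * if (j : ℕ) = k then (if (j : ℕ) = 0 ∨ (j : ℕ) = K then 1 else 2)
    else if (j : ℕ) = k + 1 ∨ (k : ℕ) = j + 1 then -1 else 0

/-- The mass matrix of the hat functions. -/
def mass (h : ℝ) (K : ℕ) : Matrix (Fin (K + 1)) (Fin (K + 1)) ℝ := fun j k =>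
  h * if (j : ℕ) = k then (if (j : ℕ) = 0 ∨ (j : ℕ) = K then 1 / 3 else 2 / 3)
    else if (j : ℕ) = k + 1 ∨ (k : ℕ) = j + 1 then 1 / 6 else 0

theorem tridiag_sum (a b w : ℝ) (z : ℕ → ℝ) (K j : ℕ) (hj : j ≤ K) :
    ∑ k : Fin (K + 1), (w * if j = (k : ℕ) then a
        else if j = (k : ℕ) + 1 ∨ (k : ℕ) = j + 1 then b else 0) * z k
      = w * (a * z j + (if 1 ≤ j then b * z (j - 1) else 0)
          + (if j + 1 ≤ K then b * z (j + 1) else 0)) := by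
  rw [Fin.sum_univ_eq_sum_range (fun k => (w * if j = k then a
        else if j = k + 1 ∨ k = j + 1 then b else 0) * z k) (K + 1)]
  have e : ∀ k ∈ Finset.range (K + 1), (w * if j = k then a
        else if j = k + 1 ∨ k = j + 1 then b else 0) * z k
      = (if k = j then w * (a * z k) else 0)
        + (if k = j - 1 then (if 1 ≤ j then w * (b * z k) else 0) else 0)
        + (if k = j + 1 then w * (b * z k) else 0) := by
    intro k _
    split_ifs <;> first | omega | (subst_vars; ring)
  rw [Finset.sum_congr rfl e, Finset.sum_add_distrib, Finset.sum_add_distrib,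
    Finset.sum_ite_eq', Finset.sum_ite_eq', Finset.sum_ite_eq']
  simp only [Finset.mem_range]
  split_ifs <;> first | omega | ring

/-- `(feEigval₁, feNodal)` solves the generalized eigenvalue problem of the Galerkin
discretization. -/
theorem galerkin_eigenpair (ℓ : ℝ) (hℓ : 0 < ℓ) (K : ℕ) (hK : 1 ≤ K) (i : ℕ) :
    (stiffness (ℓ / K) K).mulVec (fun k => feNodal ℓ K i k)
      = feEigval₁ ℓ K i • (mass (ℓ / K) K).mulVec (fun k => feNodal ℓ K i k) := by
  have hK0 : (K : ℝ) ≠ 0 := by positivity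
  obtain ⟨h, hh⟩ : ∃ h, h = ℓ / (K : ℝ) := ⟨_, rfl⟩
  have hh0 : h ≠ 0 := by rw [hh]; positivity
  obtain ⟨θ, hθ⟩ : ∃ θ, θ = (i : ℝ) * π / K := ⟨_, rfl⟩
  have hz : ∀ k : ℕ, feNodal ℓ K i k = cos (k * θ) := by
    intro k
    rw [feNodal, hθ]; congr 1; field_simp
  have hl : feEigval₁ ℓ K i = 6 / h ^ 2 * ((1 - cos θ) / (2 + cos θ)) := by
    have : (i : ℝ) * π * (ℓ / K) / ℓ = θ := by rw [hθ]; field_simp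
    rw [feEigval₁, this, hh]
  have hs : sin (K * θ) = 0 := by
    have : (K : ℝ) * θ = i * π := by rw [hθ]; field_simp
    rw [this]; exact sin_nat_mul_pi i
  have hc : 2 + cos θ ≠ 0 := by linarith [neg_one_le_cos θ]
  ext j
  obtain ⟨j, hj⟩ := j
  simp only [Matrix.mulVec, dotProduct, Pi.smul_apply, smul_eq_mul, stiffness, mass, ← hh]
  rw [tridiag_sum _ _ _ (feNodal ℓ K i) K j (by omega),
    tridiag_sum _ _ _ (feNodal ℓ K i) K j (by omega), hl]
  simp only [hz]
  rcases Nat.eq_zero_or_pos j with rfl | hj0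
  · simp only [Nat.cast_zero, zero_mul, cos_zero, true_or, if_true]
    rw [if_neg (by omega), if_pos (by omega), if_neg (by omega), if_pos (by omega)]
    simp only [zero_add, Nat.cast_one, one_mul]
    field_simp
    ring
  · have hm : cos ((j - 1 : ℕ) * θ) = cos (j * θ) * cos θ + sin (j * θ) * sin θ := by
      rw [← cos_sub]; congr 1; push_cast [Nat.cast_sub hj0]; ring
    have hp : cos ((j + 1 : ℕ) * θ) = cos (j * θ) * cos θ - sin (j * θ) * sin θ := by
      rw [← cos_add]; congr 1; push_cast; ring
    rw [if_pos (show 1 ≤ j by omega), if_pos (show 1 ≤ j by omega), hm, hp]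
    rcases Nat.lt_or_ge j K with hjK | hjK
    · rw [if_neg (by omega), if_pos (by omega), if_neg (by omega), if_pos (by omega)]
      field_simp
      ring
    · obtain rfl : j = K := by omega
      rw [if_pos (by omega), if_neg (by omega), if_pos (by omega), if_neg (by omega), hs]
      field_simp
      ring

/-! ### Tensor-product finite elements on the hyperrectangle, `K d` cells in direction `d` -/

/-- The mesh width `h_d = L_d / K_d`. -/
def width {D : ℕ} (L : Fin D → ℝ) (K : Fin D → ℕ) (d : Fin D) : ℝ :=
  L d / K d

/-- The mesh size `h = max_d h_d`. -/
def meshSize {D : ℕ} (L : Fin D → ℝ) (K : Fin D → ℕ) : ℝ :=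
  ⨆ d, width L K d

/-- The Galerkin eigenvalue `Λ_{h,i} = ∑_d λ_{h_d,i_d}` of `-Δ`. -/
def feEigval {D : ℕ} (L : Fin D → ℝ) (K i : Fin D → ℕ) : ℝ :=
  ∑ d, feEigval₁ (L d) (K d) (i d)

/-- The Galerkin eigenfunction `Ψ_{h,i}(x) = ∏_d ψ_{h_d,i_d}(x_d)`. -/
def feEigfun {D : ℕ} (L : Fin D → ℝ) (K i : Fin D → ℕ) (x : Fin D → ℝ) : ℝ :=
  ∏ d, feEigfun₁ (L d) (K d) (i d) (x d)

/-! ### The random fields -/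

/-- The family `ξ` is i.i.d. standard normal under `P`. -/
structure IsIIDStdNormal {Ω ι : Type*} [MeasurableSpace Ω] (ξ : ι → Ω → ℝ) (P : Measure Ω) :
    Prop where
  measurable : ∀ i, Measurable (ξ i)
  indep : iIndepFun ξ P
  law : ∀ i, P.map (ξ i) = gaussianReal 0 1

/-- The term of index `i` in the Karhunen–Loève series of the Matérn-type field,
`κ^(s - D/2) (κ² + Λ_i)^(-s/2) ξ_i Ψ_i`, as an element of `L²`. -/
def fieldTerm {D : ℕ} {Ω : Type*} (L : Fin D → ℝ) (s κ : ℝ) (ξ : (Fin D → ℕ) → Ω → ℝ)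
    (ω : Ω) (i : Fin D → ℕ) : Lp ℝ 2 (domainMeasure L) :=
  (κ ^ (s - (D : ℝ) / 2) * (κ ^ 2 + eigval L i) ^ (-s / 2) * ξ i ω) • eigfunLp L i

/-- The Matérn-type field `u`, a random element of `L²`: the sum in `L²` of its series. -/
def field {D : ℕ} {Ω : Type*} (L : Fin D → ℝ) (s κ : ℝ) (ξ : (Fin D → ℕ) → Ω → ℝ)
    (ω : Ω) : Lp ℝ 2 (domainMeasure L) :=
  ∑' i, fieldTerm L s κ ξ ω i

/-- The finite element representation `u_h` of the field, driven by the same `ξ`. -/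
def feField {D : ℕ} {Ω : Type*} (L : Fin D → ℝ) (s κ : ℝ) (K : Fin D → ℕ)
    (ξ : (Fin D → ℕ) → Ω → ℝ) (ω : Ω) (x : Fin D → ℝ) : ℝ :=
  κ ^ (s - (D : ℝ) / 2) * ∑ i ∈ Fintype.piFinset fun d => Finset.range (K d + 1),
    (κ ^ 2 + feEigval L K i) ^ (-s / 2) * ξ i ω * feEigfun L K i x

/-- `E ‖u_h - u‖_p²`, the norm being that of `L^p` of the hyperrectangle. -/
def meanSqError {D : ℕ} {Ω : Type*} [MeasurableSpace Ω] (P : Measure Ω) (p : ENNReal)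
    (L : Fin D → ℝ) (s κ : ℝ) (K : Fin D → ℕ) (ξ : (Fin D → ℕ) → Ω → ℝ) : ENNReal :=
  ∫⁻ ω, eLpNorm (fun x => feField L s κ K ξ ω x - field L s κ ξ ω x) p (domainMeasure L) ^ 2 ∂P

/-- `v` is `β`-Hölder on `S` for the Euclidean distance (on the bounded hyperrectangle such a
function is bounded, so this is membership in `C^β`). -/
def IsHolderOn {D : ℕ} (β : ℝ) (v : (Fin D → ℝ) → ℝ) (S : Set (Fin D → ℝ)) : Prop :=
  ∃ M : ℝ, ∀ x ∈ S, ∀ y ∈ S, |v x - v y| ≤ M * (√(∑ d, (x d - y d) ^ 2)) ^ β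

/-- Admissible grids: at least one cell in each direction, widths of the same order, with
constant `ρ`. -/
def IsAdmissible {D : ℕ} (L : Fin D → ℝ) (ρ : ℝ) (K : Fin D → ℕ) : Prop :=
  (∀ d, 1 ≤ K d) ∧ ∀ j k, width L K j ≤ ρ * width L K k

end MaternFEM

end

/-! Everything is organised by the dyadic size of the largest entry of the multi-index. Block n has
O(2^(nD)) indices, and on it `Λ_i` is of order 4^n, so the coefficient of the series without the
power of κ is O(2^(-ns)). The index 0 lies in no block. It is the only index where κ² is needed to
keep `(κ² + Λ_i)^(-s/2)` bounded; finite elements reproduce constants, so it cancels in the error.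
At every other index κ² is simply discarded, which makes all constants independent of κ.

The explicit one-dimensional formulas (`integral_feShape_sq`, `feNormConst_sub_le`,
`abs_feEigval₁_sub_le`) show that eigenvalues and normalizations are perturbed by a relative O((2^n
h)²), and multilinear interpolation of the cosines costs the same. Hence a resolved mode, with 2^n h
bounded above, has an error of size h² 2^(n(2-s)), while an unresolved mode, with 2^n h bounded
below, contributes its whole coefficient 2^(-ns) (`coef_bounds`, `scale_bounds`).

For the L² error, independence and Fatou's lemma bound the mean square by the sum of the squared
norms of the error functions (`meanSqError_two_le`); no orthogonality of the discrete eigenfunctions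
is needed. With a = 2s - D this leaves h⁴ ∑ 2^(n(4-a)) over resolved scales plus ∑ 2^(-na) over
unresolved ones. For a = 4 every resolved scale contributes the same amount, which is the source of
the logarithm.

For suprema, `exists_sup_bound` compares a Gaussian trigonometric sum with its values on a
polynomially fine net and uses high even moments there; the price over the variance is only 2^(nε).
Linear interpolation takes convex combinations, so it does not increase suprema, and its error is
controlled by second derivatives: the whole finite element error is thereby dominated by suprema of
plain cosine sums, which are added over blocks. For Hölder continuity the same bound is applied to
the blocks of u and to their gradients, and the two estimates are interpolated on each block. -/

noncomputable section

namespace MaternFEM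

/-! ### Dyadic blocks of multi-indices -/

/-- The multi-indices with all entries below `2 ^ m`. -/
def dyadicBox (D m : ℕ) : Finset (Fin D → ℕ) :=
  Fintype.piFinset fun _ => Finset.range (2 ^ m)

/-- The multi-indices whose largest entry lies in `[2 ^ n, 2 ^ (n + 1))`. -/
def dyadicBlock (D n : ℕ) : Finset (Fin D → ℕ) :=
  dyadicBox D (n + 1) \ dyadicBox D n

theorem mem_dyadicBox {D m : ℕ} {i : Fin D → ℕ} : i ∈ dyadicBox D m ↔ ∀ d, i d < 2 ^ m := by
  simp [dyadicBox]

theorem mem_dyadicBlock {D n : ℕ} {i : Fin D → ℕ} :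
    i ∈ dyadicBlock D n ↔ (∀ d, i d < 2 ^ (n + 1)) ∧ ∃ d, 2 ^ n ≤ i d := by
  simp [dyadicBlock, mem_dyadicBox]

theorem dyadicBox_mono (D : ℕ) : Monotone (dyadicBox D) := by
  intro m n h i hi
  rw [mem_dyadicBox] at *
  exact fun d => (hi d).trans_le (Nat.pow_le_pow_right (by norm_num) h)

theorem dyadicBox_zero (D : ℕ) : dyadicBox D 0 = {0} := by
  ext i
  rw [mem_dyadicBox, Finset.mem_singleton]
  simp [funext_iff]

theorem exists_subset_dyadicBox {D : ℕ} (F : Finset (Fin D → ℕ)) : ∃ m, F ⊆ dyadicBox D m := by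
  refine ⟨∑ i ∈ F, ∑ d, i d, fun i hi => mem_dyadicBox.2 fun d => ?_⟩
  have h1 : i d ≤ ∑ d, i d := Finset.single_le_sum (fun _ _ => Nat.zero_le _) (Finset.mem_univ d)
  have h2 : ∑ d, i d ≤ ∑ i ∈ F, ∑ d, i d :=
    Finset.single_le_sum (f := fun i => ∑ d, i d) (fun _ _ => Nat.zero_le _) hi
  exact (h1.trans h2).trans_lt Nat.lt_two_pow_self

/-- The boxes are cofinal among finite index sets, so an unconditionally convergent series can be
summed along them. -/
theorem tendsto_dyadicBox (D : ℕ) :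
    Filter.Tendsto (dyadicBox D) Filter.atTop Filter.atTop :=
  Filter.tendsto_atTop_finset_of_monotone (dyadicBox_mono D) fun i => by
    obtain ⟨m, hm⟩ := exists_subset_dyadicBox {i}
    exact ⟨m, hm (Finset.mem_singleton_self i)⟩

/-- The differences of successive boxes telescope. The smallest box is the single index 0, which is
why that term stands apart. -/
theorem sum_dyadicBox {D : ℕ} {E : Type*} [AddCommGroup E] (f : (Fin D → ℕ) → E) (m : ℕ) :
    ∑ i ∈ dyadicBox D m, f i
      = f 0 + ∑ n ∈ Finset.range m, ∑ i ∈ dyadicBlock D n, f i := by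
  induction m with
  | zero => simp [dyadicBox_zero]
  | succ m ih =>
    rw [Finset.sum_range_succ, ← add_assoc, ← ih, dyadicBlock,
      add_comm (∑ i ∈ dyadicBox D m, f i), Finset.sum_sdiff (dyadicBox_mono D (Nat.le_succ m))]

theorem exists_mem_dyadicBlock {D : ℕ} {i : Fin D → ℕ} (hi : i ≠ 0) :
    ∃ n, i ∈ dyadicBlock D n := by
  obtain ⟨m, hm⟩ := exists_subset_dyadicBox {i}
  have hm' : i ∈ dyadicBox D m := hm (Finset.mem_singleton_self i)
  induction m with
  | zero => exact absurd (by simpa [dyadicBox_zero] using hm') hi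
  | succ m ih =>
    by_cases h : i ∈ dyadicBox D m
    · exact ih (by simpa using h) h
    · exact ⟨m, Finset.mem_sdiff.2 ⟨hm', h⟩⟩

theorem zero_notMem_dyadicBlock (D n : ℕ) : (0 : Fin D → ℕ) ∉ dyadicBlock D n := by
  simp [mem_dyadicBlock]

theorem card_dyadicBlock_le (D n : ℕ) : ((dyadicBlock D n).card : ℝ) ≤ 2 ^ D * 2 ^ ((n : ℝ) * D) := by
  have h : (dyadicBlock D n).card ≤ (2 ^ (n + 1)) ^ D := by
    refine (Finset.card_le_card Finset.sdiff_subset).trans ?_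
    simp [dyadicBox]
  calc ((dyadicBlock D n).card : ℝ) ≤ (((2 ^ (n + 1)) ^ D : ℕ) : ℝ) := by exact_mod_cast h
    _ = 2 ^ D * 2 ^ ((n : ℝ) * D) := by
      rw [← Nat.cast_mul, Real.rpow_natCast]
      push_cast
      ring

/-- A sum over nonzero multi-indices of terms bounded blockwise. -/
theorem tsum_le_tsum_dyadicBlock {D : ℕ} (F : (Fin D → ℕ) → ENNReal) (g : ℕ → ENNReal)
    (h0 : F 0 = 0) (hF : ∀ n, ∀ i ∈ dyadicBlock D n, F i ≤ g n) :
    ∑' i, F i ≤ ∑' n, ((dyadicBlock D n).card : ENNReal) * g n := by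
  classical
  -- Every nonzero index lies in some block, so `F i` is at most the sum of `g n` over the blocks
  -- containing it; disjointness of the blocks is not needed for this inequality. Exchanging the
  -- sums then counts each block.
  calc ∑' i, F i ≤ ∑' i, ∑' n, if i ∈ dyadicBlock D n then g n else 0 := by
        refine ENNReal.tsum_le_tsum fun i => ?_
        rcases eq_or_ne i 0 with rfl | hi
        · simp [h0]
        · obtain ⟨n, hn⟩ := exists_mem_dyadicBlock hi
          refine (hF n i hn).trans ?_
          refine le_trans ?_ (ENNReal.le_tsum n)
          rw [if_pos hn]
    _ = ∑' n, ∑' i, if i ∈ dyadicBlock D n then g n else 0 := ENNReal.tsum_comm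
    _ = ∑' n, ((dyadicBlock D n).card : ENNReal) * g n := by
        refine tsum_congr fun n => ?_
        rw [tsum_eq_sum (s := dyadicBlock D n) (fun i hi => if_neg hi),
          Finset.sum_congr rfl (fun i hi => if_pos hi), Finset.sum_const, nsmul_eq_mul]

/-! ### Geometric sums -/

theorem two_rpow_natCast_mul (n : ℕ) (a : ℝ) : (2 : ℝ) ^ ((n : ℝ) * a) = ((2 : ℝ) ^ a) ^ n := by
  rw [mul_comm, Real.rpow_mul (by norm_num), Real.rpow_natCast]

theorem tsum_ofReal_two_rpow_neg {a : ℝ} (ha : 0 < a) :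
    ∃ C : ℝ, 0 < C ∧ ∑' n : ℕ, ENNReal.ofReal (2 ^ (-(n : ℝ) * a)) ≤ ENNReal.ofReal C := by
  have h1 : (2 : ℝ) ^ (-a) < 1 := Real.rpow_lt_one_of_one_lt_of_neg (by norm_num) (by linarith)
  have h0 : (0 : ℝ) < 2 ^ (-a) := by positivity
  have hs := summable_geometric_of_lt_one h0.le h1
  have he : ∀ n : ℕ, (2 : ℝ) ^ (-(n : ℝ) * a) = (2 ^ (-a)) ^ n := fun n => by
    rw [← two_rpow_natCast_mul]; congr 1; ring
  simp_rw [he]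
  refine ⟨∑' n : ℕ, ((2 : ℝ) ^ (-a)) ^ n, ?_, ?_⟩
  · exact hs.tsum_pos (fun n => by positivity) 0 (by simp)
  · rw [ENNReal.ofReal_tsum_of_nonneg (fun n => by positivity) hs]

theorem summable_two_rpow_neg {a : ℝ} (ha : 0 < a) :
    Summable fun n : ℕ => (2 : ℝ) ^ (-(n : ℝ) * a) := by
  have h1 : (2 : ℝ) ^ (-a) < 1 := Real.rpow_lt_one_of_one_lt_of_neg (by norm_num) (by linarith)
  have he : ∀ n : ℕ, (2 : ℝ) ^ (-(n : ℝ) * a) = (2 ^ (-a)) ^ n := fun n => by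
    rw [← two_rpow_natCast_mul]; congr 1; ring
  simp_rw [he]
  exact summable_geometric_of_lt_one (by positivity) h1

/-- Geometric sum over the scales above `Y`. -/
theorem tsum_geometric_above {a : ℝ} (ha : 0 < a) :
    ∃ C : ℝ, 0 < C ∧ ∀ Y : ℝ, 0 < Y →
      ∑' n : ℕ, (if Y ≤ 2 ^ n then ENNReal.ofReal (2 ^ (-(n : ℝ) * a)) else 0)
        ≤ ENNReal.ofReal (C * Y ^ (-a)) := by
  classical
  obtain ⟨C, hC, hsum⟩ := tsum_ofReal_two_rpow_neg ha
  refine ⟨C, hC, fun Y hY => ?_⟩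
  have hex : ∃ n : ℕ, Y ≤ 2 ^ n := by
    obtain ⟨n, hn⟩ := pow_unbounded_of_one_lt Y (show (1 : ℝ) < 2 by norm_num)
    exact ⟨n, hn.le⟩
  -- The sum starts at the first scale with Y ≤ 2^n₀. Factoring out (2^n₀)^(-a) ≤ Y^(-a) leaves a
  -- full geometric series.
  set n₀ := Nat.find hex with hn₀
  have hn₀s : Y ≤ 2 ^ n₀ := Nat.find_spec hex
  have hz : ∀ n < n₀, ¬ Y ≤ 2 ^ n := fun n hn => Nat.find_min hex hn
  rw [← ENNReal.summable.sum_add_tsum_nat_add' (k := n₀)]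
  rw [Finset.sum_eq_zero (fun n hn => if_neg (hz n (Finset.mem_range.1 hn))), zero_add]
  calc ∑' n : ℕ, (if Y ≤ 2 ^ (n + n₀) then ENNReal.ofReal (2 ^ (-((n + n₀ : ℕ) : ℝ) * a)) else 0)
      ≤ ∑' n : ℕ, ENNReal.ofReal (Y ^ (-a)) * ENNReal.ofReal (2 ^ (-(n : ℝ) * a)) := by
        refine ENNReal.tsum_le_tsum fun n => ?_
        refine le_trans (by split_ifs <;> simp) (?_ : ENNReal.ofReal (2 ^ (-((n + n₀ : ℕ) : ℝ) * a)) ≤ _)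
        rw [← ENNReal.ofReal_mul (by positivity)]
        refine ENNReal.ofReal_le_ofReal ?_
        have : (2 : ℝ) ^ (-((n + n₀ : ℕ) : ℝ) * a) = ((2 : ℝ) ^ n₀) ^ (-a) * 2 ^ (-(n : ℝ) * a) := by
          rw [← Real.rpow_natCast, ← Real.rpow_mul (by norm_num), ← Real.rpow_add (by norm_num)]
          congr 1; push_cast; ring
        rw [this]
        exact mul_le_mul_of_nonneg_right
          (Real.rpow_le_rpow_of_nonpos hY hn₀s (by linarith)) (by positivity)
    _ = ENNReal.ofReal (Y ^ (-a)) * ∑' n : ℕ, ENNReal.ofReal (2 ^ (-(n : ℝ) * a)) :=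
        ENNReal.tsum_mul_left
    _ ≤ ENNReal.ofReal (C * Y ^ (-a)) := by
        rw [mul_comm C, ENNReal.ofReal_mul (by positivity)]
        gcongr

/-- Geometric sum over the scales below `Y`. -/
theorem tsum_geometric_below {a : ℝ} (ha : 0 < a) :
    ∃ C : ℝ, 0 < C ∧ ∀ Y : ℝ, 0 < Y →
      ∑' n : ℕ, (if 2 ^ n ≤ Y then ENNReal.ofReal (2 ^ ((n : ℝ) * a)) else 0)
        ≤ ENNReal.ofReal (C * Y ^ a) := by
  have h1 : (1 : ℝ) < 2 ^ a := Real.one_lt_rpow (by norm_num) ha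
  refine ⟨2 ^ a / (2 ^ a - 1), div_pos (by positivity) (by linarith), fun Y hY => ?_⟩
  obtain ⟨m, hm⟩ := pow_unbounded_of_one_lt Y (show (1 : ℝ) < 2 by norm_num)
  rw [tsum_eq_sum (s := Finset.range m)]
  swap
  · intro n hn
    refine if_neg (not_le.2 (hm.trans_le ?_))
    exact pow_le_pow_right₀ (by norm_num) (by simpa using hn)
  clear hm
  -- The bound does not depend on the truncation m. If 2^m is still at most Y, the partial sum is at
  -- most a complete geometric sum dominated by its last term; otherwise the new term is zero.
  induction m with
  | zero => simp
  | succ m ih =>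
    rw [Finset.sum_range_succ]
    split_ifs with h
    · calc _ ≤ ∑ n ∈ Finset.range (m + 1), ENNReal.ofReal (2 ^ ((n : ℝ) * a)) := by
            rw [Finset.sum_range_succ]
            gcongr with n _
            split_ifs <;> simp
        _ = ENNReal.ofReal (∑ n ∈ Finset.range (m + 1), ((2 : ℝ) ^ a) ^ n) := by
            rw [ENNReal.ofReal_sum_of_nonneg (fun n _ => by positivity)]
            simp_rw [two_rpow_natCast_mul]
        _ ≤ _ := by
            refine ENNReal.ofReal_le_ofReal ?_
            rw [geom_sum_eq h1.ne', div_mul_eq_mul_div]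
            have h2 : ((2 : ℝ) ^ a) ^ m ≤ Y ^ a := by
              rw [← two_rpow_natCast_mul, Real.rpow_mul (by norm_num), Real.rpow_natCast]
              exact Real.rpow_le_rpow (by positivity) h ha.le
            have h3 : (0 : ℝ) < 2 ^ a := by positivity
            refine div_le_div_of_nonneg_right ?_ (by linarith)
            rw [pow_succ]
            nlinarith
    · simpa using ih

/-- The number of scales below `Y`. -/
theorem tsum_scales_below (Y : ℝ) :
    ∑' n : ℕ, (if (2 : ℝ) ^ n ≤ Y then (1 : ENNReal) else 0)
      ≤ ENNReal.ofReal (1 + |Real.log Y| / Real.log 2) := by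
  have hl : 0 < Real.log 2 := Real.log_pos (by norm_num)
  obtain ⟨m, hm⟩ := pow_unbounded_of_one_lt Y (show (1 : ℝ) < 2 by norm_num)
  rw [tsum_eq_sum (s := Finset.range m)]
  swap
  · intro n hn
    refine if_neg (not_le.2 (hm.trans_le ?_))
    exact pow_le_pow_right₀ (by norm_num) (by simpa using hn)
  clear hm
  induction m with
  | zero => simp
  | succ m ih =>
    rw [Finset.sum_range_succ]
    split_ifs with h
    · calc _ ≤ ∑ n ∈ Finset.range (m + 1), (1 : ENNReal) := by
            rw [Finset.sum_range_succ]
            gcongr with n _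
            split_ifs <;> simp
        _ = ENNReal.ofReal (m + 1 : ℝ) := by
            rw [Finset.sum_const, Finset.card_range, nsmul_one,
              ← ENNReal.ofReal_natCast]
            push_cast; rfl
        _ ≤ _ := by
            refine ENNReal.ofReal_le_ofReal ?_
            have h2 : m * Real.log 2 ≤ Real.log Y := by
              rw [← Real.log_pow]; exact Real.log_le_log (by positivity) h
            have h3 : (m : ℝ) ≤ |Real.log Y| / Real.log 2 := by
              rw [le_div_iff₀ hl]; exact h2.trans (le_abs_self _)
            linarith
    · simpa using ih


/-! ### The one-dimensional finite element eigenfunctions -/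

/-- On a cell only the hats at its two end nodes are nonzero, and their values are the barycentric
coordinates of the point. -/
theorem hat_cell {h t : ℝ} (hh : 0 < h) (ht0 : 0 ≤ t) (ht1 : t ≤ 1) (k j : ℕ) :
    hat h j ((k + t) * h) = if j = k then 1 - t else if j = k + 1 then t else 0 := by
  have h1 : |(k + t) * h - j * h| / h = |k + t - j| := by
    rw [← sub_mul, abs_mul, abs_of_pos hh, mul_div_cancel_right₀ _ hh.ne']
  rw [hat, h1]
  rcases lt_trichotomy j k with hjk | rfl | hjk
  · have h2 : (j : ℝ) + 1 ≤ k := by exact_mod_cast hjk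
    rw [if_neg (by omega), if_neg (by omega), abs_of_nonneg (by linarith)]
    exact max_eq_left (by linarith)
  · rw [if_pos rfl, abs_of_nonneg (by linarith)]
    rw [max_eq_right (by linarith)]; ring
  · rw [if_neg (by omega)]
    split_ifs with hj
    · subst hj
      push_cast
      rw [abs_of_nonpos (by linarith), max_eq_right (by linarith)]; ring
    · have h2 : (k : ℝ) + 2 ≤ j := by exact_mod_cast (by omega : k + 2 ≤ j)
      rw [abs_of_nonpos (by linarith)]
      exact max_eq_left (by linarith)

theorem feNodal_eq {ℓ : ℝ} (hℓ : 0 < ℓ) {K : ℕ} (hK : 1 ≤ K) (i k : ℕ) :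
    feNodal ℓ K i k = cos (k * (i * π / K)) := by
  have hK0 : (K : ℝ) ≠ 0 := by positivity
  rw [feNodal]; congr 1; field_simp

theorem feShape_cell {ℓ : ℝ} (hℓ : 0 < ℓ) {K : ℕ} (hK : 1 ≤ K) (i : ℕ) {k : ℕ} (hk : k < K)
    {t : ℝ} (ht0 : 0 ≤ t) (ht1 : t ≤ 1) :
    feShape ℓ K i ((k + t) * (ℓ / K))
      = (1 - t) * cos (k * (i * π / K)) + t * cos ((k + 1 : ℕ) * (i * π / K)) := by
  have hh : 0 < ℓ / K := by positivity
  rw [feShape]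
  simp_rw [hat_cell hh ht0 ht1, feNodal_eq hℓ hK]
  rw [← Finset.sum_subset (s₁ := {k, k + 1})]
  · rw [Finset.sum_pair (by omega), if_pos rfl, if_neg (by omega), if_pos rfl]; ring
  · intro j hj
    simp only [Finset.mem_insert, Finset.mem_singleton] at hj
    simp only [Finset.mem_range]; omega
  · intro j _ hj
    simp only [Finset.mem_insert, Finset.mem_singleton, not_or] at hj
    rw [if_neg hj.1, if_neg hj.2, mul_zero]

/-- On `[0, ℓ]` the discrete shape interpolates the cosine linearly on each cell. -/
theorem feShape_interpolates {ℓ : ℝ} (hℓ : 0 < ℓ) {K : ℕ} (hK : 1 ≤ K) {x : ℝ}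
    (hx : x ∈ Icc 0 ℓ) :
    ∃ y z t : ℝ, 0 ≤ t ∧ t ≤ 1 ∧ z - y = ℓ / K ∧ x = (1 - t) * y + t * z ∧
      ∀ i : ℕ, feShape ℓ K i x = (1 - t) * cos (i * π * y / ℓ) + t * cos (i * π * z / ℓ) := by
  have hK0 : (0 : ℝ) < K := by positivity
  have hh : 0 < ℓ / K := by positivity
  -- The cell is found by rounding down, except that the right endpoint belongs to the last cell.
  -- The cell and t depend on x alone, so one choice serves every frequency i.
  obtain ⟨k, hk, hk1, hk2⟩ : ∃ k : ℕ, k < K ∧ k * (ℓ / K) ≤ x ∧ x ≤ (k + 1) * (ℓ / K) := by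
    by_cases hxℓ : x = ℓ
    · refine ⟨K - 1, by omega, ?_, ?_⟩
      · rw [hxℓ, Nat.cast_sub hK]
        have : (K : ℝ) * (ℓ / K) = ℓ := by field_simp
        nlinarith
      · rw [hxℓ, Nat.cast_sub hK]
        have : (K : ℝ) * (ℓ / K) = ℓ := by field_simp
        push_cast; nlinarith
    · have hlt : x < ℓ := lt_of_le_of_ne hx.2 hxℓ
      have h0 : 0 ≤ x / (ℓ / K) := div_nonneg hx.1 hh.le
      refine ⟨⌊x / (ℓ / K)⌋₊, ?_, ?_, ?_⟩
      · rw [Nat.floor_lt h0, div_lt_iff₀ hh]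
        have : (K : ℝ) * (ℓ / K) = ℓ := by field_simp
        linarith
      · rw [← le_div_iff₀ hh]; exact Nat.floor_le h0
      · rw [← div_le_iff₀ hh]; exact (Nat.lt_floor_add_one _).le
  set t := x / (ℓ / K) - k with ht
  have hxt : x = (k + t) * (ℓ / K) := by rw [ht]; field_simp; ring
  have ht0 : 0 ≤ t := by rw [ht, sub_nonneg, le_div_iff₀ hh]; exact hk1
  have ht1 : t ≤ 1 := by rw [ht, sub_le_iff_le_add, div_le_iff₀ hh, add_comm]; exact hk2
  refine ⟨k * (ℓ / K), (k + 1) * (ℓ / K), t, ht0, ht1, by ring, by rw [hxt]; ring, fun i => ?_⟩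
  have e1 : (i : ℝ) * π * (k * (ℓ / K)) / ℓ = k * (i * π / K) := by field_simp
  have e2 : (i : ℝ) * π * ((k + 1) * (ℓ / K)) / ℓ = (k + 1 : ℕ) * (i * π / K) := by
    push_cast; field_simp
  rw [hxt, feShape_cell hℓ hK i hk ht0 ht1, e1, e2]

theorem continuous_hat (h : ℝ) (k : ℕ) : Continuous (hat h k) := by
  unfold hat
  fun_prop

theorem continuous_feShape (ℓ : ℝ) (K i : ℕ) : Continuous (feShape ℓ K i) := by
  unfold feShape
  exact continuous_finsetSum _ fun k _ => continuous_const.mul (continuous_hat _ _)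

theorem integral_sq_linear (a b : ℝ) :
    ∫ t in (0 : ℝ)..1, ((1 - t) * a + t * b) ^ 2 = (a ^ 2 + a * b + b ^ 2) / 3 := by
  have hd : ∀ t ∈ uIcc (0 : ℝ) 1, HasDerivAt
      (fun t : ℝ => a ^ 2 * t + (a * (b - a)) * t ^ 2 + (b - a) ^ 2 / 3 * t ^ 3)
      (((1 - t) * a + t * b) ^ 2) t := by
    intro t _
    have := ((hasDerivAt_id t).const_mul (a ^ 2)).add
      (((hasDerivAt_pow 2 t).const_mul (a * (b - a))).add
        ((hasDerivAt_pow 3 t).const_mul ((b - a) ^ 2 / 3)))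
    refine (this.congr_of_eventuallyEq (Filter.Eventually.of_forall fun y => ?_)).congr_deriv ?_
    · simp only [Pi.add_apply, id]; ring
    · simp only [Nat.cast_ofNat]; ring
  rw [intervalIntegral.integral_eq_sub_of_hasDerivAt hd
    ((by fun_prop : Continuous fun t : ℝ => ((1 - t) * a + t * b) ^ 2).intervalIntegrable _ _)]
  ring

/-- With θ = iπ/K, product formulas turn the summand into 1 + cos θ / 2 plus a multiple of
cos((2k+1)θ). For 0 < i < K the latter telescopes after multiplication by 2 sin θ, and its sum
vanishes because 2Kθ is a multiple of π. For i = 0 and i = K, sin θ = 0 and every cosine equals cos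
θ = ±1, which doubles the value. -/
theorem sum_cells {K i : ℕ} (hi : i ≤ K) (hK : 1 ≤ K) :
    ∑ k ∈ Finset.range K, (cos (k * (i * π / K)) ^ 2
        + cos (k * (i * π / K)) * cos ((k + 1 : ℕ) * (i * π / K))
        + cos ((k + 1 : ℕ) * (i * π / K)) ^ 2)
      = (if 0 < i ∧ i < K then 1 else 2) * (K * (2 + cos (i * π / K)) / 2) := by
  have hK0 : (K : ℝ) ≠ 0 := by positivity
  obtain ⟨θ, hθ⟩ : ∃ θ, θ = (i : ℝ) * π / K := ⟨_, rfl⟩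
  rw [← hθ]
  have hKθ : (K : ℝ) * θ = i * π := by rw [hθ]; field_simp
  have key : ∀ k : ℕ, cos (k * θ) ^ 2 + cos (k * θ) * cos ((k + 1 : ℕ) * θ)
      + cos ((k + 1 : ℕ) * θ) ^ 2
      = 1 + cos θ / 2 + cos ((2 * k + 1) * θ) * (cos θ + 1 / 2) := by
    intro k
    obtain ⟨a, ha⟩ : ∃ a, a = (k : ℝ) * θ := ⟨_, rfl⟩
    have e1 : ((k + 1 : ℕ) : ℝ) * θ = a + θ := by rw [ha]; push_cast; ring
    have e2 : (2 * (k : ℝ) + 1) * θ = a + (a + θ) := by rw [ha]; ring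
    rw [e1, e2, ← ha, cos_add a (a + θ), cos_add a θ, sin_add a θ]
    have h1 := sin_sq_add_cos_sq a
    have h2 := sin_sq_add_cos_sq θ
    have hs : sin a ^ 2 = 1 - cos a ^ 2 := by linarith
    have ht : sin θ ^ 2 = 1 - cos θ ^ 2 := by linarith
    ring_nf
    rw [hs, ht]
    ring
  simp_rw [key]
  by_cases h : 0 < i ∧ i < K
  · have hsin : 0 < sin θ := by
      refine sin_pos_of_pos_of_lt_pi ?_ ?_
      · rw [hθ]
        have : (0 : ℝ) < i := by exact_mod_cast h.1
        positivity
      · rw [hθ, div_lt_iff₀ (by positivity), mul_comm π]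
        have : (i : ℝ) < K := by exact_mod_cast h.2
        exact mul_lt_mul_of_pos_right this pi_pos
    have hcos : ∀ k : ℕ, cos ((2 * k + 1) * θ)
        = (sin (2 * (k + 1 : ℕ) * θ) - sin (2 * k * θ)) / (2 * sin θ) := by
      intro k
      have e1 : 2 * ((k + 1 : ℕ) : ℝ) * θ = (2 * k + 1) * θ + θ := by push_cast; ring
      have e2 : 2 * (k : ℝ) * θ = (2 * k + 1) * θ - θ := by ring
      rw [e1, e2, sin_add, sin_sub]
      field_simp
      ring
    have hsum : ∑ k ∈ Finset.range K, cos ((2 * k + 1) * θ) = 0 := by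
      simp_rw [hcos, ← Finset.sum_div]
      rw [Finset.sum_range_sub (fun k : ℕ => sin (2 * (k : ℝ) * θ)), mul_assoc, hKθ]
      have : 2 * ((i : ℝ) * π) = (2 * i : ℕ) * π := by push_cast; ring
      rw [this, sin_nat_mul_pi]
      simp
    rw [if_pos h, Finset.sum_add_distrib, ← Finset.sum_mul, hsum]
    simp
    ring
  · have hi' : i = 0 ∨ i = K := by omega
    have hc : cos θ ^ 2 = 1 ∧ ∀ k : ℕ, cos ((2 * k + 1) * θ) = cos θ := by
      rcases hi' with rfl | rfl
      · simp [hθ]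
      · have : θ = π := by rw [hθ]; field_simp
        rw [this]
        refine ⟨by simp, fun k => ?_⟩
        have : (2 * (k : ℝ) + 1) * π = π + k * (2 * π) := by ring
        rw [this, cos_add_nat_mul_two_pi]
    rw [if_neg h]
    simp_rw [hc.2]
    rw [Finset.sum_const, Finset.card_range, nsmul_eq_mul]
    linear_combination (K : ℝ) * hc.1

theorem integral_feShape_sq {ℓ : ℝ} (hℓ : 0 < ℓ) {K i : ℕ} (hi : i ≤ K) (hK : 1 ≤ K) :
    ∫ y in Ioo 0 ℓ, feShape ℓ K i y ^ 2
      = (if 0 < i ∧ i < K then 1 else 2) * (ℓ * (2 + cos (i * π / K)) / 6) := by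
  have hK0 : (K : ℝ) ≠ 0 := by positivity
  have hcell : ∀ k < K, ∫ y in ((k : ℝ) * (ℓ / K))..(((k + 1 : ℕ) : ℝ) * (ℓ / K)),
      feShape ℓ K i y ^ 2 = (ℓ / K) * ((cos (k * (i * π / K)) ^ 2
        + cos (k * (i * π / K)) * cos ((k + 1 : ℕ) * (i * π / K))
        + cos ((k + 1 : ℕ) * (i * π / K)) ^ 2) / 3) := by
    intro k hk
    rw [← integral_sq_linear]
    have h1 := intervalIntegral.smul_integral_comp_mul_add (a := 0) (b := 1)
      (fun y => feShape ℓ K i y ^ 2) (ℓ / K) (k * (ℓ / K))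
    rw [smul_eq_mul] at h1
    have e1 : (ℓ / K) * 0 + k * (ℓ / K) = k * (ℓ / K) := by ring
    have e2 : (ℓ / K) * 1 + k * (ℓ / K) = ((k + 1 : ℕ) : ℝ) * (ℓ / K) := by push_cast; ring
    rw [e1, e2] at h1
    rw [← h1]
    congr 1
    refine intervalIntegral.integral_congr fun t ht => ?_
    rw [uIcc_of_le zero_le_one] at ht
    have : (ℓ / K) * t + k * (ℓ / K) = (k + t) * (ℓ / K) := by ring
    simp only [this, feShape_cell hℓ hK i hk ht.1 ht.2]
  have hsum := intervalIntegral.sum_integral_adjacent_intervals (n := K)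
    (a := fun k : ℕ => (k : ℝ) * (ℓ / K)) (f := fun y => feShape ℓ K i y ^ 2) (μ := volume)
    (fun k _ => ((continuous_feShape ℓ K i).pow 2).intervalIntegrable _ _)
  have hend : (K : ℝ) * (ℓ / K) = ℓ := by field_simp
  rw [hend, Nat.cast_zero, zero_mul] at hsum
  rw [← integral_Ioc_eq_integral_Ioo, ← intervalIntegral.integral_of_le hℓ.le, ← hsum,
    Finset.sum_congr rfl (fun k hk => hcell k (Finset.mem_range.1 hk)), ← Finset.mul_sum,
    ← Finset.sum_div, sum_cells hi hK]
  field_simp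
  ring

theorem integral_cos_sq_interval {ℓ : ℝ} (hℓ : 0 < ℓ) (i : ℕ) :
    ∫ y in Ioo 0 ℓ, cos (i * π * y / ℓ) ^ 2 = if i = 0 then ℓ else ℓ / 2 := by
  rw [← integral_Ioc_eq_integral_Ioo, ← intervalIntegral.integral_of_le hℓ.le]
  split_ifs with hi
  · simp [hi]
  · have hi' : (i : ℝ) ≠ 0 := by exact_mod_cast hi
    have hc : (i : ℝ) * π / ℓ ≠ 0 := by positivity
    have e : ∀ y : ℝ, (i : ℝ) * π * y / ℓ = (i * π / ℓ) * y := fun y => by ring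
    simp_rw [e]
    rw [intervalIntegral.integral_comp_mul_left (fun y => cos y ^ 2) hc, integral_cos_sq]
    have e2 : (i : ℝ) * π / ℓ * ℓ = i * π := by field_simp
    rw [e2, mul_zero, sin_nat_mul_pi]
    simp only [sin_zero, cos_zero, mul_zero, sub_zero, smul_eq_mul, zero_add]
    field_simp

/-- The normalization constant of the `i`-th discrete eigenfunction. -/
def feNormConst (ℓ : ℝ) (K i : ℕ) : ℝ :=
  (√(∫ y in Ioo 0 ℓ, feShape ℓ K i y ^ 2))⁻¹

/-- The normalization constant of the `i`-th Neumann eigenfunction on `(0, ℓ)`. -/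
def cosNormConst (ℓ : ℝ) (i : ℕ) : ℝ :=
  (√(∫ y in Ioo 0 ℓ, cos (i * π * y / ℓ) ^ 2))⁻¹

theorem abs_inv_sqrt_sub_le {p q r : ℝ} (hr : 0 < r) (hp : r ≤ p) (hq : r ≤ q) :
    |(√p)⁻¹ - (√q)⁻¹| ≤ |p - q| / (2 * r * √r) := by
  have hp0 : 0 < p := hr.trans_le hp
  have hq0 : 0 < q := hr.trans_le hq
  have h1 : 0 < √p := sqrt_pos.2 hp0
  have h2 : 0 < √q := sqrt_pos.2 hq0
  have h3 : 0 < √r := sqrt_pos.2 hr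
  have h4 : √r ≤ √p := sqrt_le_sqrt hp
  have h5 : √r ≤ √q := sqrt_le_sqrt hq
  have e : (√p)⁻¹ - (√q)⁻¹ = (q - p) / (√p * √q * (√p + √q)) := by
    have h6 : q - p = (√q - √p) * (√p + √q) := by
      nlinarith [sq_sqrt hp0.le, sq_sqrt hq0.le]
    rw [h6]
    field_simp
  rw [e, abs_div, abs_sub_comm, abs_of_pos (by positivity : 0 < √p * √q * (√p + √q))]
  refine div_le_div_of_nonneg_left (abs_nonneg _) (by positivity) ?_
  calc 2 * r * √r = √r * √r * (√r + √r) := by rw [mul_self_sqrt hr.le]; ring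
    _ ≤ √p * √q * (√p + √q) := by gcongr

theorem angle_mem {K i : ℕ} (hi : i ≤ K) (hK : 1 ≤ K) : (i : ℝ) * π / K ∈ Icc 0 π := by
  have hK0 : (0 : ℝ) < K := by positivity
  refine ⟨by positivity, ?_⟩
  rw [div_le_iff₀ hK0, mul_comm π]
  exact mul_le_mul_of_nonneg_right (by exact_mod_cast hi) pi_pos.le

/-- Since 2 + cos θ ≥ 1, the discrete norms do not degenerate even at the highest frequency. The
same lower bound is used for the continuous norms, so both kinds of normalization constants are
bounded uniformly. -/
theorem feShape_sq_ge {ℓ : ℝ} (hℓ : 0 < ℓ) {K i : ℕ} (hi : i ≤ K) (hK : 1 ≤ K) :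
    ℓ / 6 ≤ ∫ y in Ioo 0 ℓ, feShape ℓ K i y ^ 2 := by
  rw [integral_feShape_sq hℓ hi hK]
  have := neg_one_le_cos ((i : ℝ) * π / K)
  split_ifs <;> nlinarith

theorem cos_sq_ge {ℓ : ℝ} (hℓ : 0 < ℓ) (i : ℕ) :
    ℓ / 6 ≤ ∫ y in Ioo 0 ℓ, cos (i * π * y / ℓ) ^ 2 := by
  rw [integral_cos_sq_interval hℓ]
  split_ifs <;> linarith

/-- For 0 < i < K the squared norms are ℓ(2 + cos θ)/6 and ℓ/2, so they differ by ℓ(1 - cos θ)/6 ≤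
ℓθ²/12. The inverse square root is Lipschitz above ℓ/6. -/
theorem feNormConst_sub_le {ℓ : ℝ} (hℓ : 0 < ℓ) {K i : ℕ} (hi : i ≤ K) (hK : 1 ≤ K) :
    |feNormConst ℓ K i - cosNormConst ℓ i| ≤ (4 * √(ℓ / 6))⁻¹ * (i * π / K) ^ 2 := by
  have hθ := angle_mem hi hK
  refine (abs_inv_sqrt_sub_le (by positivity) (feShape_sq_ge hℓ hi hK) (cos_sq_ge hℓ i)).trans ?_
  have hdiff : |(∫ y in Ioo 0 ℓ, feShape ℓ K i y ^ 2) - ∫ y in Ioo 0 ℓ, cos (i * π * y / ℓ) ^ 2|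
      ≤ ℓ / 12 * (i * π / K) ^ 2 := by
    rw [integral_feShape_sq hℓ hi hK, integral_cos_sq_interval hℓ]
    have hc1 := one_sub_sq_div_two_le_cos (x := (i : ℝ) * π / K)
    have hc2 := cos_le_one ((i : ℝ) * π / K)
    rcases Nat.eq_zero_or_pos i with rfl | hi0
    · simp only [Nat.cast_zero, zero_mul, zero_div, cos_zero, lt_irrefl, false_and, if_false, if_true]
      rw [abs_of_nonpos (by linarith)]
      linarith
    · rcases Nat.lt_or_ge i K with hiK | hiK
      · rw [if_pos ⟨hi0, hiK⟩, if_neg (by omega), abs_le]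
        constructor <;> nlinarith
      -- At the top frequency the squared norms are ℓ/3 and ℓ/2. The gap is not small, but θ = π
      -- there, so the quadratic bound still covers it.
      · obtain rfl : i = K := le_antisymm hi hiK
        have hK0 : (i : ℝ) ≠ 0 := by positivity
        have e : (i : ℝ) * π / i = π := by field_simp
        rw [if_neg (by omega), if_neg (by omega), e, cos_pi, abs_le]
        have := pi_gt_three
        have h8 : 9 ≤ π ^ 2 := by nlinarith
        have h9 : ℓ * 9 ≤ ℓ * π ^ 2 := mul_le_mul_of_nonneg_left h8 hℓ.le
        constructor <;> nlinarith
  calc _ ≤ ℓ / 12 * (i * π / K) ^ 2 / (2 * (ℓ / 6) * √(ℓ / 6)) := by gcongr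
    _ = (4 * √(ℓ / 6))⁻¹ * (i * π / K) ^ 2 := by
      have : √(ℓ / 6) ≠ 0 := (sqrt_pos.2 (by positivity)).ne'
      field_simp
      ring

theorem feNormConst_nonneg (ℓ : ℝ) (K i : ℕ) : 0 ≤ feNormConst ℓ K i :=
  inv_nonneg.2 (sqrt_nonneg _)

theorem cosNormConst_nonneg (ℓ : ℝ) (i : ℕ) : 0 ≤ cosNormConst ℓ i :=
  inv_nonneg.2 (sqrt_nonneg _)

theorem feNormConst_le {ℓ : ℝ} (hℓ : 0 < ℓ) {K i : ℕ} (hi : i ≤ K) (hK : 1 ≤ K) :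
    feNormConst ℓ K i ≤ (√(ℓ / 6))⁻¹ :=
  inv_anti₀ (sqrt_pos.2 (by positivity)) (sqrt_le_sqrt (feShape_sq_ge hℓ hi hK))

theorem cosNormConst_le {ℓ : ℝ} (hℓ : 0 < ℓ) (i : ℕ) :
    cosNormConst ℓ i ≤ (√(ℓ / 6))⁻¹ :=
  inv_anti₀ (sqrt_pos.2 (by positivity)) (sqrt_le_sqrt (cos_sq_ge hℓ i))

/-! ### The discrete eigenvalues -/

theorem feEigval₁_eq {ℓ : ℝ} (hℓ : 0 < ℓ) {K : ℕ} (hK : 1 ≤ K) (i : ℕ) :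
    feEigval₁ ℓ K i = 6 / (ℓ / K) ^ 2 * ((1 - cos (i * π / K)) / (2 + cos (i * π / K))) := by
  have hK0 : (K : ℝ) ≠ 0 := by positivity
  have : (i : ℝ) * π * (ℓ / K) / ℓ = i * π / K := by field_simp
  rw [feEigval₁, this]

/-- From cos θ ≤ 1 - 2θ²/π² on [0, π] and 2 + cos θ ≤ 3. A lower bound up to a constant factor
suffices to control negative powers of the discrete eigenvalues. -/
theorem feEigval₁_ge {ℓ : ℝ} (hℓ : 0 < ℓ) {K i : ℕ} (hi : i ≤ K) (hK : 1 ≤ K) :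
    4 / π ^ 2 * (i * π / ℓ) ^ 2 ≤ feEigval₁ ℓ K i := by
  have hθ := angle_mem hi hK
  have hK0 : (0 : ℝ) < K := by positivity
  rw [feEigval₁_eq hℓ hK]
  have e : (i * π / ℓ) ^ 2 = (i * π / K) ^ 2 / (ℓ / K) ^ 2 := by field_simp
  rw [e]
  generalize (i : ℝ) * π / K = θ at hθ
  have h1 : cos θ ≤ 1 - 2 / π ^ 2 * θ ^ 2 :=
    cos_le_one_sub_mul_cos_sq (by rw [abs_of_nonneg hθ.1]; exact hθ.2)
  have h2 := neg_one_le_cos θ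
  have h3 := cos_le_one θ
  have h4 : 2 / 3 / π ^ 2 * θ ^ 2 ≤ (1 - cos θ) / (2 + cos θ) := by
    rw [le_div_iff₀ (by linarith)]
    have : 0 ≤ 2 / π ^ 2 * θ ^ 2 := by positivity
    have e : 2 / 3 / π ^ 2 * θ ^ 2 = (2 / π ^ 2 * θ ^ 2) / 3 := by ring
    rw [e]
    nlinarith
  calc _ = 6 / (ℓ / K) ^ 2 * (2 / 3 / π ^ 2 * θ ^ 2) := by ring
    _ ≤ _ := by gcongr

theorem cos_taylor_remainder (θ : ℝ) : cos θ - (1 - θ ^ 2 / 2) ∈ Icc 0 (3 * θ ^ 4) := by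
  refine ⟨by linarith [one_sub_sq_div_two_le_cos (x := θ)], ?_⟩
  -- The Taylor bound is available for |θ| ≤ 1; for larger θ the remainder is at most θ²/2, already
  -- below θ⁴.
  rcases le_or_gt |θ| 1 with h | h
  · have h1 := (abs_le.1 (cos_bound h)).2
    have h2 : |θ| ^ 4 = θ ^ 4 := by
      rw [show (4 : ℕ) = 2 * 2 from rfl, pow_mul, sq_abs, ← pow_mul]
    rw [h2] at h1
    have : 0 ≤ θ ^ 4 := by positivity
    linarith
  · have h1 : 1 ≤ θ ^ 2 := by rw [← sq_abs]; nlinarith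
    have h2 := cos_le_one θ
    nlinarith

/-- Inserting cos θ = 1 - θ²/2 + r over a common denominator, the terms of order θ² cancel and a
numerator O(θ⁴) remains, because r = O(θ⁴) and θ ≤ π. Division by h² gives h² times the square of
the exact eigenvalue. -/
theorem abs_feEigval₁_sub_le {ℓ : ℝ} (hℓ : 0 < ℓ) {K i : ℕ} (hi : i ≤ K) (hK : 1 ≤ K) :
    |feEigval₁ ℓ K i - (i * π / ℓ) ^ 2| ≤ 60 * (ℓ / K) ^ 2 * ((i * π / ℓ) ^ 2) ^ 2 := by
  have hθ := angle_mem hi hK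
  have hK0 : (0 : ℝ) < K := by positivity
  rw [feEigval₁_eq hℓ hK]
  have e : (i * π / ℓ) ^ 2 = (i * π / K) ^ 2 / (ℓ / K) ^ 2 := by field_simp
  rw [e]
  have hh : 0 < ℓ / K := by positivity
  generalize ℓ / K = h at hh
  generalize (i : ℝ) * π / K = θ at hθ
  obtain ⟨r, hr⟩ : ∃ r, r = cos θ - (1 - θ ^ 2 / 2) := ⟨_, rfl⟩
  have hr0 := cos_taylor_remainder θ
  rw [← hr] at hr0
  have hc := neg_one_le_cos θ
  have e1 : 6 / h ^ 2 * ((1 - cos θ) / (2 + cos θ)) - θ ^ 2 / h ^ 2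
      = (-6 * r + θ ^ 4 / 2 - r * θ ^ 2) / (h ^ 2 * (2 + cos θ)) := by
    have h2 : 2 + cos θ ≠ 0 := by linarith
    have h3 : cos θ = r + 1 - θ ^ 2 / 2 := by rw [hr]; ring
    field_simp
    rw [h3]
    ring
  have hθ2 : θ ^ 2 ≤ 10 := by nlinarith [pi_lt_d2, hθ.1, hθ.2, pi_pos]
  have h4 : 0 ≤ θ ^ 4 := by positivity
  have hnum : |-6 * r + θ ^ 4 / 2 - r * θ ^ 2| ≤ 60 * θ ^ 4 := by
    have h5 : r * θ ^ 2 ≤ 30 * θ ^ 4 := by nlinarith [hr0.1, hr0.2, sq_nonneg θ]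
    have h6 : 0 ≤ r * θ ^ 2 := mul_nonneg hr0.1 (sq_nonneg θ)
    rw [abs_le]
    constructor <;> linarith [hr0.1, hr0.2]
  rw [e1, abs_div, abs_of_pos (by nlinarith [sq_pos_of_pos hh] : 0 < h ^ 2 * (2 + cos θ))]
  calc _ ≤ 60 * θ ^ 4 / (h ^ 2 * 1) := by
        gcongr
        linarith
    _ = _ := by field_simp


/-- The factors are exchanged one at a time, the others being bounded by M. It serves for products
of normalization constants and for products of waves. -/
theorem abs_prod_sub_prod_le {ι : Type*} (s : Finset ι) {a b : ι → ℝ} {M : ℝ} (hM : 1 ≤ M)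
    (ha : ∀ d ∈ s, |a d| ≤ M) (hb : ∀ d ∈ s, |b d| ≤ M) :
    |∏ d ∈ s, a d - ∏ d ∈ s, b d| ≤ M ^ s.card * ∑ d ∈ s, |a d - b d| := by
  classical
  induction s using Finset.induction_on with
  | empty => simp
  | insert j s hj ih =>
    rw [Finset.prod_insert hj, Finset.prod_insert hj, Finset.sum_insert hj,
      Finset.card_insert_of_notMem hj]
    have ih' := ih (fun d hd => ha d (Finset.mem_insert_of_mem hd))
      (fun d hd => hb d (Finset.mem_insert_of_mem hd))
    have h1 : |∏ d ∈ s, b d| ≤ M ^ s.card := by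
      rw [Finset.abs_prod]
      exact (Finset.prod_le_prod (fun _ _ => abs_nonneg _)
        fun d hd => hb d (Finset.mem_insert_of_mem hd)).trans_eq (Finset.prod_const M)
    have h2 := ha j (Finset.mem_insert_self j s)
    have h3 : (1 : ℝ) ≤ M ^ s.card := one_le_pow₀ hM
    have e : a j * ∏ d ∈ s, a d - b j * ∏ d ∈ s, b d
        = a j * (∏ d ∈ s, a d - ∏ d ∈ s, b d) + (a j - b j) * ∏ d ∈ s, b d := by ring
    rw [e]
    calc _ ≤ |a j| * |∏ d ∈ s, a d - ∏ d ∈ s, b d| + |a j - b j| * |∏ d ∈ s, b d| := by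
          rw [← abs_mul, ← abs_mul]; exact abs_add_le _ _
      _ ≤ M * (M ^ s.card * ∑ d ∈ s, |a d - b d|) + |a j - b j| * M ^ s.card := by gcongr
      _ ≤ M * (M ^ s.card * ∑ d ∈ s, |a d - b d|) + |a j - b j| * (M * M ^ s.card) := by
          gcongr
          exact le_mul_of_one_le_left (by positivity) hM
      _ = _ := by ring

/-! ### Multilinear interpolation of cosine sums -/

/-- Linear interpolation error of a function with bounded second derivative. -/
theorem abs_linear_interpolation_sub_le {φ φ' φ'' : ℝ → ℝ} {M y z t : ℝ}
    (h1 : ∀ r, HasDerivAt φ (φ' r) r) (h2 : ∀ r, HasDerivAt φ' (φ'' r) r)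
    (hM : ∀ r, |φ'' r| ≤ M) (ht0 : 0 ≤ t) (ht1 : t ≤ 1) (hyz : y ≤ z) :
    |(1 - t) * φ y + t * φ z - φ ((1 - t) * y + t * z)| ≤ (z - y) ^ 2 * M := by
  obtain ⟨x, hx⟩ : ∃ x, x = (1 - t) * y + t * z := ⟨_, rfl⟩
  have hM0 : 0 ≤ M := (abs_nonneg _).trans (hM 0)
  have hxmem : x ∈ Icc y z := by
    rw [hx]; constructor <;> nlinarith
  -- Two applications of the mean value inequality give a first-order Taylor estimate at x. In the
  -- convex combination of its values at y and z the linear terms cancel, since x is that same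
  -- combination of y and z.
  have hlip : ∀ r ∈ Icc y z, |φ' r - φ' x| ≤ M * (z - y) := by
    intro r hr
    have := Convex.norm_image_sub_le_of_norm_hasDerivWithin_le (s := Set.univ) (C := M)
      (fun r _ => (h2 r).hasDerivWithinAt) (fun r _ => hM r) convex_univ (mem_univ x) (mem_univ r)
    refine this.trans (mul_le_mul_of_nonneg_left ?_ hM0)
    rw [Real.norm_eq_abs, abs_le]
    constructor <;> linarith [hr.1, hr.2, hxmem.1, hxmem.2]
  have hrem : ∀ r ∈ Icc y z, |φ r - φ x - φ' x * (r - x)| ≤ (z - y) ^ 2 * M := by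
    intro r hr
    have := Convex.norm_image_sub_le_of_norm_hasDerivWithin_le (s := Icc y z) (C := M * (z - y))
      (f := fun r => φ r - φ' x * r) (f' := fun r => φ' r - φ' x)
      (fun r _ => by
        have := ((h1 r).sub ((hasDerivAt_id r).const_mul (φ' x))).hasDerivWithinAt (s := Icc y z)
        rw [mul_one] at this
        exact this)
      (fun r hr => hlip r hr) (convex_Icc y z) hxmem hr
    rw [Real.norm_eq_abs] at this
    calc _ = |φ r - φ' x * r - (φ x - φ' x * x)| := by congr 1; ring
      _ ≤ M * (z - y) * ‖r - x‖ := this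
      _ ≤ M * (z - y) * (z - y) := by
          refine mul_le_mul_of_nonneg_left ?_ (mul_nonneg hM0 (by linarith))
          rw [Real.norm_eq_abs, abs_le]
          constructor <;> linarith [hr.1, hr.2, hxmem.1, hxmem.2]
      _ = _ := by ring
  have hy := hrem y (left_mem_Icc.2 hyz)
  have hz := hrem z (right_mem_Icc.2 hyz)
  rw [← hx]
  have e : (1 - t) * φ y + t * φ z - φ x
      = (1 - t) * (φ y - φ x - φ' x * (y - x)) + t * (φ z - φ x - φ' x * (z - x)) := by
    rw [hx]; ring
  rw [e]
  calc _ ≤ |(1 - t) * (φ y - φ x - φ' x * (y - x))| + |t * (φ z - φ x - φ' x * (z - x))| :=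
        abs_add_le _ _
    _ = (1 - t) * |φ y - φ x - φ' x * (y - x)| + t * |φ z - φ x - φ' x * (z - x)| := by
        rw [abs_mul, abs_mul, abs_of_nonneg ht0, abs_of_nonneg (by linarith : 0 ≤ 1 - t)]
    _ ≤ (1 - t) * ((z - y) ^ 2 * M) + t * ((z - y) ^ 2 * M) := by
        gcongr
    _ = _ := by ring

variable {D : ℕ}

/-- The product of cosines, interpolated in the coordinates of `A`. -/
def mixedProd (L : Fin D → ℝ) (K : Fin D → ℕ) (A : Finset (Fin D)) (i : Fin D → ℕ)
    (x : Fin D → ℝ) : ℝ :=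
  ∏ d, if d ∈ A then feShape (L d) (K d) (i d) (x d) else cos (i d * π * x d / L d)

theorem mixedProd_empty (L : Fin D → ℝ) (K : Fin D → ℕ) (i : Fin D → ℕ) (x : Fin D → ℝ) :
    mixedProd L K ∅ i x = cosProd L i x := by
  simp [mixedProd, cosProd]

theorem mixedProd_univ (L : Fin D → ℝ) (K : Fin D → ℕ) (i : Fin D → ℕ) (x : Fin D → ℝ) :
    mixedProd L K Finset.univ i x = ∏ d, feShape (L d) (K d) (i d) (x d) := by
  simp [mixedProd]

/-- The factors of `mixedProd` away from the coordinate `d`. -/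
def mixedCofactor (L : Fin D → ℝ) (K : Fin D → ℕ) (A : Finset (Fin D)) (d : Fin D)
    (i : Fin D → ℕ) (x : Fin D → ℝ) : ℝ :=
  ∏ j ∈ Finset.univ.erase d,
    if j ∈ A then feShape (L j) (K j) (i j) (x j) else cos (i j * π * x j / L j)

/-- As a function of a coordinate not yet interpolated, the product is one cosine times a constant;
both the interpolation and the differentiation in that coordinate rest on this. -/
theorem mixedProd_update (L : Fin D → ℝ) (K : Fin D → ℕ) {A : Finset (Fin D)} {d : Fin D}
    (hd : d ∉ A) (i : Fin D → ℕ) (x : Fin D → ℝ) (r : ℝ) :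
    mixedProd L K A i (Function.update x d r)
      = cos (i d * π * r / L d) * mixedCofactor L K A d i x := by
  rw [mixedProd, ← Finset.mul_prod_erase _ _ (Finset.mem_univ d), mixedCofactor, if_neg hd,
    Function.update_self]
  congr 1
  refine Finset.prod_congr rfl fun j hj => ?_
  rw [Function.update_of_ne (Finset.ne_of_mem_erase hj)]

theorem mixedProd_insert (L : Fin D → ℝ) (K : Fin D → ℕ) (A : Finset (Fin D)) (d : Fin D)
    (i : Fin D → ℕ) (x : Fin D → ℝ) :
    mixedProd L K (insert d A) i x
      = feShape (L d) (K d) (i d) (x d) * mixedCofactor L K A d i x := by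
  rw [mixedProd, ← Finset.mul_prod_erase _ _ (Finset.mem_univ d), mixedCofactor,
    if_pos (Finset.mem_insert_self d A)]
  congr 1
  refine Finset.prod_congr rfl fun j hj => ?_
  have : j ≠ d := Finset.ne_of_mem_erase hj
  simp [Finset.mem_insert, this]

/-- The nodes y, z and the weight t do not depend on the index i, so the identity passes to
arbitrary linear combinations over i. -/
theorem mixedProd_interpolates {L : Fin D → ℝ} (hL : ∀ d, 0 < L d) {K : Fin D → ℕ}
    (hK : ∀ d, 1 ≤ K d) {A : Finset (Fin D)} {d : Fin D} (hd : d ∉ A) {x : Fin D → ℝ}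
    (hx : x d ∈ Icc 0 (L d)) :
    ∃ y z t : ℝ, 0 ≤ t ∧ t ≤ 1 ∧ z - y = width L K d ∧ x d = (1 - t) * y + t * z ∧
      ∀ i, mixedProd L K (insert d A) i x
        = (1 - t) * mixedProd L K A i (Function.update x d y)
          + t * mixedProd L K A i (Function.update x d z) := by
  obtain ⟨y, z, t, ht0, ht1, hyz, hxt, h⟩ := feShape_interpolates (hL d) (hK d) hx
  refine ⟨y, z, t, ht0, ht1, hyz, hxt, fun i => ?_⟩
  rw [mixedProd_insert, mixedProd_update L K hd, mixedProd_update L K hd, h]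
  ring

/-- Interpolation does not increase the supremum of a cosine sum. -/
theorem abs_sum_mixedProd_le {L : Fin D → ℝ} (hL : ∀ d, 0 < L d) {K : Fin D → ℕ}
    (hK : ∀ d, 1 ≤ K d) {F : Finset (Fin D → ℕ)} {β : (Fin D → ℕ) → ℝ} {M : ℝ}
    (hM : ∀ y, |∑ i ∈ F, β i * cosProd L i y| ≤ M) (A : Finset (Fin D)) :
    ∀ x : Fin D → ℝ, (∀ d ∈ A, x d ∈ Icc 0 (L d)) → |∑ i ∈ F, β i * mixedProd L K A i x| ≤ M := by
  classical
  induction A using Finset.induction_on with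
  | empty =>
    intro x _
    simp_rw [mixedProd_empty]
    exact hM x
  | insert d A hd ih =>
    intro x hx
    obtain ⟨y, z, t, ht0, ht1, -, -, h⟩ := mixedProd_interpolates hL hK hd
      (hx d (Finset.mem_insert_self d A))
    -- Only the coordinate d outside A is moved, so the induction hypothesis applies at both shifted
    -- points, and a convex combination keeps the bound.
    have hA : ∀ r, ∀ j ∈ A, Function.update x d r j ∈ Icc 0 (L j) := by
      intro r j hj
      rw [Function.update_of_ne (ne_of_mem_of_not_mem hj hd)]
      exact hx j (Finset.mem_insert_of_mem hj)
    have hy := ih _ (hA y)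
    have hz := ih _ (hA z)
    have e : ∑ i ∈ F, β i * mixedProd L K (insert d A) i x
        = (1 - t) * ∑ i ∈ F, β i * mixedProd L K A i (Function.update x d y)
          + t * ∑ i ∈ F, β i * mixedProd L K A i (Function.update x d z) := by
      rw [Finset.mul_sum, Finset.mul_sum, ← Finset.sum_add_distrib]
      refine Finset.sum_congr rfl fun i _ => ?_
      rw [h]; ring
    rw [e]
    refine (abs_add_le _ _).trans ?_
    rw [abs_mul, abs_mul, abs_of_nonneg ht0, abs_of_nonneg (by linarith : 0 ≤ 1 - t)]
    nlinarith

/-- The interpolation error of a cosine sum, in terms of its pure second derivatives. -/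
theorem abs_sum_mixedProd_sub_le {L : Fin D → ℝ} (hL : ∀ d, 0 < L d) {K : Fin D → ℕ}
    (hK : ∀ d, 1 ≤ K d) {F : Finset (Fin D → ℕ)} {β : (Fin D → ℕ) → ℝ} {M : Fin D → ℝ}
    (hM : ∀ d y, |∑ i ∈ F, β i * (i d * π / L d) ^ 2 * cosProd L i y| ≤ M d)
    (A : Finset (Fin D)) :
    ∀ x : Fin D → ℝ, (∀ d ∈ A, x d ∈ Icc 0 (L d)) →
      |∑ i ∈ F, β i * mixedProd L K A i x - ∑ i ∈ F, β i * cosProd L i x|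
        ≤ ∑ d ∈ A, width L K d ^ 2 * M d := by
  classical
  induction A using Finset.induction_on with
  | empty =>
    intro x _
    simp [mixedProd_empty]
  | insert d A hd ih =>
    intro x hx
    obtain ⟨y, z, t, ht0, ht1, hyz, hxt, h⟩ := mixedProd_interpolates hL hK hd
      (hx d (Finset.mem_insert_self d A))
    have hxA : ∀ j ∈ A, x j ∈ Icc 0 (L j) := fun j hj => hx j (Finset.mem_insert_of_mem hj)
    have hA : ∀ r, ∀ j ∈ A, Function.update x d r j ∈ Icc 0 (L j) := by
      intro r j hj
      rw [Function.update_of_ne (ne_of_mem_of_not_mem hj hd)]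
      exact hxA j hj
    have hyz' : y ≤ z := by
      have : 0 ≤ width L K d := div_nonneg (hL d).le (Nat.cast_nonneg _)
      linarith
    have hω : ∀ i : Fin D → ℕ, ∀ r : ℝ, HasDerivAt (fun r : ℝ => (i d : ℝ) * π * r / L d)
        (i d * π / L d) r := by
      intro i r
      have := (hasDerivAt_id r).const_mul ((i d : ℝ) * π / L d)
      refine (this.congr_of_eventuallyEq (Filter.Eventually.of_forall fun y => ?_)).congr_deriv
        (mul_one _)
      simp only [id]; ring
    -- Along coordinate d, the second derivative of the mixed sum is minus the mixed sum with
    -- coefficients multiplied by (i_d π / L_d)². Interpolation in the coordinates of A does not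
    -- increase the supremum, so it is bounded by `M d`, and the one-dimensional estimate applies.
    have h1 : ∀ r, HasDerivAt (fun r => ∑ i ∈ F, β i * mixedProd L K A i (Function.update x d r))
        (∑ i ∈ F, β i * (-sin (i d * π * r / L d) * (i d * π / L d) * mixedCofactor L K A d i x))
        r := by
      intro r
      simp_rw [mixedProd_update L K hd]
      exact HasDerivAt.fun_sum fun i _ => (((hω i r).cos).mul_const _).const_mul _
    have h2 : ∀ r, HasDerivAt (fun r => ∑ i ∈ F, β i *
          (-sin (i d * π * r / L d) * (i d * π / L d) * mixedCofactor L K A d i x))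
        (-∑ i ∈ F, β i * (i d * π / L d) ^ 2 * mixedProd L K A i (Function.update x d r)) r := by
      intro r
      have := HasDerivAt.fun_sum (u := F) (fun i _ =>
        ((((hω i r).sin).neg.mul_const ((i d : ℝ) * π / L d)).mul_const
          (mixedCofactor L K A d i x)).const_mul (β i))
      refine this.congr_deriv ?_
      rw [← Finset.sum_neg_distrib]
      refine Finset.sum_congr rfl fun i _ => ?_
      rw [mixedProd_update L K hd]
      ring
    have h3 := abs_linear_interpolation_sub_le h1 h2 (M := M d) (fun r => by
      rw [abs_neg]
      exact abs_sum_mixedProd_le hL hK (hM d) A _ (hA r)) ht0 ht1 hyz'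
    rw [← hxt, Function.update_eq_self, hyz] at h3
    have e : ∑ i ∈ F, β i * mixedProd L K (insert d A) i x
        = (1 - t) * ∑ i ∈ F, β i * mixedProd L K A i (Function.update x d y)
          + t * ∑ i ∈ F, β i * mixedProd L K A i (Function.update x d z) := by
      rw [Finset.mul_sum, Finset.mul_sum, ← Finset.sum_add_distrib]
      refine Finset.sum_congr rfl fun i _ => ?_
      rw [h]; ring
    rw [← e] at h3
    rw [Finset.sum_insert hd]
    refine (abs_sub_le _ _ _).trans (add_le_add h3 (ih x hxA))


/-! ### Moments of Gaussian sums -/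

section Gaussian

variable {Ω ι : Type*} [MeasurableSpace Ω] {P : Measure Ω}
  {ξ : ι → Ω → ℝ}

theorem IsIIDStdNormal.memLp_two (hξ : IsIIDStdNormal ξ P) (i : ι) : MemLp (ξ i) 2 P := by
  have h := memLp_id_gaussianReal (μ := 0) (v := 1) 2
  rw [← hξ.law i] at h
  exact (memLp_map_measure_iff aestronglyMeasurable_id (hξ.measurable i).aemeasurable).1 h

theorem IsIIDStdNormal.integral_eq_zero (hξ : IsIIDStdNormal ξ P) (i : ι) :
    ∫ ω, ξ i ω ∂P = 0 := by
  have h := integral_map (hξ.measurable i).aemeasurable (f := fun x : ℝ => x) (μ := P)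
    aestronglyMeasurable_id
  rw [← h, hξ.law i, integral_id_gaussianReal]

theorem IsIIDStdNormal.integral_sq (hξ : IsIIDStdNormal ξ P) (i : ι) :
    ∫ ω, ξ i ω ^ 2 ∂P = 1 := by
  have h := integral_map (hξ.measurable i).aemeasurable (f := fun x : ℝ => x ^ 2) (μ := P)
    (by fun_prop)
  rw [← h, hξ.law i]
  have hv := variance_fun_id_gaussianReal (μ := 0) (v := 1)
  rw [variance_eq_integral aemeasurable_id'] at hv
  simpa [integral_id_gaussianReal] using hv

theorem IsIIDStdNormal.integral_mul (hξ : IsIIDStdNormal ξ P) {i j : ι} (hij : i ≠ j) :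
    ∫ ω, ξ i ω * ξ j ω ∂P = 0 := by
  rw [(hξ.indep.indepFun hij).integral_fun_mul_eq_mul_integral
    (hξ.measurable i).aestronglyMeasurable (hξ.measurable j).aestronglyMeasurable,
    hξ.integral_eq_zero, zero_mul]

theorem IsIIDStdNormal.lintegral_sq (hξ : IsIIDStdNormal ξ P) (c : ℝ) (i : ι) :
    ∫⁻ ω, ENNReal.ofReal ((c * ξ i ω) ^ 2) ∂P = ENNReal.ofReal (c ^ 2) := by
  have hInt : Integrable (fun ω => (c * ξ i ω) ^ 2) P :=
    ((hξ.memLp_two i).const_mul c).integrable_sq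
  rw [← ofReal_integral_eq_lintegral_ofReal hInt
    (Filter.Eventually.of_forall fun ω => sq_nonneg _)]
  simp_rw [mul_pow]
  rw [integral_const_mul, hξ.integral_sq, mul_one]

/-- The second moment of a finite Gaussian sum of vectors. -/
theorem IsIIDStdNormal.lintegral_norm_sum_sq (hξ : IsIIDStdNormal ξ P) {H : Type*}
    [NormedAddCommGroup H] [InnerProductSpace ℝ H] (F : Finset ι) (w : ι → H) :
    ∫⁻ ω, ENNReal.ofReal (‖∑ i ∈ F, ξ i ω • w i‖ ^ 2) ∂P
      = ∑ i ∈ F, ENNReal.ofReal (‖w i‖ ^ 2) := by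
  classical
  have e : ∀ ω, ‖∑ i ∈ F, ξ i ω • w i‖ ^ 2
      = ∑ i ∈ F, ∑ j ∈ F, ξ i ω * ξ j ω * inner ℝ (w i) (w j) := by
    intro ω
    rw [← real_inner_self_eq_norm_sq, sum_inner]
    refine Finset.sum_congr rfl fun i _ => ?_
    rw [inner_sum]
    refine Finset.sum_congr rfl fun j _ => ?_
    rw [real_inner_smul_left, real_inner_smul_right]
    ring
  have hInt : ∀ i j, Integrable (fun ω => ξ i ω * ξ j ω * inner ℝ (w i) (w j)) P := fun i j =>
    ((hξ.memLp_two i).integrable_mul (hξ.memLp_two j)).mul_const _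
  have hInt' : Integrable (fun ω => ‖∑ i ∈ F, ξ i ω • w i‖ ^ 2) P := by
    simp_rw [e]
    exact integrable_finsetSum _ fun i _ => integrable_finsetSum _ fun j _ => hInt i j
  rw [← ofReal_integral_eq_lintegral_ofReal hInt'
    (Filter.Eventually.of_forall fun ω => sq_nonneg _),
    ← ENNReal.ofReal_sum_of_nonneg (fun _ _ => sq_nonneg _)]
  congr 1
  simp_rw [e]
  rw [integral_finsetSum _ fun i _ => integrable_finsetSum _ fun j _ => hInt i j]
  refine Finset.sum_congr rfl fun i hi => ?_
  rw [integral_finsetSum _ fun j _ => hInt i j, Finset.sum_eq_single_of_mem i hi]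
  · rw [integral_mul_const, ← real_inner_self_eq_norm_sq]
    simp_rw [← sq]
    rw [hξ.integral_sq, one_mul]
  · intro j _ hj
    rw [integral_mul_const, hξ.integral_mul hj.symm, zero_mul]

/-- The second moment of a Gaussian series of vectors is at most the sum of the squared norms. -/
theorem IsIIDStdNormal.lintegral_norm_hasSum_sq_le (hξ : IsIIDStdNormal ξ P) {H : Type*}
    [NormedAddCommGroup H] [InnerProductSpace ℝ H] [Countable ι] (w : ι → H) (X : Ω → H)
    (hX : ∀ᵐ ω ∂P, HasSum (fun i => ξ i ω • w i) (X ω)) :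
    ∫⁻ ω, ENNReal.ofReal (‖X ω‖ ^ 2) ∂P ≤ ∑' i, ENNReal.ofReal (‖w i‖ ^ 2) := by
  classical
  -- No measurable structure on H is assumed, so measurability is read off from the Gram expansion
  -- of the squared norm.
  have hmeas : ∀ F : Finset ι,
      Measurable fun ω => ENNReal.ofReal (‖∑ i ∈ F, ξ i ω • w i‖ ^ 2) := by
    intro F
    have e : ∀ ω, ‖∑ i ∈ F, ξ i ω • w i‖ ^ 2
        = ∑ i ∈ F, ∑ j ∈ F, ξ i ω * ξ j ω * inner ℝ (w i) (w j) := by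
      intro ω
      rw [← real_inner_self_eq_norm_sq, sum_inner]
      refine Finset.sum_congr rfl fun i _ => ?_
      rw [inner_sum]
      refine Finset.sum_congr rfl fun j _ => ?_
      rw [real_inner_smul_left, real_inner_smul_right]
      ring
    simp_rw [e]
    refine ENNReal.measurable_ofReal.comp (Finset.measurable_sum _ fun i _ =>
      Finset.measurable_sum _ fun j _ => ?_)
    exact ((hξ.measurable i).mul (hξ.measurable j)).mul_const _
  -- Fatou's lemma along the finite subsets of ι; countability of ι makes this filter countably
  -- generated.
  calc ∫⁻ ω, ENNReal.ofReal (‖X ω‖ ^ 2) ∂P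
      ≤ ∫⁻ ω, Filter.liminf (fun F : Finset ι => ENNReal.ofReal (‖∑ i ∈ F, ξ i ω • w i‖ ^ 2))
          Filter.atTop ∂P := by
        refine lintegral_mono_ae ?_
        filter_upwards [hX] with ω hω
        have h1 : Filter.Tendsto (fun F : Finset ι => ENNReal.ofReal (‖∑ i ∈ F, ξ i ω • w i‖ ^ 2))
            Filter.atTop (nhds (ENNReal.ofReal (‖X ω‖ ^ 2))) :=
          ENNReal.tendsto_ofReal ((Filter.Tendsto.norm hω).pow 2)
        exact h1.liminf_eq.ge
    _ ≤ Filter.liminf (fun F : Finset ι => ∫⁻ ω, ENNReal.ofReal (‖∑ i ∈ F, ξ i ω • w i‖ ^ 2) ∂P)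
          Filter.atTop := lintegral_liminf_le hmeas
    _ = Filter.liminf (fun F : Finset ι => ∑ i ∈ F, ENNReal.ofReal (‖w i‖ ^ 2)) Filter.atTop := by
        simp_rw [hξ.lintegral_norm_sum_sq]
    _ ≤ ∑' i, ENNReal.ofReal (‖w i‖ ^ 2) :=
        (Filter.Tendsto.liminf_eq (ENNReal.summable (f := fun i =>
          ENNReal.ofReal (‖w i‖ ^ 2))).hasSum).le

theorem IsIIDStdNormal.lintegral_exp_sum (hξ : IsIIDStdNormal ξ P) (F : Finset ι) (c : ι → ℝ) :
    ∫⁻ ω, ENNReal.ofReal (exp (∑ i ∈ F, c i * ξ i ω)) ∂P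
      = ENNReal.ofReal (exp ((∑ i ∈ F, c i ^ 2) / 2)) := by
  have hind : iIndepFun (fun i ω => c i * ξ i ω) P :=
    hξ.indep.comp (fun i x => c i * x) (fun i => measurable_const_mul _)
  have h := hind.mgf_sum (t := 1) (fun i => (hξ.measurable i).const_mul _) F
  have hm : ∀ i, mgf (fun ω => c i * ξ i ω) P 1 = exp (c i ^ 2 / 2) := by
    intro i
    rw [mgf_const_mul, mgf_gaussianReal (hξ.law i)]
    simp
  simp_rw [hm, ← exp_sum, ← Finset.sum_div] at h
  rw [mgf] at h
  simp only [one_mul, Finset.sum_apply] at h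
  -- A non-integrable function has integral 0 by convention, whereas the moment generating function
  -- has just been found to be positive.
  have hInt : Integrable (fun ω => exp (∑ i ∈ F, c i * ξ i ω)) P := by
    by_contra hn
    rw [integral_undef hn] at h
    exact (exp_pos _).ne h
  rw [← ofReal_integral_eq_lintegral_ofReal hInt
    (Filter.Eventually.of_forall fun ω => (exp_pos _).le), h]

/-- One term of the exponential series at |y|, and exp |y| ≤ exp y + exp (-y). It converts
exponential moments into bounds on even moments. -/
theorem pow_two_mul_le_exp_add_exp (y : ℝ) (p : ℕ) :
    y ^ (2 * p) ≤ (2 * p).factorial * (exp y + exp (-y)) := by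
  have h := pow_div_factorial_le_exp (x := |y|) (abs_nonneg y) (2 * p)
  rw [div_le_iff₀ (by positivity), pow_mul, sq_abs, ← pow_mul] at h
  refine h.trans ?_
  rw [mul_comm]
  gcongr
  rcases abs_cases y with ⟨e, -⟩ | ⟨e, -⟩ <;> rw [e] <;>
    linarith [exp_pos y, exp_pos (-y)]

/-- Even moments of a finite Gaussian sum. -/
theorem IsIIDStdNormal.lintegral_sum_pow_le (hξ : IsIIDStdNormal ξ P) (F : Finset ι) (c : ι → ℝ)
    {σ : ℝ} (hσ : 0 < σ) (hc : ∑ i ∈ F, c i ^ 2 ≤ σ ^ 2) (p : ℕ) :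
    ∫⁻ ω, ENNReal.ofReal ((∑ i ∈ F, c i * ξ i ω) ^ (2 * p)) ∂P
      ≤ ENNReal.ofReal ((2 * p).factorial * (2 * exp 1) * σ ^ (2 * p)) := by
  -- After division by σ the sum has variance at most 1, so both exponential moments, τ = 1 and τ =
  -- -1, are at most e.
  have hexp : ∀ τ : ℝ, τ ^ 2 = 1 →
      ∫⁻ ω, ENNReal.ofReal (exp (∑ i ∈ F, τ * c i / σ * ξ i ω)) ∂P ≤ ENNReal.ofReal (exp 1) := by
    intro τ hτ
    rw [hξ.lintegral_exp_sum]
    refine ENNReal.ofReal_le_ofReal (exp_le_exp.2 ?_)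
    simp_rw [div_pow, mul_pow, hτ, one_mul]
    rw [← Finset.sum_div]
    have : (∑ i ∈ F, c i ^ 2) / σ ^ 2 ≤ 1 := by
      rw [div_le_one (by positivity)]; exact hc
    linarith
  have hm : ∀ τ : ℝ, Measurable fun ω => ENNReal.ofReal (exp (∑ i ∈ F, τ * c i / σ * ξ i ω)) :=
    fun τ => ENNReal.measurable_ofReal.comp (measurable_exp.comp
      (Finset.measurable_sum _ fun i _ => (hξ.measurable i).const_mul _))
  calc ∫⁻ ω, ENNReal.ofReal ((∑ i ∈ F, c i * ξ i ω) ^ (2 * p)) ∂P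
      ≤ ∫⁻ ω, ENNReal.ofReal ((2 * p).factorial * σ ^ (2 * p)) *
          (ENNReal.ofReal (exp (∑ i ∈ F, 1 * c i / σ * ξ i ω))
            + ENNReal.ofReal (exp (∑ i ∈ F, (-1) * c i / σ * ξ i ω))) ∂P := by
        refine lintegral_mono fun ω => ?_
        rw [← ENNReal.ofReal_add (exp_pos _).le (exp_pos _).le, ← ENNReal.ofReal_mul (by positivity)]
        refine ENNReal.ofReal_le_ofReal ?_
        have h := pow_two_mul_le_exp_add_exp ((∑ i ∈ F, c i * ξ i ω) / σ) p
        rw [div_pow, div_le_iff₀ (by positivity)] at h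
        have e : ∀ τ : ℝ, ∑ i ∈ F, τ * c i / σ * ξ i ω = τ * ((∑ i ∈ F, c i * ξ i ω) / σ) := by
          intro τ
          rw [Finset.sum_div, Finset.mul_sum]
          exact Finset.sum_congr rfl fun i _ => by ring
        rw [e, e, one_mul, neg_one_mul]
        calc _ ≤ _ := h
          _ = _ := by ring
    _ = ENNReal.ofReal ((2 * p).factorial * σ ^ (2 * p)) *
          (∫⁻ ω, ENNReal.ofReal (exp (∑ i ∈ F, 1 * c i / σ * ξ i ω)) ∂P
            + ∫⁻ ω, ENNReal.ofReal (exp (∑ i ∈ F, (-1) * c i / σ * ξ i ω)) ∂P) := by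
        rw [lintegral_const_mul' _ _ ENNReal.ofReal_ne_top, lintegral_add_left (hm 1)]
    _ ≤ ENNReal.ofReal ((2 * p).factorial * σ ^ (2 * p)) *
          (ENNReal.ofReal (exp 1) + ENNReal.ofReal (exp 1)) := by
        gcongr
        · exact hexp 1 (by norm_num)
        · exact hexp (-1) (by norm_num)
    _ = _ := by
        rw [← ENNReal.ofReal_add (exp_pos _).le (exp_pos _).le, ← ENNReal.ofReal_mul (by positivity)]
        congr 1; ring

/-- Cauchy–Schwarz, losing a factor `F.card`. This loss is harmless, since the estimate only
controls the deviation from a very fine net. -/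
theorem IsIIDStdNormal.lintegral_sum_abs_sq_le (hξ : IsIIDStdNormal ξ P) (F : Finset ι)
    (b : ι → ℝ) :
    ∫⁻ ω, ENNReal.ofReal ((∑ i ∈ F, |b i * ξ i ω|) ^ 2) ∂P
      ≤ ENNReal.ofReal (F.card * ∑ i ∈ F, b i ^ 2) := by
  calc ∫⁻ ω, ENNReal.ofReal ((∑ i ∈ F, |b i * ξ i ω|) ^ 2) ∂P
      ≤ ∫⁻ ω, ENNReal.ofReal F.card * ∑ i ∈ F, ENNReal.ofReal ((b i * ξ i ω) ^ 2) ∂P := by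
        refine lintegral_mono fun ω => ?_
        rw [← ENNReal.ofReal_sum_of_nonneg (fun _ _ => sq_nonneg _),
          ← ENNReal.ofReal_mul (by positivity)]
        refine ENNReal.ofReal_le_ofReal (sq_sum_le_card_mul_sum_sq.trans_eq ?_)
        simp_rw [sq_abs]
    _ = ENNReal.ofReal (F.card * ∑ i ∈ F, b i ^ 2) := by
        have hm : ∀ i ∈ F, Measurable fun ω => ENNReal.ofReal ((b i * ξ i ω) ^ 2) := fun i _ =>
          ENNReal.measurable_ofReal.comp (((hξ.measurable i).const_mul _).pow_const 2)
        rw [lintegral_const_mul _ (Finset.measurable_sum _ hm), lintegral_finsetSum _ hm]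
        simp_rw [hξ.lintegral_sq]
        rw [← ENNReal.ofReal_sum_of_nonneg (fun _ _ => sq_nonneg _),
          ← ENNReal.ofReal_mul (by positivity)]

end Gaussian

/-! ### Suprema of Gaussian trigonometric sums -/

/-- The product of the waves `g d` with the frequencies of `cosProd`. -/
def waveProd {D : ℕ} (g : Fin D → ℝ → ℝ) (L : Fin D → ℝ) (i : Fin D → ℕ) (x : Fin D → ℝ) : ℝ :=
  ∏ d, g d ((i d : ℝ) * π * x d / L d)

/-- Waves bounded by one, with Lipschitz constant one and period `2 π`. -/
structure IsWave (g : ℝ → ℝ) : Prop where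
  abs_le_one : ∀ r, |g r| ≤ 1
  lipschitz : ∀ r r', |g r - g r'| ≤ |r - r'|
  periodic : Function.Periodic g (2 * π)

theorem isWave_cos : IsWave cos :=
  ⟨abs_cos_le_one, fun r r' => by
    simpa [Real.dist_eq] using lipschitzWith_cos.dist_le_mul r r', cos_periodic⟩

theorem isWave_sin : IsWave sin :=
  ⟨abs_sin_le_one, fun r r' => by
    simpa [Real.dist_eq] using lipschitzWith_sin.dist_le_mul r r', sin_periodic⟩

theorem abs_waveProd_le_one {D : ℕ} {g : Fin D → ℝ → ℝ} (hg : ∀ d, IsWave (g d)) (L : Fin D → ℝ)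
    (i : Fin D → ℕ) (x : Fin D → ℝ) : |waveProd g L i x| ≤ 1 := by
  rw [waveProd, Finset.abs_prod]
  exact Finset.prod_le_one (fun _ _ => abs_nonneg _) fun d _ => (hg d).abs_le_one _

/-- Every point is within one cell of a point of a regular periodic grid, as far as wave products
of bounded frequency are concerned. -/
theorem exists_net_point {D : ℕ} {g : Fin D → ℝ → ℝ} (hg : ∀ d, IsWave (g d)) {L : Fin D → ℝ}
    (hL : ∀ d, 0 < L d) {M : ℕ} (hM : 0 < M) (N : ℕ) (x : Fin D → ℝ) :
    ∃ j : Fin D → Fin M, ∀ i : Fin D → ℕ, (∀ d, i d ≤ N) →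
      |waveProd g L i x - waveProd g L i (fun d => 2 * L d * (j d : ℕ) / M)| ≤ D * (2 * π * N / M) := by
  have hM0 : (0 : ℝ) < M := by exact_mod_cast hM
  have hMz : (0 : ℤ) < M := by exact_mod_cast hM
  -- The grid has step 2 L_d / M. Since 2 L_d is a common period of all the waves in direction d,
  -- the cell number may be reduced modulo M, so finitely many points serve all of space.
  set q : Fin D → ℤ := fun d => ⌊x d * M / (2 * L d)⌋ with hq
  have hmod : ∀ d, ((q d % M).toNat : ℤ) = q d % M := fun d =>
    Int.toNat_of_nonneg (Int.emod_nonneg _ hMz.ne')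
  refine ⟨fun d => ⟨(q d % M).toNat, ?_⟩, fun i hi => ?_⟩
  · have := Int.emod_lt_of_pos (q d) hMz
    have := hmod d
    omega
  refine (abs_prod_sub_prod_le Finset.univ le_rfl (fun d _ => (hg d).abs_le_one _)
    (fun d _ => (hg d).abs_le_one _)).trans ?_
  rw [one_pow, one_mul]
  refine (Finset.sum_le_card_nsmul _ _ (2 * π * N / M) fun d _ => ?_).trans_eq (by simp)
  have hLd := hL d
  have hper : g d ((i d : ℝ) * π * (2 * L d * ((q d % M).toNat : ℕ) / M) / L d)
      = g d ((i d : ℝ) * π * (2 * L d * (q d) / M) / L d) := by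
    have h1 : (q d : ℝ) = ((q d % M).toNat : ℕ) + M * ((q d / M : ℤ) : ℝ) := by
      have h2 : q d = ((q d % M).toNat : ℤ) + M * (q d / M) := by
        rw [hmod]; exact (Int.emod_add_mul_ediv (q d) M).symm
      exact_mod_cast h2
    have h3 : (i d : ℝ) * π * (2 * L d * (q d) / M) / L d
        = (i d : ℝ) * π * (2 * L d * ((q d % M).toNat : ℕ) / M) / L d
          + ((i d * (q d / M) : ℤ) : ℝ) * (2 * π) := by
      rw [h1]; push_cast; field_simp
    rw [h3]
    exact ((hg d).periodic.int_mul _ _).symm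
  simp only
  rw [hper]
  refine ((hg d).lipschitz _ _).trans ?_
  have hfl := Int.floor_le (x d * M / (2 * L d))
  have hlt := Int.lt_floor_add_one (x d * M / (2 * L d))
  have e : (i d : ℝ) * π * x d / L d - (i d : ℝ) * π * (2 * L d * (q d) / M) / L d
      = 2 * π * i d / M * (x d * M / (2 * L d) - q d) := by
    field_simp
  rw [e, abs_mul, abs_of_nonneg (by positivity)]
  have h4 : |x d * M / (2 * L d) - q d| ≤ 1 := by
    rw [abs_of_nonneg (by simp only [hq]; linarith)]
    simp only [hq]; linarith
  have h5 : (i d : ℝ) ≤ N := by exact_mod_cast hi d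
  calc _ ≤ 2 * π * i d / M * 1 := by gcongr
    _ ≤ _ := by rw [mul_one]; gcongr


/-- Replaces a maximum over the net by a sum of p-th powers, whose expectation can be computed term
by term. -/
theorem le_mul_one_add_pow {y T : ℝ} (hy : 0 ≤ y) (hT : 0 < T) {p : ℕ} (hp : 1 ≤ p) :
    y ≤ T * (1 + (y / T) ^ p) := by
  have h : y / T ≤ 1 + (y / T) ^ p := by
    rcases le_or_gt (y / T) 1 with h | h
    · have : 0 ≤ (y / T) ^ p := by positivity
      linarith
    · have := le_self_pow₀ h.le (by omega : p ≠ 0)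
      linarith
  calc y = T * (y / T) := by field_simp
    _ ≤ _ := by gcongr

/-- The supremum of a Gaussian sum of wave products with frequencies below `2 ^ n` and coefficients
bounded by `B` is, in mean square, at most of the order `B ^ 2 * 2 ^ (n * (D + ε))`. -/
theorem exists_sup_bound (D : ℕ) {ε : ℝ} (hε : 0 < ε) :
    ∃ C : ℝ, 0 < C ∧ ∀ {Ω : Type*} [MeasurableSpace Ω] {P : Measure Ω} [IsProbabilityMeasure P]
      {ξ : (Fin D → ℕ) → Ω → ℝ}, IsIIDStdNormal ξ P → ∀ {L : Fin D → ℝ}, (∀ d, 0 < L d) →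
      ∀ {g : Fin D → ℝ → ℝ}, (∀ d, IsWave (g d)) → ∀ (n : ℕ) (F : Finset (Fin D → ℕ)),
      F ⊆ dyadicBox D n → ∀ (b : (Fin D → ℕ) → ℝ) (B : ℝ), 0 < B → (∀ i ∈ F, |b i| ≤ B) →
      ∃ Q : Ω → ℝ, Measurable Q ∧ (∀ ω, 0 ≤ Q ω) ∧
        (∀ ω x, (∑ i ∈ F, b i * ξ i ω * waveProd g L i x) ^ 2 ≤ Q ω) ∧
        ∫⁻ ω, ENNReal.ofReal (Q ω) ∂P ≤ ENNReal.ofReal (C * (B ^ 2 * 2 ^ ((n : ℝ) * (D + ε)))) := by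
  obtain ⟨p, hp⟩ : ∃ p : ℕ, (D * (D + 1) : ℝ) / ε ≤ p := exists_nat_ge _
  -- The net will have 2^(nD(D+1)) points, while each p-th moment gains 2^(-npε). This choice of p
  -- lets the gain absorb the number of points.
  obtain ⟨p, hp1, hp⟩ : ∃ p : ℕ, 1 ≤ p ∧ (D * (D + 1) : ℝ) ≤ p * ε := by
    refine ⟨p + 1, by omega, ?_⟩
    rw [div_le_iff₀ hε] at hp
    push_cast; nlinarith
  set c : ℝ := (2 * p).factorial * (2 * exp 1) with hc
  have hc0 : 0 < c := by positivity
  refine ⟨2 * (1 + c) + 2 * (D * (2 * π)) ^ 2, by positivity, ?_⟩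
  intro Ω _ P _ ξ hξ L hL g hg n F hF b B hB hb
  set N : ℝ := 2 ^ n with hN
  have hN1 : 1 ≤ N := one_le_pow₀ (by norm_num)
  have hN0 : 0 < N := by linarith
  -- The net is fine enough that the oscillation factor A times the bound N^D on the number of terms
  -- is the constant 2πD.
  set M : ℕ := (2 ^ n) ^ (D + 1) with hMdef
  have hM : 0 < M := by positivity
  have hMN : (M : ℝ) = N ^ (D + 1) := by rw [hMdef, hN]; push_cast; rfl
  set T : ℝ := B ^ 2 * 2 ^ ((n : ℝ) * (D + ε)) with hT
  have hT0 : 0 < T := by positivity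
  obtain ⟨X, hX⟩ : ∃ X : (Fin D → Fin M) → Ω → ℝ, X = fun j ω =>
      ∑ i ∈ F, b i * waveProd g L i (fun d => 2 * L d * (j d : ℕ) / M) * ξ i ω := ⟨_, rfl⟩
  have hXm : ∀ j, Measurable (X j) := by
    intro j
    rw [hX]
    exact Finset.measurable_sum _ fun i _ => (hξ.measurable i).const_mul _
  obtain ⟨S, hS⟩ : ∃ S : Ω → ℝ, S = fun ω => ∑ i ∈ F, |b i * ξ i ω| := ⟨_, rfl⟩
  have hSm : Measurable S := by
    rw [hS]
    exact Finset.measurable_sum _ fun i _ => measurable_norm.comp ((hξ.measurable i).const_mul _)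
  set A : ℝ := D * (2 * π * N / M) with hA
  have hcard : (F.card : ℝ) ≤ N ^ D := by
    have h := Finset.card_le_card hF
    rw [dyadicBox, Fintype.card_piFinset_const] at h
    simp only [Finset.card_range] at h
    rw [hN]; exact_mod_cast h
  have hND : N ^ D = 2 ^ ((n : ℝ) * D) := by
    rw [hN, Real.rpow_mul (by norm_num), Real.rpow_natCast, Real.rpow_natCast]
  -- The majorant is a finite expression in ξ: the first part dominates the values on the net, the
  -- second the deviation from it. It is measurable by construction, so measurability of the
  -- supremum over x never arises.
  refine ⟨fun ω => 2 * (T * (1 + ∑ j, (X j ω ^ 2 / T) ^ p)) + 2 * (A ^ 2 * S ω ^ 2), ?_, ?_, ?_, ?_⟩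
  · refine Measurable.add (Measurable.const_mul (Measurable.const_mul (Measurable.const_add
      (Finset.measurable_sum _ fun j _ => ?_) _) _) _) (((hSm.pow_const 2).const_mul _).const_mul _)
    exact (((hXm j).pow_const 2).div_const T).pow_const p
  · intro ω
    have : 0 ≤ ∑ j, (X j ω ^ 2 / T) ^ p := Finset.sum_nonneg fun j _ => by positivity
    positivity
  · intro ω x
    obtain ⟨j, hj⟩ := exists_net_point hg hL hM (2 ^ n) x
    have h1 : |∑ i ∈ F, b i * ξ i ω * waveProd g L i x - X j ω| ≤ A * S ω := by
      rw [hX, hS]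
      simp only
      rw [← Finset.sum_sub_distrib, Finset.mul_sum]
      refine (Finset.abs_sum_le_sum_abs _ _).trans (Finset.sum_le_sum fun i hi => ?_)
      have hi' : ∀ d, i d ≤ 2 ^ n := fun d => (mem_dyadicBox.1 (hF hi) d).le
      have h2 := hj i hi'
      have e : b i * ξ i ω * waveProd g L i x
          - b i * waveProd g L i (fun d => 2 * L d * (j d : ℕ) / M) * ξ i ω
          = (waveProd g L i x - waveProd g L i (fun d => 2 * L d * (j d : ℕ) / M))
            * (b i * ξ i ω) := by ring
      rw [e, abs_mul]
      refine mul_le_mul_of_nonneg_right ?_ (abs_nonneg _)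
      rw [hA, hN]
      exact_mod_cast h2
    have h3 : X j ω ^ 2 ≤ T * (1 + ∑ j, (X j ω ^ 2 / T) ^ p) := by
      refine (le_mul_one_add_pow (sq_nonneg _) hT0 hp1).trans ?_
      gcongr
      exact Finset.single_le_sum (f := fun j => (X j ω ^ 2 / T) ^ p) (fun j _ => by positivity)
        (Finset.mem_univ j)
    have h4 : (∑ i ∈ F, b i * ξ i ω * waveProd g L i x - X j ω) ^ 2 ≤ A ^ 2 * S ω ^ 2 := by
      rw [← mul_pow, ← sq_abs]
      exact pow_le_pow_left₀ (abs_nonneg _) h1 2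
    have h5 := add_sq_le (a := X j ω) (b := ∑ i ∈ F, b i * ξ i ω * waveProd g L i x - X j ω)
    rw [add_sub_cancel] at h5
    linarith
  -- A net value is a Gaussian sum of variance at most B² N^D, that is T 2^(-nε), so the p-th moment
  -- of X²/T is O(2^(-npε)).
  · have hXp : ∀ j, ∫⁻ ω, ENNReal.ofReal ((X j ω ^ 2 / T) ^ p) ∂P
        ≤ ENNReal.ofReal (c * ((2 : ℝ) ^ (-((n : ℝ) * (D * (D + 1)))))) := by
      intro j
      set σ : ℝ := B * 2 ^ ((n : ℝ) * D / 2) with hσ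
      have hσ0 : 0 < σ := by positivity
      have hσ2 : σ ^ 2 = B ^ 2 * N ^ D := by
        rw [hσ, mul_pow, hND, ← Real.rpow_natCast (2 ^ ((n : ℝ) * D / 2)) 2,
          ← Real.rpow_mul (by norm_num)]
        congr 2; push_cast; ring
      have hle : ∑ i ∈ F, (b i * waveProd g L i (fun d => 2 * L d * (j d : ℕ) / M)) ^ 2
          ≤ σ ^ 2 := by
        calc _ ≤ ∑ i ∈ F, B ^ 2 := by
              refine Finset.sum_le_sum fun i hi => ?_
              rw [← sq_abs, abs_mul]
              refine pow_le_pow_left₀ (by positivity) ?_ 2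
              calc _ ≤ B * 1 := mul_le_mul (hb i hi) (abs_waveProd_le_one hg L i _)
                    (abs_nonneg _) hB.le
                _ = B := mul_one B
          _ = F.card * B ^ 2 := by simp
          _ ≤ _ := by rw [hσ2, mul_comm]; gcongr
      have h := hξ.lintegral_sum_pow_le F _ hσ0 hle p
      have e : ∀ ω, (X j ω ^ 2 / T) ^ p = (T ^ p)⁻¹ * X j ω ^ (2 * p) := by
        intro ω; rw [div_pow, pow_mul]; field_simp
      simp_rw [e]
      simp_rw [ENNReal.ofReal_mul (inv_nonneg.2 (pow_nonneg hT0.le p))]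
      rw [lintegral_const_mul' _ _ ENNReal.ofReal_ne_top]
      rw [hX]
      refine (mul_le_mul_right h _).trans ?_
      rw [← ENNReal.ofReal_mul (by positivity)]
      refine ENNReal.ofReal_le_ofReal ?_
      rw [← hc, pow_mul, hσ2]
      have e2 : (T ^ p)⁻¹ * (c * (B ^ 2 * N ^ D) ^ p) = c * (2 : ℝ) ^ (-((n : ℝ) * (p * ε))) := by
        have e3 : T = B ^ 2 * N ^ D * 2 ^ ((n : ℝ) * ε) := by
          rw [hT, hND, mul_assoc, ← Real.rpow_add (by norm_num)]; congr 2; ring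
        have e4 : (2 : ℝ) ^ (-((n : ℝ) * (p * ε))) = ((2 ^ ((n : ℝ) * ε)) ^ p)⁻¹ := by
          rw [Real.rpow_neg (by norm_num), ← Real.rpow_natCast (2 ^ ((n : ℝ) * ε)) p,
            ← Real.rpow_mul (by norm_num)]
          congr 2; ring
        rw [e3, e4]
        have : (2 : ℝ) ^ ((n : ℝ) * ε) ≠ 0 := by positivity
        rw [mul_pow (B ^ 2 * N ^ D)]
        field_simp
      rw [e2]
      gcongr
      norm_num
    have hcardJ : (Fintype.card (Fin D → Fin M) : ℝ) = 2 ^ ((n : ℝ) * (D * (D + 1))) := by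
      rw [Fintype.card_fun, Fintype.card_fin, Fintype.card_fin]
      push_cast
      rw [hMN, hN, ← pow_mul, ← pow_mul, ← Real.rpow_natCast]
      congr 1; push_cast; ring
    have hsum : ∑ j, ∫⁻ ω, ENNReal.ofReal ((X j ω ^ 2 / T) ^ p) ∂P ≤ ENNReal.ofReal c := by
      refine (Finset.sum_le_card_nsmul _ _ _ fun j _ => hXp j).trans ?_
      rw [Finset.card_univ, nsmul_eq_mul, ← ENNReal.ofReal_natCast,
        ← ENNReal.ofReal_mul (by positivity), hcardJ, Real.rpow_neg (by norm_num)]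
      refine ENNReal.ofReal_le_ofReal (le_of_eq ?_)
      have : (2 : ℝ) ^ ((n : ℝ) * (D * (D + 1))) ≠ 0 := by positivity
      field_simp
    have hS2 : ∫⁻ ω, ENNReal.ofReal (S ω ^ 2) ∂P ≤ ENNReal.ofReal ((N ^ D) ^ 2 * B ^ 2) := by
      rw [hS]
      refine (hξ.lintegral_sum_abs_sq_le F b).trans (ENNReal.ofReal_le_ofReal ?_)
      calc (F.card : ℝ) * ∑ i ∈ F, b i ^ 2 ≤ F.card * ∑ i ∈ F, B ^ 2 := by
            refine mul_le_mul_of_nonneg_left (Finset.sum_le_sum fun i hi => ?_) (Nat.cast_nonneg _)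
            rw [← sq_abs (b i)]; exact pow_le_pow_left₀ (abs_nonneg _) (hb i hi) 2
        _ = (F.card : ℝ) ^ 2 * B ^ 2 := by simp; ring
        _ ≤ _ := by gcongr
    have hXpm : ∀ j, Measurable fun ω => ENNReal.ofReal ((X j ω ^ 2 / T) ^ p) := fun j =>
      ENNReal.measurable_ofReal.comp ((((hXm j).pow_const 2).div_const T).pow_const p)
    have hAN : A ^ 2 * ((N ^ D) ^ 2 * B ^ 2) ≤ (D * (2 * π)) ^ 2 * T := by
      have e1 : A * N ^ D = D * (2 * π) := by
        rw [hA, hMN, pow_succ]; field_simp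
      have e2 : A ^ 2 * ((N ^ D) ^ 2 * B ^ 2) = (D * (2 * π)) ^ 2 * (B ^ 2 * 1) := by
        rw [← e1]; ring
      rw [e2, hT]
      gcongr
      exact Real.one_le_rpow (by norm_num) (by positivity)
    calc ∫⁻ ω, ENNReal.ofReal (2 * (T * (1 + ∑ j, (X j ω ^ 2 / T) ^ p)) + 2 * (A ^ 2 * S ω ^ 2)) ∂P
        = ∫⁻ ω, ENNReal.ofReal (2 * T) * (1 + ∑ j, ENNReal.ofReal ((X j ω ^ 2 / T) ^ p))
            + ENNReal.ofReal (2 * A ^ 2) * ENNReal.ofReal (S ω ^ 2) ∂P := by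
          refine lintegral_congr fun ω => ?_
          have h0 : 0 ≤ ∑ j, (X j ω ^ 2 / T) ^ p := Finset.sum_nonneg fun j _ => by positivity
          rw [ENNReal.ofReal_add (by positivity) (by positivity), ← mul_assoc 2 T, ← mul_assoc 2 (A ^ 2),
            ENNReal.ofReal_mul (by positivity : 0 ≤ 2 * T),
            ENNReal.ofReal_mul (by positivity : 0 ≤ 2 * A ^ 2),
            ENNReal.ofReal_add zero_le_one h0, ENNReal.ofReal_one,
            ENNReal.ofReal_sum_of_nonneg (fun j _ => by positivity)]
      _ = ENNReal.ofReal (2 * T) * (1 + ∑ j, ∫⁻ ω, ENNReal.ofReal ((X j ω ^ 2 / T) ^ p) ∂P)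
            + ENNReal.ofReal (2 * A ^ 2) * ∫⁻ ω, ENNReal.ofReal (S ω ^ 2) ∂P := by
          have hSm2 : Measurable fun ω => ENNReal.ofReal (2 * A ^ 2) * ENNReal.ofReal (S ω ^ 2) :=
            (ENNReal.measurable_ofReal.comp (hSm.pow_const 2)).const_mul _
          rw [lintegral_add_right _ hSm2,
            lintegral_const_mul' _ _ ENNReal.ofReal_ne_top,
            lintegral_const_mul' _ _ ENNReal.ofReal_ne_top,
            lintegral_add_left measurable_const, lintegral_finsetSum _ fun j _ => hXpm j]
          simp
      _ ≤ ENNReal.ofReal (2 * T) * (ENNReal.ofReal 1 + ENNReal.ofReal c)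
            + ENNReal.ofReal (2 * A ^ 2) * ENNReal.ofReal ((N ^ D) ^ 2 * B ^ 2) := by
          rw [ENNReal.ofReal_one]
          gcongr
      _ = ENNReal.ofReal (2 * T * (1 + c) + 2 * A ^ 2 * ((N ^ D) ^ 2 * B ^ 2)) := by
          rw [← ENNReal.ofReal_add zero_le_one hc0.le, ← ENNReal.ofReal_mul (by positivity),
            ← ENNReal.ofReal_mul (by positivity), ← ENNReal.ofReal_add (by positivity) (by positivity)]
      _ ≤ _ := by
          refine ENNReal.ofReal_le_ofReal ?_
          nlinarith [hAN]

/-- Block n is contained in the box of level n + 1; the shift by one costs the factor 2^(D + ε). -/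
theorem exists_block_sup_bound (D : ℕ) {ε : ℝ} (hε : 0 < ε) :
    ∃ C : ℝ, 0 < C ∧ ∀ {Ω : Type*} [MeasurableSpace Ω] {P : Measure Ω} [IsProbabilityMeasure P]
      {ξ : (Fin D → ℕ) → Ω → ℝ}, IsIIDStdNormal ξ P → ∀ {L : Fin D → ℝ}, (∀ d, 0 < L d) →
      ∀ {g : Fin D → ℝ → ℝ}, (∀ d, IsWave (g d)) → ∀ (n : ℕ) (b : (Fin D → ℕ) → ℝ) (B : ℝ),
      0 < B → (∀ i ∈ dyadicBlock D n, |b i| ≤ B) →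
      ∃ Q : Ω → ℝ, Measurable Q ∧ (∀ ω, 0 ≤ Q ω) ∧
        (∀ ω x, (∑ i ∈ dyadicBlock D n, b i * ξ i ω * waveProd g L i x) ^ 2 ≤ Q ω) ∧
        ∫⁻ ω, ENNReal.ofReal (Q ω) ∂P ≤ ENNReal.ofReal (C * (B ^ 2 * 2 ^ ((n : ℝ) * (D + ε)))) := by
  obtain ⟨C, hC, h⟩ := exists_sup_bound D hε
  refine ⟨C * 2 ^ (D + ε), by positivity, ?_⟩
  intro Ω _ P _ ξ hξ L hL g hg n b B hB hb
  obtain ⟨Q, hQm, hQ0, hQ, hInt⟩ := h hξ hL hg (n + 1) (dyadicBlock D n) Finset.sdiff_subset b B hB hb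
  refine ⟨Q, hQm, hQ0, hQ, hInt.trans_eq ?_⟩
  have e : ((n + 1 : ℕ) : ℝ) * (D + ε) = n * (D + ε) + (D + ε) := by push_cast; ring
  rw [e, Real.rpow_add (by norm_num)]
  congr 1; ring


/-! ### Coefficients of the field and of its finite element representation -/

/-- The coefficient of `ξ_i * cosProd L i` in the field, up to the power of `κ`. -/
def specCoef {D : ℕ} (L : Fin D → ℝ) (s κ : ℝ) (i : Fin D → ℕ) : ℝ :=
  (κ ^ 2 + eigval L i) ^ (-s / 2) * ∏ d, cosNormConst (L d) (i d)

/-- The coefficient of `ξ_i * ∏ d, feShape (L d) (K d) (i d)` in the finite element field, up to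
the power of `κ`. -/
def feCoef {D : ℕ} (L : Fin D → ℝ) (s κ : ℝ) (K i : Fin D → ℕ) : ℝ :=
  (κ ^ 2 + feEigval L K i) ^ (-s / 2) * ∏ d, feNormConst (L d) (K d) (i d)

theorem abs_rpow_neg_sub_le {a m x y : ℝ} (ha : 0 < a) (hm : 0 < m) (hx : m ≤ x) (hy : m ≤ y) :
    |x ^ (-a) - y ^ (-a)| ≤ a * m ^ (-a - 1) * |x - y| := by
  refine Convex.norm_image_sub_le_of_norm_hasDerivWithin_le (s := Ici m)
    (f := fun r : ℝ => r ^ (-a)) (f' := fun r => -a * r ^ (-a - 1)) (fun r hr => ?_)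
    (fun r hr => ?_) (convex_Ici m) hy hx
  · exact (Real.hasDerivAt_rpow_const (Or.inl (hm.trans_le hr).ne')).hasDerivWithinAt
  · have hr0 : 0 < r := hm.trans_le hr
    rw [norm_mul, norm_neg, Real.norm_of_nonneg ha.le, Real.norm_of_nonneg (by positivity)]
    exact mul_le_mul_of_nonneg_left (Real.rpow_le_rpow_of_nonpos hm hr (by linarith)) ha.le

section Coefficients

variable {D : ℕ} {L : Fin D → ℝ}

theorem width_le_meshSize (L : Fin D → ℝ) (K : Fin D → ℕ) (d : Fin D) :
    width L K d ≤ meshSize L K :=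
  le_ciSup (f := width L K) (Set.finite_range _).bddAbove d

theorem width_pos (hL : ∀ d, 0 < L d) {K : Fin D → ℕ} (hK : ∀ d, 1 ≤ K d) (d : Fin D) :
    0 < width L K d :=
  div_pos (hL d) (by exact_mod_cast hK d)

theorem meshSize_pos (hD : 1 ≤ D) (hL : ∀ d, 0 < L d) {K : Fin D → ℕ} (hK : ∀ d, 1 ≤ K d) :
    0 < meshSize L K :=
  (width_pos hL hK ⟨0, hD⟩).trans_le (width_le_meshSize L K _)

theorem exists_length_bound (hL : ∀ d, 0 < L d) :
    ∃ R : ℝ, 1 ≤ R ∧ ∀ d, L d ≤ R ∧ (L d)⁻¹ ≤ R := by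
  refine ⟨1 + ∑ d, L d + ∑ d, (L d)⁻¹, ?_, fun d => ?_⟩
  · have h1 : 0 ≤ ∑ d, L d := Finset.sum_nonneg fun d _ => (hL d).le
    have h2 : 0 ≤ ∑ d, (L d)⁻¹ := Finset.sum_nonneg fun d _ => inv_nonneg.2 (hL d).le
    linarith
  · have h1 : L d ≤ ∑ d, L d := Finset.single_le_sum (fun d _ => (hL d).le) (Finset.mem_univ d)
    have h2 : (L d)⁻¹ ≤ ∑ d, (L d)⁻¹ :=
      Finset.single_le_sum (fun d _ => inv_nonneg.2 (hL d).le) (Finset.mem_univ d)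
    have h3 := hL d
    have h4 : 0 < (L d)⁻¹ := inv_pos.2 h3
    constructor <;> linarith

theorem meshSize_le (hD : 1 ≤ D) (hL : ∀ d, 0 < L d) {K : Fin D → ℕ} (hK : ∀ d, 1 ≤ K d) {R : ℝ}
    (hR : ∀ d, L d ≤ R) : meshSize L K ≤ R := by
  have : Nonempty (Fin D) := ⟨⟨0, hD⟩⟩
  refine ciSup_le fun d => (div_le_self (hL d).le ?_).trans (hR d)
  exact_mod_cast hK d

theorem frequency_le (hL : ∀ d, 0 < L d) {R : ℝ} (hR : ∀ d, (L d)⁻¹ ≤ R) {n : ℕ} {i : Fin D → ℕ}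
    (hi : i ∈ dyadicBlock D n) (d : Fin D) : (i d : ℝ) * π / L d ≤ 8 * R * 2 ^ n := by
  have h1 : (i d : ℝ) ≤ 2 * 2 ^ n := by
    have := ((mem_dyadicBlock.1 hi).1 d).le
    rw [pow_succ, mul_comm] at this
    exact_mod_cast this
  have h2 : 0 < (L d)⁻¹ := inv_pos.2 (hL d)
  rw [div_eq_mul_inv]
  calc (i d : ℝ) * π * (L d)⁻¹ ≤ 2 * 2 ^ n * 4 * R := by
        gcongr
        · exact pi_le_four
        · exact hR d
    _ = _ := by ring

/-- The largest entry alone gives the bound. The factor π is kept to cancel the 4/π² lost in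
`feEigval_ge`. -/
theorem eigval_ge (hL : ∀ d, 0 < L d) {R : ℝ} (hR : ∀ d, L d ≤ R) {n : ℕ} {i : Fin D → ℕ}
    (hi : i ∈ dyadicBlock D n) : (π * (2 ^ n / R)) ^ 2 ≤ eigval L i := by
  obtain ⟨d, hd⟩ := (mem_dyadicBlock.1 hi).2
  refine le_trans ?_ (Finset.single_le_sum (f := fun d => ((i d : ℝ) * π / L d) ^ 2)
    (fun _ _ => sq_nonneg _) (Finset.mem_univ d))
  have h0 := hL d
  have h1 : (2 : ℝ) ^ n ≤ i d := by exact_mod_cast hd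
  have hR0 : 0 < R := h0.trans_le (hR d)
  have h2 : π * (2 ^ n / R) ≤ (i d : ℝ) * π / L d := by
    calc π * (2 ^ n / R) ≤ π * (i d / L d) := by gcongr; exact hR d
      _ = _ := by ring
  exact pow_le_pow_left₀ (by positivity) h2 2

theorem feEigval_ge (hL : ∀ d, 0 < L d) {K i : Fin D → ℕ} (hK : ∀ d, 1 ≤ K d)
    (hi : ∀ d, i d ≤ K d) : 4 / π ^ 2 * eigval L i ≤ feEigval L K i := by
  rw [eigval, feEigval, Finset.mul_sum]
  exact Finset.sum_le_sum fun d _ => feEigval₁_ge (hL d) (hi d) (hK d)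

theorem eigval_nonneg (L : Fin D → ℝ) (i : Fin D → ℕ) : 0 ≤ eigval L i :=
  Finset.sum_nonneg fun _ _ => sq_nonneg _

/-- Constants are reproduced exactly: both eigenvalues are 0 and the normalizations agree. So the
one mode whose coefficient blows up as κ → 0 is absent from the error. -/
theorem specCoef_zero_eq (hL : ∀ d, 0 < L d) {K : Fin D → ℕ} (hK : ∀ d, 1 ≤ K d) (s κ : ℝ) :
    feCoef L s κ K 0 = specCoef L s κ 0 := by
  have h1 : feEigval L K 0 = eigval L 0 := by
    simp [feEigval, eigval, feEigval₁]
  have h2 : ∀ d, feNormConst (L d) (K d) 0 = cosNormConst (L d) 0 := by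
    intro d
    have := feNormConst_sub_le (hL d) (Nat.zero_le (K d)) (hK d)
    simp only [Nat.cast_zero, zero_mul, zero_div, ne_eq, OfNat.ofNat_ne_zero, not_false_eq_true,
      zero_pow, mul_zero] at this
    exact sub_eq_zero.1 (abs_nonpos_iff.1 this)
  rw [feCoef, specCoef, h1]
  congr 1
  exact Finset.prod_congr rfl fun d _ => h2 d

theorem rpow_block {R s : ℝ} (hR : 0 < R) (n : ℕ) :
    ((2 ^ n / R) ^ 2 : ℝ) ^ (-s / 2) = R ^ s * 2 ^ ((n : ℝ) * (-s)) := by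
  have h : (0 : ℝ) ≤ 2 ^ n / R := by positivity
  rw [← Real.rpow_natCast (2 ^ n / R) 2, ← Real.rpow_mul h, Real.div_rpow (by positivity) hR.le,
    two_rpow_natCast_mul, ← Real.rpow_natCast 2 n, ← Real.rpow_mul (by norm_num),
    ← two_rpow_natCast_mul]
  have e : ((2 : ℕ) : ℝ) * (-s / 2) = -s := by push_cast; ring
  rw [e, Real.rpow_neg hR.le, div_inv_eq_mul, mul_comm]

/-- Uniform bounds for the coefficients on a dyadic block. -/
theorem coef_bounds (hL : ∀ d, 0 < L d) {s : ℝ} (hs : 0 < s) :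
    ∃ C : ℝ, 0 < C ∧ ∀ κ : ℝ, ∀ n : ℕ, ∀ i ∈ dyadicBlock D n,
      |specCoef L s κ i| ≤ C * 2 ^ ((n : ℝ) * (-s)) ∧
      (∀ d, |specCoef L s κ i * (i d * π / L d)| ≤ C * 2 ^ ((n : ℝ) * (1 - s))) ∧
      ∀ K : Fin D → ℕ, (∀ d, 1 ≤ K d) → (∀ d, i d ≤ K d) →
        |feCoef L s κ K i - specCoef L s κ i| ≤ C * (meshSize L K ^ 2 * 2 ^ ((n : ℝ) * (2 - s))) ∧
        ∀ d, |feCoef L s κ K i * (i d * π / L d) ^ 2| * width L K d ^ 2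
          ≤ C * (meshSize L K ^ 2 * 2 ^ ((n : ℝ) * (2 - s))) := by
  obtain ⟨R, hR1, hR⟩ := exists_length_bound hL
  have hR0 : 0 < R := by linarith
  obtain ⟨m, hm1, hm⟩ : ∃ m : ℝ, 1 ≤ m ∧ ∀ d, (√(L d / 6))⁻¹ ≤ m := by
    have h0 : ∀ d, 0 ≤ (√(L d / 6))⁻¹ := fun d => inv_nonneg.2 (sqrt_nonneg _)
    refine ⟨1 + ∑ d, (√(L d / 6))⁻¹, ?_, fun d => ?_⟩
    · linarith [Finset.sum_nonneg fun d (_ : d ∈ Finset.univ) => h0 d]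
    · linarith [Finset.single_le_sum (fun d _ => h0 d) (Finset.mem_univ d)]
  have hm0 : 0 < m := by linarith
  set C₁ : ℝ := R ^ s * m ^ D with hC₁
  have hC₁0 : 0 < C₁ := by positivity
  -- The first summand comes from the perturbed eigenvalue, the second from the perturbed
  -- normalization constants.
  set C₂ : ℝ := s / 2 * R ^ (s + 2) * (60 * D * (8 * R) ^ 4) * m ^ D
    + R ^ s * (m ^ D * (D * (m * (8 * R) ^ 2))) with hC₂
  have hC₂0 : 0 ≤ C₂ := by positivity
  refine ⟨C₁ + C₁ * (8 * R) + C₁ * (8 * R) ^ 2 + C₂, by positivity, ?_⟩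
  intro κ n i hi
  set N : ℝ := 2 ^ n with hN
  have hN0 : 0 < N := by positivity
  have hfr : ∀ d, (i d : ℝ) * π / L d ≤ 8 * R * N := frequency_le hL (fun d => (hR d).2) hi
  have hfr0 : ∀ d, 0 ≤ (i d : ℝ) * π / L d := fun d => by have := hL d; positivity
  have hq : 0 < (N / R) ^ 2 := by positivity
  -- Dropping κ² here makes every bound uniform in κ.
  have hΛ : (N / R) ^ 2 ≤ κ ^ 2 + eigval L i := by
    have h1 := eigval_ge hL (fun d => (hR d).1) hi
    rw [mul_pow, ← hN] at h1
    have h2 : (1 : ℝ) ≤ π ^ 2 := by nlinarith [pi_gt_three]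
    nlinarith [sq_nonneg κ]
  have hpc0 : 0 ≤ ∏ d, cosNormConst (L d) (i d) :=
    Finset.prod_nonneg fun d _ => cosNormConst_nonneg _ _
  have hpc : ∏ d, cosNormConst (L d) (i d) ≤ m ^ D := by
    refine (Finset.prod_le_prod (fun d _ => cosNormConst_nonneg _ _) fun d _ =>
      (cosNormConst_le (hL d) _).trans (hm d)).trans_eq ?_
    simp
  have hpow : ∀ x : ℝ, (N / R) ^ 2 ≤ x → x ^ (-s / 2) ≤ R ^ s * 2 ^ ((n : ℝ) * (-s)) := by
    intro x hx
    rw [← rpow_block hR0, ← hN]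
    exact Real.rpow_le_rpow_of_nonpos hq hx (by linarith)
  have hspec0 : 0 ≤ specCoef L s κ i := mul_nonneg (Real.rpow_nonneg (hq.le.trans hΛ) _) hpc0
  have hspec : |specCoef L s κ i| ≤ C₁ * 2 ^ ((n : ℝ) * (-s)) := by
    rw [abs_of_nonneg hspec0, specCoef]
    calc _ ≤ R ^ s * 2 ^ ((n : ℝ) * (-s)) * m ^ D :=
          mul_le_mul (hpow _ hΛ) hpc hpc0 (by positivity)
      _ = _ := by rw [hC₁]; ring
  have hN1 : (2 : ℝ) ^ ((n : ℝ) * (1 - s)) = 2 ^ ((n : ℝ) * (-s)) * N := by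
    rw [hN, ← Real.rpow_natCast, ← Real.rpow_add (by norm_num)]; congr 1; ring
  have hN2 : (2 : ℝ) ^ ((n : ℝ) * (2 - s)) = 2 ^ ((n : ℝ) * (-s)) * N ^ 2 := by
    rw [hN, ← pow_mul, ← Real.rpow_natCast, ← Real.rpow_add (by norm_num)]; congr 1
    push_cast; ring
  refine ⟨?_, fun d => ?_, fun K hK hiK => ⟨?_, fun d => ?_⟩⟩
  · refine hspec.trans ?_
    gcongr
    have : 0 ≤ C₁ * (8 * R) := by positivity
    have : 0 ≤ C₁ * (8 * R) ^ 2 := by positivity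
    linarith
  · rw [abs_mul, abs_of_nonneg (hfr0 d), hN1]
    calc _ ≤ C₁ * 2 ^ ((n : ℝ) * (-s)) * (8 * R * N) :=
          mul_le_mul hspec (hfr d) (hfr0 d) (by positivity)
      _ = C₁ * (8 * R) * (2 ^ ((n : ℝ) * (-s)) * N) := by ring
      _ ≤ _ := by
          gcongr
          have : 0 ≤ C₁ * (8 * R) ^ 2 := by positivity
          linarith
  all_goals
    set h := meshSize L K with hh
    have hw : ∀ d, width L K d ≤ h := width_le_meshSize L K
    have hw0 : ∀ d, 0 ≤ width L K d := fun d => (width_pos hL hK d).le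
    have hΛh : (N / R) ^ 2 ≤ κ ^ 2 + feEigval L K i := by
      have h1 := eigval_ge hL (fun d => (hR d).1) hi
      have h2 := feEigval_ge hL hK hiK
      have h3 : 4 / π ^ 2 * (π * (2 ^ n / R)) ^ 2 ≤ 4 / π ^ 2 * eigval L i := by gcongr
      have h4 : 4 / π ^ 2 * (π * (2 ^ n / R)) ^ 2 = 4 * (N / R) ^ 2 := by
        rw [hN]; field_simp
      nlinarith [sq_nonneg κ]
    have hpf0 : 0 ≤ ∏ d, feNormConst (L d) (K d) (i d) :=
      Finset.prod_nonneg fun d _ => feNormConst_nonneg _ _ _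
    have hpf : ∏ d, feNormConst (L d) (K d) (i d) ≤ m ^ D := by
      refine (Finset.prod_le_prod (fun d _ => feNormConst_nonneg _ _ _) fun d _ =>
        (feNormConst_le (hL d) (hiK d) (hK d)).trans (hm d)).trans_eq ?_
      simp
  · have hdiff : |feEigval L K i - eigval L i| ≤ 60 * D * (8 * R) ^ 4 * (h ^ 2 * N ^ 4) := by
      rw [feEigval, eigval, ← Finset.sum_sub_distrib]
      refine (Finset.abs_sum_le_sum_abs _ _).trans ((Finset.sum_le_card_nsmul _ _
        (60 * h ^ 2 * ((8 * R * N) ^ 2) ^ 2) fun d _ => ?_).trans_eq ?_)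
      · refine (abs_feEigval₁_sub_le (hL d) (hiK d) (hK d)).trans ?_
        have := hw0 d
        have := hfr0 d
        gcongr
        · exact hw d
        · exact hfr d
      · simp; ring
    have hprod : |∏ d, feNormConst (L d) (K d) (i d) - ∏ d, cosNormConst (L d) (i d)|
        ≤ m ^ D * (D * (m * (8 * R) ^ 2)) * (h ^ 2 * N ^ 2) := by
      refine (abs_prod_sub_prod_le Finset.univ hm1 (fun d _ => ?_) (fun d _ => ?_)).trans ?_
      · rw [abs_of_nonneg (feNormConst_nonneg _ _ _)]
        exact (feNormConst_le (hL d) (hiK d) (hK d)).trans (hm d)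
      · rw [abs_of_nonneg (cosNormConst_nonneg _ _)]
        exact (cosNormConst_le (hL d) _).trans (hm d)
      · rw [Finset.card_univ, Fintype.card_fin]
        have hsum : ∑ d, |feNormConst (L d) (K d) (i d) - cosNormConst (L d) (i d)|
            ≤ D * (m * (h * (8 * R * N)) ^ 2) := by
          refine (Finset.sum_le_card_nsmul _ _ (m * (h * (8 * R * N)) ^ 2) fun d _ => ?_).trans_eq
            (by simp)
          refine (feNormConst_sub_le (hL d) (hiK d) (hK d)).trans ?_
          have e : (i d : ℝ) * π / K d = width L K d * (i d * π / L d) := by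
            have h1 := (hL d).ne'
            rw [width]; field_simp
          have h1 : (4 * √(L d / 6))⁻¹ ≤ m := by
            rw [mul_inv]
            have := hm d
            have h2 : 0 ≤ (√(L d / 6))⁻¹ := inv_nonneg.2 (sqrt_nonneg _)
            linarith
          rw [e]
          have hh0 : 0 ≤ h := (hw0 d).trans (hw d)
          have := hw0 d
          have := hfr0 d
          gcongr
          · exact hw d
          · exact hfr d
        calc _ ≤ m ^ D * (D * (m * (h * (8 * R * N)) ^ 2)) := by gcongr
          _ = _ := by ring
    -- Mean value estimate at the lower bound (N/R)²: the derivative is O(N^(-s-2)) and the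
    -- eigenvalue error O(h² N⁴), so the product is O(h² N^(2-s)).
    have hpd : |(κ ^ 2 + feEigval L K i) ^ (-s / 2) - (κ ^ 2 + eigval L i) ^ (-s / 2)|
        ≤ s / 2 * R ^ (s + 2) * (60 * D * (8 * R) ^ 4)
          * (h ^ 2 * (2 ^ ((n : ℝ) * (-s)) * N ^ 2)) := by
      have h1 := abs_rpow_neg_sub_le (a := s / 2) (by linarith) hq hΛh hΛ
      have e1 : -(s / 2) - 1 = -(s + 2) / 2 := by ring
      have e2 : κ ^ 2 + feEigval L K i - (κ ^ 2 + eigval L i) = feEigval L K i - eigval L i := by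
        ring
      have e3 : (2 : ℝ) ^ ((n : ℝ) * (-(s + 2))) = 2 ^ ((n : ℝ) * (-s)) / N ^ 2 := by
        rw [eq_div_iff (by positivity), hN, ← pow_mul, ← Real.rpow_natCast,
          ← Real.rpow_add (by norm_num)]
        congr 1; push_cast; ring
      rw [e1, e2, hN, rpow_block hR0, e3, ← neg_div] at h1
      refine h1.trans ?_
      calc _ ≤ s / 2 * (R ^ (s + 2) * (2 ^ ((n : ℝ) * (-s)) / N ^ 2))
            * (60 * D * (8 * R) ^ 4 * (h ^ 2 * N ^ 4)) := by gcongr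
        _ = _ := by field_simp
    have e : feCoef L s κ K i - specCoef L s κ i
        = ((κ ^ 2 + feEigval L K i) ^ (-s / 2) - (κ ^ 2 + eigval L i) ^ (-s / 2))
            * ∏ d, feNormConst (L d) (K d) (i d)
          + (κ ^ 2 + eigval L i) ^ (-s / 2)
            * (∏ d, feNormConst (L d) (K d) (i d) - ∏ d, cosNormConst (L d) (i d)) := by
      rw [feCoef, specCoef]; ring
    rw [e, hN2]
    refine (abs_add_le _ _).trans ?_
    rw [abs_mul, abs_mul, abs_of_nonneg hpf0,
      abs_of_nonneg (Real.rpow_nonneg (hq.le.trans hΛ) _)]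
    calc _ ≤ s / 2 * R ^ (s + 2) * (60 * D * (8 * R) ^ 4)
            * (h ^ 2 * (2 ^ ((n : ℝ) * (-s)) * N ^ 2)) * m ^ D
          + R ^ s * 2 ^ ((n : ℝ) * (-s))
            * (m ^ D * (D * (m * (8 * R) ^ 2)) * (h ^ 2 * N ^ 2)) := by
          refine add_le_add (mul_le_mul hpd hpf hpf0 (by positivity))
            (mul_le_mul (hpow _ hΛ) hprod (abs_nonneg _) (by positivity))
      _ = C₂ * (h ^ 2 * (2 ^ ((n : ℝ) * (-s)) * N ^ 2)) := by rw [hC₂]; ring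
      _ ≤ _ := by
          gcongr
          have : 0 ≤ C₁ * (8 * R) := by positivity
          have : 0 ≤ C₁ * (8 * R) ^ 2 := by positivity
          linarith
  · have hfe : |feCoef L s κ K i| ≤ C₁ * 2 ^ ((n : ℝ) * (-s)) := by
      rw [feCoef, abs_mul, abs_of_nonneg hpf0, abs_of_nonneg (Real.rpow_nonneg (hq.le.trans hΛh) _)]
      calc _ ≤ R ^ s * 2 ^ ((n : ℝ) * (-s)) * m ^ D :=
            mul_le_mul (hpow _ hΛh) hpf hpf0 (by positivity)
        _ = _ := by rw [hC₁]; ring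
    rw [abs_mul, abs_of_nonneg (sq_nonneg ((i d : ℝ) * π / L d)), hN2]
    have h1 := hw0 d
    have h2 := hfr0 d
    calc _ ≤ C₁ * 2 ^ ((n : ℝ) * (-s)) * (8 * R * N) ^ 2 * h ^ 2 := by
          gcongr
          · exact hfr d
          · exact hw d
      _ = C₁ * (8 * R) ^ 2 * (h ^ 2 * (2 ^ ((n : ℝ) * (-s)) * N ^ 2)) := by ring
      _ ≤ _ := by
          gcongr
          have : 0 ≤ C₁ * (8 * R) := by positivity
          linarith

/-- On admissible grids the resolved blocks have scale at most `1 / h`, and the unresolved ones at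
least `1 / h`, up to constants. -/
theorem scale_bounds (hD : 1 ≤ D) (hL : ∀ d, 0 < L d) (ρ : ℝ) :
    ∃ C : ℝ, 0 < C ∧ ∀ K : Fin D → ℕ, IsAdmissible L ρ K → meshSize L K ≤ C ∧
      ∀ n : ℕ, ∀ i ∈ dyadicBlock D n,
        ((∀ d, i d ≤ K d) → 2 ^ n * meshSize L K ≤ C) ∧
        ((∃ d, K d < i d) → 1 ≤ C * (2 ^ n * meshSize L K)) := by
  have : Nonempty (Fin D) := ⟨⟨0, hD⟩⟩
  obtain ⟨R, hR1, hR⟩ := exists_length_bound hL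
  have hR0 : 0 < R := by linarith
  refine ⟨2 * R + |ρ| * R, by positivity, ?_⟩
  intro K hK
  have hρR : 0 ≤ |ρ| * R := by positivity
  have hh := meshSize_pos hD hL hK.1
  refine ⟨(meshSize_le hD hL hK.1 fun d => (hR d).1).trans (by linarith), fun n i hi =>
    ⟨fun hlow => ?_, fun ⟨d, hd⟩ => ?_⟩⟩
  · obtain ⟨d, hd⟩ := (mem_dyadicBlock.1 hi).2
    -- Comparability of the widths enters here: direction d carries the largest entry, yet its width
    -- need not be the largest. The absolute value allows any real ρ.
    have h1 : meshSize L K ≤ |ρ| * width L K d :=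
      ciSup_le fun j => (hK.2 j d).trans
        (mul_le_mul_of_nonneg_right (le_abs_self ρ) (width_pos hL hK.1 d).le)
    have hKd : (0 : ℝ) < K d := by exact_mod_cast hK.1 d
    have h2 : (2 : ℝ) ^ n ≤ K d := by exact_mod_cast hd.trans (hlow d)
    calc 2 ^ n * meshSize L K ≤ K d * (|ρ| * width L K d) := by gcongr
      _ = |ρ| * L d := by rw [width]; field_simp
      _ ≤ |ρ| * R := by gcongr; exact (hR d).1
      _ ≤ _ := by linarith
  · have hKd : (0 : ℝ) < K d := by exact_mod_cast hK.1 d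
    have h1 : (K d : ℝ) ≤ 2 * 2 ^ n := by
      have := (hd.trans ((mem_dyadicBlock.1 hi).1 d)).le
      rw [pow_succ, mul_comm] at this
      exact_mod_cast this
    have h2 := hL d
    have h3 : 1 ≤ R * L d := by
      have := (hR d).2
      rw [inv_le_iff_one_le_mul₀ h2] at this
      exact this
    have h4 : L d ≤ 2 * 2 ^ n * meshSize L K := by
      calc L d = K d * width L K d := by rw [width]; field_simp
        _ ≤ 2 * 2 ^ n * meshSize L K := by
          have := width_le_meshSize L K d
          have := (width_pos hL hK.1 d).le
          gcongr
    calc (1 : ℝ) ≤ R * L d := h3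
      _ ≤ R * (2 * 2 ^ n * meshSize L K) := by gcongr
      _ = 2 * R * (2 ^ n * meshSize L K) := by ring
      _ ≤ _ := by gcongr; linarith

end Coefficients


/-! ### The Neumann eigenfunctions are orthonormal -/

theorem integral_domain_prod {D : ℕ} (L : Fin D → ℝ) (f : Fin D → ℝ → ℝ) :
    ∫ y in domain L, ∏ d, f d (y d) = ∏ d, ∫ y in Ioo 0 (L d), f d y := by
  rw [domain, volume_pi, Measure.restrict_pi_pi]
  exact integral_fintype_prod_eq_prod (𝕜 := ℝ) f

/-- By Fubini the squared norm factorises, so the normalization is the product of the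
one-dimensional ones. -/
theorem eigfun_eq {D : ℕ} (L : Fin D → ℝ) (i : Fin D → ℕ) (x : Fin D → ℝ) :
    eigfun L i x = (∏ d, cosNormConst (L d) (i d)) * cosProd L i x := by
  have h : ∫ y in domain L, cosProd L i y ^ 2
      = ∏ d, ∫ y in Ioo 0 (L d), cos (i d * π * y / L d) ^ 2 := by
    rw [← integral_domain_prod L fun d y => cos (i d * π * y / L d) ^ 2]
    simp_rw [cosProd, Finset.prod_pow]
  rw [eigfun, h, Real.sqrt_prod _ fun d _ => integral_nonneg fun y => sq_nonneg _,
    ← Finset.prod_inv_distrib]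
  rfl

theorem integral_cos_mul_pi {ℓ : ℝ} (hℓ : 0 < ℓ) {k : ℤ} (hk : k ≠ 0) :
    ∫ y in (0 : ℝ)..ℓ, cos (k * π * y / ℓ) = 0 := by
  have hk' : (k : ℝ) ≠ 0 := by exact_mod_cast hk
  have hc : (k : ℝ) * π / ℓ ≠ 0 := by positivity
  have e : ∀ y : ℝ, (k : ℝ) * π * y / ℓ = (k * π / ℓ) * y := fun y => by ring
  simp_rw [e]
  rw [intervalIntegral.integral_comp_mul_left (fun y => cos y) hc, integral_cos]
  have e2 : (k : ℝ) * π / ℓ * ℓ = k * π := by field_simp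
  rw [e2, mul_zero, sin_int_mul_pi]
  simp

theorem integral_cos_mul_cos {ℓ : ℝ} (hℓ : 0 < ℓ) {i j : ℕ} (hij : i ≠ j) :
    ∫ y in Ioo 0 ℓ, cos (i * π * y / ℓ) * cos (j * π * y / ℓ) = 0 := by
  rw [← integral_Ioc_eq_integral_Ioo, ← intervalIntegral.integral_of_le hℓ.le]
  have e : ∀ y : ℝ, cos (i * π * y / ℓ) * cos (j * π * y / ℓ)
      = (1 / 2) * cos (((i - j : ℤ) : ℝ) * π * y / ℓ)
        + (1 / 2) * cos (((i + j : ℤ) : ℝ) * π * y / ℓ) := by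
    intro y
    have e1 : ((i - j : ℤ) : ℝ) * π * y / ℓ = i * π * y / ℓ - j * π * y / ℓ := by
      push_cast; ring
    have e2 : ((i + j : ℤ) : ℝ) * π * y / ℓ = i * π * y / ℓ + j * π * y / ℓ := by
      push_cast; ring
    rw [e1, e2, cos_sub, cos_add]
    ring
  simp_rw [e]
  have hc : ∀ k : ℤ, IntervalIntegrable (fun y : ℝ => (1 / 2) * cos ((k : ℝ) * π * y / ℓ)) volume 0 ℓ :=
    fun k => (by fun_prop : Continuous fun y : ℝ =>
      (1 / 2) * cos ((k : ℝ) * π * y / ℓ)).intervalIntegrable _ _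
  rw [intervalIntegral.integral_add (hc _) (hc _), intervalIntegral.integral_const_mul,
    intervalIntegral.integral_const_mul, integral_cos_mul_pi hℓ (by omega),
    integral_cos_mul_pi hℓ (by omega)]
  simp

theorem eigfunLp_coeFn {D : ℕ} (L : Fin D → ℝ) (i : Fin D → ℕ) :
    (eigfunLp L i : (Fin D → ℝ) → ℝ) =ᵐ[domainMeasure L] eigfun L i :=
  (eigfun_memLp L i).coeFn_toLp

theorem inner_eigfunLp {D : ℕ} (L : Fin D → ℝ) (i j : Fin D → ℕ) :
    inner ℝ (eigfunLp L i) (eigfunLp L j) = ∫ y in domain L, eigfun L i y * eigfun L j y := by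
  rw [L2.inner_def]
  refine integral_congr_ae ?_
  filter_upwards [eigfunLp_coeFn L i, eigfunLp_coeFn L j] with y hi hj
  rw [hi, hj, RCLike.inner_apply, conj_trivial, mul_comm]

theorem orthonormal_eigfunLp {D : ℕ} {L : Fin D → ℝ} (hL : ∀ d, 0 < L d) :
    Orthonormal ℝ (eigfunLp L) := by
  rw [orthonormal_iff_ite]
  intro i j
  have e : ∀ y, eigfun L i y * eigfun L j y
      = ((∏ d, cosNormConst (L d) (i d)) * ∏ d, cosNormConst (L d) (j d))
        * ∏ d, cos (i d * π * y d / L d) * cos (j d * π * y d / L d) := by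
    intro y
    rw [eigfun_eq, eigfun_eq, cosProd, cosProd, Finset.prod_mul_distrib]
    ring
  rw [inner_eigfunLp]
  simp_rw [e]
  rw [integral_const_mul, integral_domain_prod L fun d y =>
    cos (i d * π * y / L d) * cos (j d * π * y / L d)]
  split_ifs with hij
  · subst hij
    rw [← Finset.prod_mul_distrib, ← Finset.prod_mul_distrib]
    refine Finset.prod_eq_one fun d _ => ?_
    simp_rw [← sq]
    have h1 := cos_sq_ge (hL d) (i d)
    have h2 := hL d
    have h3 : 0 < ∫ y in Ioo 0 (L d), cos (i d * π * y / L d) ^ 2 := by linarith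
    rw [cosNormConst, inv_pow, sq_sqrt h3.le, inv_mul_cancel₀ h3.ne']
  · obtain ⟨d, hd⟩ := Function.ne_iff.1 hij
    have h0 : ∏ d, ∫ y in Ioo 0 (L d), cos (i d * π * y / L d) * cos (j d * π * y / L d) = 0 :=
      Finset.prod_eq_zero (Finset.mem_univ d) (integral_cos_mul_cos (hL d) hd)
    rw [h0, mul_zero]

/-! ### Convergence of the series defining the field -/

theorem fieldTerm_eq {D : ℕ} {Ω : Type*} (L : Fin D → ℝ) (s κ : ℝ) (ξ : (Fin D → ℕ) → Ω → ℝ)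
    (ω : Ω) (i : Fin D → ℕ) :
    (fieldTerm L s κ ξ ω i : (Fin D → ℝ) → ℝ) =ᵐ[domainMeasure L]
      fun x => κ ^ (s - (D : ℝ) / 2) * (specCoef L s κ i * ξ i ω * cosProd L i x) := by
  filter_upwards [Lp.coeFn_smul (κ ^ (s - (D : ℝ) / 2) * (κ ^ 2 + eigval L i) ^ (-s / 2) * ξ i ω)
    (eigfunLp L i), eigfunLp_coeFn L i] with x h1 h2
  rw [fieldTerm, h1, Pi.smul_apply, h2, eigfun_eq, specCoef, smul_eq_mul]
  ring

/-- Along a subsequence of dyadic boxes the partial sums converge almost everywhere. -/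
theorem exists_subseq_tendsto_field {D : ℕ} {Ω : Type*} {L : Fin D → ℝ} {s κ : ℝ}
    {ξ : (Fin D → ℕ) → Ω → ℝ} {ω : Ω} (h : Summable (fieldTerm L s κ ξ ω)) :
    ∃ ns : ℕ → ℕ, StrictMono ns ∧ ∀ᵐ x ∂domainMeasure L, Filter.Tendsto
      (fun k => κ ^ (s - (D : ℝ) / 2)
        * ∑ i ∈ dyadicBox D (ns k), specCoef L s κ i * ξ i ω * cosProd L i x)
      Filter.atTop (nhds (field L s κ ξ ω x)) := by
  have h1 : Filter.Tendsto (fun m => ∑ i ∈ dyadicBox D m, fieldTerm L s κ ξ ω i) Filter.atTop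
      (nhds (field L s κ ξ ω)) := h.hasSum.comp (tendsto_dyadicBox D)
  obtain ⟨ns, hns, hae⟩ := (tendstoInMeasure_of_tendsto_Lp h1).exists_seq_tendsto_ae
  refine ⟨ns, hns, ?_⟩
  have h2 : ∀ᵐ x ∂domainMeasure L, ∀ i, fieldTerm L s κ ξ ω i x
      = κ ^ (s - (D : ℝ) / 2) * (specCoef L s κ i * ξ i ω * cosProd L i x) :=
    ae_all_iff.2 fun i => fieldTerm_eq L s κ ξ ω i
  have h3 : ∀ᵐ x ∂domainMeasure L, ∀ m, (∑ i ∈ dyadicBox D m, fieldTerm L s κ ξ ω i : Lp ℝ 2 _) x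
      = ∑ i ∈ dyadicBox D m, fieldTerm L s κ ξ ω i x := by
    refine ae_all_iff.2 fun m => ?_
    filter_upwards [Lp.coeFn_finsetSum (dyadicBox D m) (fieldTerm L s κ ξ ω)] with x hx
    rw [hx, Finset.sum_apply]
  filter_upwards [hae, h2, h3] with x hx hx2 hx3
  refine hx.congr fun k => ?_
  rw [hx3, Finset.mul_sum]
  exact Finset.sum_congr rfl fun i _ => hx2 i

/-- By orthonormality the series converges once ∑ a_i² ξ_i² is finite. Apart from the index 0 its
expectation is ∑ a_i², bounded blockwise by 2^(nD) 2^(-2ns), which is summable as 2s > D. -/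
theorem summable_fieldTerm {Ω : Type*} [MeasurableSpace Ω] {P : Measure Ω}
    {D : ℕ} {L : Fin D → ℝ} (hL : ∀ d, 0 < L d) {ξ : (Fin D → ℕ) → Ω → ℝ}
    (hξ : IsIIDStdNormal ξ P) {s : ℝ} (hs : (D : ℝ) / 2 < s) (κ : ℝ) :
    ∀ᵐ ω ∂P, Summable (fieldTerm L s κ ξ ω) := by
  have hs0 : 0 < s := lt_of_le_of_lt (by positivity) hs
  obtain ⟨C, hC, hcoef⟩ := coef_bounds hL hs0
  set a : (Fin D → ℕ) → ℝ := fun i => (κ ^ 2 + eigval L i) ^ (-s / 2) with ha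
  -- The coefficient bounds include the normalization constants; a positive lower bound for these
  -- allows them to be divided out.
  obtain ⟨m, hm0, hm⟩ : ∃ m : ℝ, 0 < m ∧ ∀ i : Fin D → ℕ, m ≤ ∏ d, cosNormConst (L d) (i d) := by
    refine ⟨∏ d, (√(L d))⁻¹, Finset.prod_pos fun d _ => inv_pos.2 (sqrt_pos.2 (hL d)), fun i =>
      Finset.prod_le_prod (fun d _ => inv_nonneg.2 (sqrt_nonneg _)) fun d _ => ?_⟩
    have h1 := cos_sq_ge (hL d) (i d)
    have h2 := hL d
    refine inv_anti₀ (sqrt_pos.2 (by linarith)) (sqrt_le_sqrt ?_)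
    rw [integral_cos_sq_interval (hL d)]
    split_ifs <;> linarith
  have hane : ∀ i, 0 ≤ a i := fun i =>
    Real.rpow_nonneg (add_nonneg (sq_nonneg κ) (eigval_nonneg L i)) _
  have hblock : ∀ n, ∀ i ∈ dyadicBlock D n, a i ≤ C / m * 2 ^ ((n : ℝ) * (-s)) := by
    intro n i hi
    have h1 := (hcoef κ n i hi).1
    rw [specCoef, abs_of_nonneg (mul_nonneg (hane i) (hm0.le.trans (hm i)))] at h1
    rw [div_mul_eq_mul_div, le_div_iff₀ hm0]
    exact (mul_le_mul_of_nonneg_left (hm i) (hane i)).trans h1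
  have hsum : ∑' i, (if i = 0 then 0 else ENNReal.ofReal (a i ^ 2)) < ⊤ := by
    obtain ⟨C', -, hC'⟩ := tsum_ofReal_two_rpow_neg (a := 2 * s - D) (by linarith)
    refine (tsum_le_tsum_dyadicBlock _ (fun n => ENNReal.ofReal
      ((C / m * 2 ^ ((n : ℝ) * (-s))) ^ 2)) (by simp) ?_).trans_lt ?_
    · intro n i hi
      rw [if_neg (ne_of_mem_of_not_mem hi (zero_notMem_dyadicBlock D n))]
      exact ENNReal.ofReal_le_ofReal (pow_le_pow_left₀ (hane i) (hblock n i hi) 2)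
    · calc ∑' n, ((dyadicBlock D n).card : ENNReal)
            * ENNReal.ofReal ((C / m * 2 ^ ((n : ℝ) * (-s))) ^ 2)
          ≤ ∑' n : ℕ, ENNReal.ofReal (2 ^ D * (C / m) ^ 2)
            * ENNReal.ofReal (2 ^ (-(n : ℝ) * (2 * s - D))) := by
            refine ENNReal.tsum_le_tsum fun n => ?_
            rw [← ENNReal.ofReal_natCast, ← ENNReal.ofReal_mul (by positivity),
              ← ENNReal.ofReal_mul (by positivity)]
            refine ENNReal.ofReal_le_ofReal ?_
            have e : (2 : ℝ) ^ (-(n : ℝ) * (2 * s - D))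
                = 2 ^ ((n : ℝ) * D) * (2 ^ ((n : ℝ) * (-s))) ^ 2 := by
              rw [← Real.rpow_natCast (2 ^ ((n : ℝ) * (-s))) 2, ← Real.rpow_mul (by norm_num),
                ← Real.rpow_add (by norm_num)]
              congr 1; push_cast; ring
            rw [e]
            calc _ ≤ 2 ^ D * 2 ^ ((n : ℝ) * D) * (C / m * 2 ^ ((n : ℝ) * (-s))) ^ 2 := by
                  gcongr; exact card_dyadicBlock_le D n
              _ = _ := by ring
        _ = ENNReal.ofReal (2 ^ D * (C / m) ^ 2)
            * ∑' n : ℕ, ENNReal.ofReal (2 ^ (-(n : ℝ) * (2 * s - D))) := ENNReal.tsum_mul_left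
        _ < ⊤ := ENNReal.mul_lt_top ENNReal.ofReal_lt_top (hC'.trans_lt ENNReal.ofReal_lt_top)
  have hmeas : ∀ i, Measurable fun ω => if i = 0 then 0 else ENNReal.ofReal ((a i * ξ i ω) ^ 2) := by
    intro i
    split_ifs
    · exact measurable_const
    · exact ENNReal.measurable_ofReal.comp (((hξ.measurable i).const_mul _).pow_const 2)
  have hInt : ∫⁻ ω, ∑' i, (if i = 0 then 0 else ENNReal.ofReal ((a i * ξ i ω) ^ 2)) ∂P ≠ ⊤ := by
    rw [lintegral_tsum fun i => (hmeas i).aemeasurable]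
    refine (lt_of_le_of_lt (ENNReal.tsum_le_tsum fun i => ?_) hsum).ne
    split_ifs with h
    · simp
    · rw [hξ.lintegral_sq]
  have hfin := ae_lt_top (Measurable.tsum fun i => hmeas i) hInt
  filter_upwards [hfin] with ω hω
  have hsq : Summable fun i => (a i * ξ i ω) ^ 2 := by
    have h1 : Summable fun i : Fin D → ℕ => (if i = 0 then 0 else (a i * ξ i ω) ^ 2) := by
      refine (ENNReal.summable_toReal hω.ne).congr fun i => ?_
      split_ifs
      · simp
      · exact ENNReal.toReal_ofReal (sq_nonneg _)
    -- The index 0, left out of the block sums, is put back; a single term does not affect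
    -- summability.
    refine (h1.update 0 ((a 0 * ξ 0 ω) ^ 2)).congr fun i => ?_
    by_cases hi : i = 0
    · subst hi; simp
    · simp [hi]
  have h2 := (orthonormal_eigfunLp hL).orthogonalFamily.summable_iff_norm_sq_summable
    (fun i => κ ^ (s - (D : ℝ) / 2) * a i * ξ i ω)
  refine h2.2 ((hsq.mul_left ((κ ^ (s - (D : ℝ) / 2)) ^ 2)).congr fun i => ?_)
  rw [Real.norm_eq_abs, sq_abs]
  ring


/-! ### Mean-square error -/

/-- The resolved scales contribute `h ^ 4 * 2 ^ (n * (4 - a))` each, the unresolved ones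
`2 ^ (-n * a)`. -/
def scaleSum (c a h : ℝ) : ENNReal :=
  ∑' n : ℕ, ((if (2 : ℝ) ^ n ≤ c / h then ENNReal.ofReal (h ^ 4 * 2 ^ ((n : ℝ) * (4 - a))) else 0)
    + if (c * h)⁻¹ ≤ (2 : ℝ) ^ n then ENNReal.ofReal (2 ^ (-(n : ℝ) * a)) else 0)

/-- The first unresolved scale dominates and gives h^a, which is at most a constant times h^(min a
4) because h ≤ c. -/
theorem scaleSum_tail_le {a : ℝ} (ha : 0 < a) {c : ℝ} (hc : 0 < c) :
    ∃ C : ℝ, 0 < C ∧ ∀ h : ℝ, 0 < h → h ≤ c →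
      ∑' n : ℕ, (if (c * h)⁻¹ ≤ (2 : ℝ) ^ n then ENNReal.ofReal (2 ^ (-(n : ℝ) * a)) else 0)
        ≤ ENNReal.ofReal (C * h ^ (min a 4)) := by
  obtain ⟨C, hC, h1⟩ := tsum_geometric_above ha
  refine ⟨C * (c ^ a * c ^ (a - min a 4)), by positivity, fun h hh hhc => ?_⟩
  refine (h1 _ (by positivity)).trans (ENNReal.ofReal_le_ofReal ?_)
  rw [Real.inv_rpow (by positivity), Real.rpow_neg (by positivity), inv_inv,
    Real.mul_rpow hc.le hh.le]
  have e : h ^ a = h ^ (a - min a 4) * h ^ (min a 4) := by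
    rw [← Real.rpow_add hh]; congr 1; ring
  have h2 : h ^ (a - min a 4) ≤ c ^ (a - min a 4) :=
    Real.rpow_le_rpow hh.le hhc (sub_nonneg.2 (min_le_left _ _))
  rw [e]
  calc C * (c ^ a * (h ^ (a - min a 4) * h ^ (min a 4)))
      ≤ C * (c ^ a * (c ^ (a - min a 4) * h ^ (min a 4))) := by gcongr
    _ = _ := by ring

theorem tsum_low_eq (c a h : ℝ) :
    ∑' n : ℕ, (if (2 : ℝ) ^ n ≤ c / h then ENNReal.ofReal (h ^ 4 * 2 ^ ((n : ℝ) * (4 - a))) else 0)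
      = ENNReal.ofReal (h ^ 4)
        * ∑' n : ℕ, (if (2 : ℝ) ^ n ≤ c / h then ENNReal.ofReal (2 ^ ((n : ℝ) * (4 - a))) else 0) := by
  rw [← ENNReal.tsum_mul_left]
  refine tsum_congr fun n => ?_
  split_ifs
  · rw [ENNReal.ofReal_mul (by positivity)]
  · simp

/-- For a < 4 the finest resolved scale dominates and gives h⁴ h^(a-4) = h^a; for a > 4 the resolved
series converges, leaving h⁴. -/
theorem scaleSum_le_of_ne {a : ℝ} (ha : 0 < a) (ha4 : a ≠ 4) {c : ℝ} (hc : 0 < c) :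
    ∃ C : ℝ, 0 < C ∧ ∀ h : ℝ, 0 < h → h ≤ c →
      scaleSum c a h ≤ ENNReal.ofReal (C * h ^ (min a 4)) := by
  obtain ⟨C₁, hC₁, htail⟩ := scaleSum_tail_le ha hc
  suffices hlow : ∃ C : ℝ, 0 < C ∧ ∀ h : ℝ, 0 < h → h ≤ c →
      ∑' n : ℕ, (if (2 : ℝ) ^ n ≤ c / h then ENNReal.ofReal (h ^ 4 * 2 ^ ((n : ℝ) * (4 - a))) else 0)
        ≤ ENNReal.ofReal (C * h ^ (min a 4)) by
    obtain ⟨C₂, hC₂, hlow⟩ := hlow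
    refine ⟨C₂ + C₁, by positivity, fun h hh hhc => ?_⟩
    rw [scaleSum, ENNReal.tsum_add, add_mul, ENNReal.ofReal_add (by positivity) (by positivity)]
    exact add_le_add (hlow h hh hhc) (htail h hh hhc)
  simp_rw [tsum_low_eq]
  rcases lt_or_gt_of_ne ha4 with h4 | h4
  · obtain ⟨C, hC, h1⟩ := tsum_geometric_below (a := 4 - a) (by linarith)
    refine ⟨C * c ^ (4 - a), by positivity, fun h hh hhc => ?_⟩
    refine (mul_le_mul_right (h1 (c / h) (by positivity)) _).trans ?_
    rw [← ENNReal.ofReal_mul (by positivity), min_eq_left h4.le]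
    refine ENNReal.ofReal_le_ofReal (le_of_eq ?_)
    have e : h ^ (4 : ℕ) = h ^ (4 - a) * h ^ a := by
      rw [← Real.rpow_add hh, ← Real.rpow_natCast]; congr 1; push_cast; ring
    have h0 : h ^ (4 - a) ≠ 0 := by positivity
    rw [Real.div_rpow hc.le hh.le, e]
    field_simp
  · obtain ⟨C, hC, h1⟩ := tsum_ofReal_two_rpow_neg (a := a - 4) (by linarith)
    refine ⟨C, hC, fun h hh hhc => ?_⟩
    have h2 : ∑' n : ℕ, (if (2 : ℝ) ^ n ≤ c / h then ENNReal.ofReal (2 ^ ((n : ℝ) * (4 - a))) else 0)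
        ≤ ENNReal.ofReal C := by
      refine le_trans (ENNReal.tsum_le_tsum fun n => ?_) h1
      have e : -(n : ℝ) * (a - 4) = n * (4 - a) := by ring
      rw [e]
      split_ifs <;> simp
    refine (mul_le_mul_right h2 _).trans ?_
    rw [← ENNReal.ofReal_mul (by positivity), min_eq_right h4.le, mul_comm]
    norm_cast

/-- At the critical exponent each resolved scale contributes h⁴, and their number is of order at
most 1 + |log h|. -/
theorem scaleSum_four_le {c : ℝ} (hc : 0 < c) :
    ∃ C : ℝ, 0 < C ∧ ∀ h : ℝ, 0 < h → h ≤ c →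
      scaleSum c 4 h ≤ ENNReal.ofReal (C * h ^ (4 : ℝ) * (1 + |log h|)) := by
  obtain ⟨C₁, hC₁, htail⟩ := scaleSum_tail_le (a := 4) (by norm_num) hc
  have hl : 0 < log 2 := log_pos (by norm_num)
  refine ⟨C₁ + (1 + |log c| / log 2 + 1 / log 2), by positivity, fun h hh hhc => ?_⟩
  have ht := htail h hh hhc
  rw [min_self] at ht
  have e4 : h ^ (4 : ℝ) = h ^ (4 : ℕ) := by norm_cast
  rw [e4] at ht ⊢
  have hlow := tsum_scales_below (c / h)
  have hlog : |log (c / h)| ≤ |log c| + |log h| := by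
    rw [log_div hc.ne' hh.ne']
    exact abs_sub _ _
  rw [scaleSum, ENNReal.tsum_add, tsum_low_eq]
  simp only [sub_self, mul_zero, Real.rpow_zero, ENNReal.ofReal_one]
  refine (add_le_add (mul_le_mul_right hlow _) ht).trans ?_
  rw [← ENNReal.ofReal_mul (by positivity), ← ENNReal.ofReal_add (by positivity) (by positivity)]
  refine ENNReal.ofReal_le_ofReal ?_
  have h1 : |log (c / h)| / log 2 ≤ |log c| / log 2 + 1 / log 2 * |log h| := by
    rw [div_mul_eq_mul_div, one_mul, ← add_div]
    gcongr
  have h2 : 0 ≤ |log h| := abs_nonneg _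
  have h3 : 0 ≤ |log c| / log 2 := by positivity
  have h4 : 0 ≤ 1 / log 2 := by positivity
  have h5 : 0 ≤ h ^ 4 := by positivity
  calc h ^ 4 * (1 + |log (c / h)| / log 2) + C₁ * h ^ 4
      ≤ h ^ 4 * (1 + (|log c| / log 2 + 1 / log 2 * |log h|)) + C₁ * h ^ 4 := by gcongr
    _ = h ^ 4 * (1 + |log c| / log 2 + 1 / log 2 * |log h| + C₁) := by ring
    _ ≤ h ^ 4 * ((C₁ + (1 + |log c| / log 2 + 1 / log 2)) * (1 + |log h|)) := by
        gcongr
        nlinarith [mul_nonneg h3 h2, mul_nonneg hC₁.le h2]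
    _ = _ := by ring

/-! ### The error as a Gaussian series in L² -/

section FiniteElement

variable {D : ℕ} {L : Fin D → ℝ}

/-- The multi-indices resolved by the grid. -/
def gridIndices (K : Fin D → ℕ) : Finset (Fin D → ℕ) :=
  Fintype.piFinset fun d => Finset.range (K d + 1)

theorem mem_gridIndices {K i : Fin D → ℕ} : i ∈ gridIndices K ↔ ∀ d, i d ≤ K d := by
  simp [gridIndices]

theorem feField_eq {Ω : Type*} (L : Fin D → ℝ) (s κ : ℝ) (K : Fin D → ℕ)
    (ξ : (Fin D → ℕ) → Ω → ℝ) (ω : Ω) (x : Fin D → ℝ) :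
    feField L s κ K ξ ω x = κ ^ (s - (D : ℝ) / 2)
      * ∑ i ∈ gridIndices K, feCoef L s κ K i * ξ i ω * mixedProd L K Finset.univ i x := by
  rw [feField]
  congr 1
  refine Finset.sum_congr rfl fun i _ => ?_
  rw [feCoef, mixedProd_univ, feEigfun]
  have h : ∀ d, feEigfun₁ (L d) (K d) (i d) (x d)
      = feNormConst (L d) (K d) (i d) * feShape (L d) (K d) (i d) (x d) := fun d => rfl
  simp_rw [h]
  rw [Finset.prod_mul_distrib]
  ring

theorem abs_cosProd_le_one (L : Fin D → ℝ) (i : Fin D → ℕ) (x : Fin D → ℝ) :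
    |cosProd L i x| ≤ 1 :=
  abs_waveProd_le_one (g := fun _ => cos) (fun _ => isWave_cos) L i x

theorem mem_Icc_of_mem_domain {x : Fin D → ℝ} (hx : x ∈ domain L) (d : Fin D) :
    x d ∈ Icc 0 (L d) :=
  Ioo_subset_Icc_self (hx d (mem_univ d))

theorem measurableSet_domain (L : Fin D → ℝ) : MeasurableSet (domain L) :=
  MeasurableSet.univ_pi fun _ => measurableSet_Ioo

theorem mixedProd_univ_memLp (hL : ∀ d, 0 < L d) {K : Fin D → ℕ} (hK : ∀ d, 1 ≤ K d)
    (i : Fin D → ℕ) : MemLp (mixedProd L K Finset.univ i) 2 (domainMeasure L) := by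
  have hc : Continuous (mixedProd L K Finset.univ i) := by
    have : mixedProd L K Finset.univ i = fun x => ∏ d, feShape (L d) (K d) (i d) (x d) :=
      funext fun x => mixedProd_univ L K i x
    rw [this]
    exact continuous_finsetProd _ fun d _ => (continuous_feShape _ _ _).comp (continuous_apply d)
  refine MemLp.of_bound hc.aestronglyMeasurable 1 ?_
  refine ae_restrict_of_forall_mem (measurableSet_domain L) fun x hx => ?_
  have := abs_sum_mixedProd_le hL hK (F := {i}) (β := fun _ => 1) (M := 1)
    (fun y => by simpa using abs_cosProd_le_one L i y) Finset.univ x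
    (fun d _ => mem_Icc_of_mem_domain hx d)
  simpa using this

/-- The coefficient of `ξ_i` in the error, without the power of `κ`. -/
def errorFun (L : Fin D → ℝ) (s κ : ℝ) (K i : Fin D → ℕ) (x : Fin D → ℝ) : ℝ :=
  (if i ∈ gridIndices K then feCoef L s κ K i * mixedProd L K Finset.univ i x else 0)
    - specCoef L s κ i * cosProd L i x

theorem errorFun_memLp (hL : ∀ d, 0 < L d) {K : Fin D → ℕ} (hK : ∀ d, 1 ≤ K d) (s κ : ℝ)
    (i : Fin D → ℕ) : MemLp (errorFun L s κ K i) 2 (domainMeasure L) := by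
  have h1 : MemLp (fun x => specCoef L s κ i * cosProd L i x) 2 (domainMeasure L) := by
    have := (eigfun_memLp L i).const_mul ((κ ^ 2 + eigval L i) ^ (-s / 2))
    simp_rw [eigfun_eq, ← mul_assoc] at this
    exact this
  unfold errorFun
  split_ifs
  · exact ((mixedProd_univ_memLp hL hK i).const_mul _).sub h1
  · exact (MemLp.zero' (ε := ℝ)).sub h1

/-- The error of a resolved mode splits into the change of coefficient and the interpolation error
of a single cosine product. -/
theorem abs_errorFun_low_le (hL : ∀ d, 0 < L d) {K : Fin D → ℕ} (hK : ∀ d, 1 ≤ K d) (s κ : ℝ)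
    {i : Fin D → ℕ} (hi : i ∈ gridIndices K) {x : Fin D → ℝ} (hx : x ∈ domain L) :
    |errorFun L s κ K i x| ≤ |feCoef L s κ K i - specCoef L s κ i|
      + ∑ d, |feCoef L s κ K i * (i d * π / L d) ^ 2| * width L K d ^ 2 := by
  have h := abs_sum_mixedProd_sub_le hL hK (F := {i}) (β := feCoef L s κ K)
    (M := fun d => |feCoef L s κ K i * (i d * π / L d) ^ 2|) (fun d y => by
      rw [Finset.sum_singleton, abs_mul]
      exact mul_le_of_le_one_right (abs_nonneg _) (abs_cosProd_le_one L i y)) Finset.univ x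
    (fun d _ => mem_Icc_of_mem_domain hx d)
  rw [Finset.sum_singleton, Finset.sum_singleton] at h
  rw [errorFun, if_pos hi]
  have e : feCoef L s κ K i * mixedProd L K Finset.univ i x - specCoef L s κ i * cosProd L i x
      = (feCoef L s κ K i - specCoef L s κ i) * cosProd L i x
        + (feCoef L s κ K i * mixedProd L K Finset.univ i x
          - feCoef L s κ K i * cosProd L i x) := by ring
  rw [e]
  refine (abs_add_le _ _).trans (add_le_add ?_ (h.trans_eq ?_))
  · rw [abs_mul]
    exact mul_le_of_le_one_right (abs_nonneg _) (abs_cosProd_le_one L i x)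
  · exact Finset.sum_congr rfl fun d _ => mul_comm _ _

/-- The mean-square error is at most the sum of the squared norms of the error coefficients. -/
theorem meanSqError_two_le {Ω : Type*} [MeasurableSpace Ω] {P : Measure Ω}
    (hL : ∀ d, 0 < L d) {ξ : (Fin D → ℕ) → Ω → ℝ} (hξ : IsIIDStdNormal ξ P) {s : ℝ}
    (hs : (D : ℝ) / 2 < s) (κ : ℝ) {K : Fin D → ℕ} (hK : ∀ d, 1 ≤ K d) :
    meanSqError P 2 L s κ K ξ ≤ ∑' i, ENNReal.ofReal
      (‖κ ^ (s - (D : ℝ) / 2) • (errorFun_memLp hL hK s κ i).toLp (errorFun L s κ K i)‖ ^ 2) := by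
  classical
  set c := κ ^ (s - (D : ℝ) / 2) with hc
  set V : (Fin D → ℕ) → Lp ℝ 2 (domainMeasure L) := fun i =>
    (mixedProd_univ_memLp hL hK i).toLp _ with hV
  set U : Ω → Lp ℝ 2 (domainMeasure L) := fun ω =>
    ∑ i ∈ gridIndices K, (c * (feCoef L s κ K i * ξ i ω)) • V i with hU
  have hsum := summable_fieldTerm hL hξ hs κ
  refine le_trans ?_ (hξ.lintegral_norm_hasSum_sq_le
    (fun i => c • (errorFun_memLp hL hK s κ i).toLp (errorFun L s κ K i))
    (fun ω => U ω - field L s κ ξ ω) ?_)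
  · refine lintegral_mono fun ω => ?_
    have hae : (fun x => feField L s κ K ξ ω x - field L s κ ξ ω x) =ᵐ[domainMeasure L]
        (U ω - field L s κ ξ ω : Lp ℝ 2 (domainMeasure L)) := by
      have h1 : ∀ᵐ x ∂domainMeasure L, ∀ i, V i x = mixedProd L K Finset.univ i x :=
        ae_all_iff.2 fun i => (mixedProd_univ_memLp hL hK i).coeFn_toLp
      have h2 : ∀ᵐ x ∂domainMeasure L, ∀ i, ((c * (feCoef L s κ K i * ξ i ω)) • V i : Lp ℝ 2 _) x
          = (c * (feCoef L s κ K i * ξ i ω)) * V i x := ae_all_iff.2 fun i => by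
        filter_upwards [Lp.coeFn_smul (c * (feCoef L s κ K i * ξ i ω)) (V i)] with x hx
        rw [hx, Pi.smul_apply, smul_eq_mul]
      filter_upwards [Lp.coeFn_sub (U ω) (field L s κ ξ ω), h1, h2,
        Lp.coeFn_finsetSum (gridIndices K) (fun i => (c * (feCoef L s κ K i * ξ i ω)) • V i)]
        with x hx0 hx1 hx2 hx3
      rw [hx0, Pi.sub_apply, hU]
      simp only
      rw [hx3, Finset.sum_apply, feField_eq, Finset.mul_sum]
      congr 1
      refine Finset.sum_congr rfl fun i _ => ?_
      rw [hx2, hx1]; ring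
    rw [eLpNorm_congr_ae hae, ← Lp.enorm_def, ← ofReal_norm, ← ENNReal.ofReal_pow (norm_nonneg _)]
  · filter_upwards [hsum] with ω hω
    -- The finite sum is written as a series over all indices, so that subtracting the series of u
    -- gives one Gaussian series with the error functions as coefficients.
    have h1 : HasSum (fun i => if i ∈ gridIndices K then (c * (feCoef L s κ K i * ξ i ω)) • V i
        else 0) (U ω) := by
      have h0 : U ω = ∑ i ∈ gridIndices K, if i ∈ gridIndices K then
          (c * (feCoef L s κ K i * ξ i ω)) • V i else 0 :=
        Finset.sum_congr rfl fun i hi => (if_pos hi).symm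
      rw [h0]
      exact hasSum_sum_of_ne_finset_zero fun i hi => if_neg hi
    refine (h1.sub hω.hasSum).congr_fun fun i => ?_
    refine Lp.ext ?_
    have h2 : ((if i ∈ gridIndices K then (c * (feCoef L s κ K i * ξ i ω)) • V i else 0 :
        Lp ℝ 2 (domainMeasure L)) : (Fin D → ℝ) → ℝ) =ᵐ[domainMeasure L] fun x =>
        if i ∈ gridIndices K then c * (feCoef L s κ K i * ξ i ω) * mixedProd L K Finset.univ i x
        else 0 := by
      split_ifs
      · filter_upwards [Lp.coeFn_smul (c * (feCoef L s κ K i * ξ i ω)) (V i),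
          (mixedProd_univ_memLp hL hK i).coeFn_toLp] with x hx1 hx2
        rw [hx1, Pi.smul_apply, hV, hx2, smul_eq_mul]
      · exact Lp.coeFn_zero _ _ _
    filter_upwards [h2, fieldTerm_eq L s κ ξ ω i, Lp.coeFn_smul (ξ i ω)
        (c • (errorFun_memLp hL hK s κ i).toLp (errorFun L s κ K i)),
      Lp.coeFn_smul c ((errorFun_memLp hL hK s κ i).toLp (errorFun L s κ K i)),
      (errorFun_memLp hL hK s κ i).coeFn_toLp, Lp.coeFn_sub (if i ∈ gridIndices K then
        (c * (feCoef L s κ K i * ξ i ω)) • V i else 0) (fieldTerm L s κ ξ ω i)]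
      with x hx1 hx2 hx3 hx4 hx5 hx6
    rw [hx6, hx3, Pi.sub_apply, Pi.smul_apply, hx4, Pi.smul_apply, hx5, hx1, hx2, errorFun,
      smul_eq_mul, smul_eq_mul]
    split_ifs <;> ring

end FiniteElement


/-! ### The rate in L² -/

section MeanSquare

variable {D : ℕ} {L : Fin D → ℝ}

theorem rpow_sq_eq {κ : ℝ} (hκ : 0 < κ) (s : ℝ) (D : ℕ) :
    (κ ^ (s - (D : ℝ) / 2)) ^ 2 = κ ^ (2 * s - D) := by
  rw [← Real.rpow_natCast, ← Real.rpow_mul hκ.le]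
  congr 1; push_cast; ring

theorem errorFun_zero (hL : ∀ d, 0 < L d) {K : Fin D → ℕ} (hK : ∀ d, 1 ≤ K d) (s κ : ℝ)
    {x : Fin D → ℝ} (hx : x ∈ domain L) : errorFun L s κ K 0 x = 0 := by
  have h := abs_errorFun_low_le hL hK s κ (i := 0) (mem_gridIndices.2 fun d => Nat.zero_le _) hx
  rw [specCoef_zero_eq hL hK] at h
  simpa using h

/-- The `L²` error in terms of the sum over scales. -/
theorem meanSqError_two_le_scaleSum (hD : 1 ≤ D) (hL : ∀ d, 0 < L d) {s : ℝ}
    (hs : (D : ℝ) / 2 < s) (ρ : ℝ) :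
    ∃ C c : ℝ, 0 < C ∧ 0 < c ∧ ∀ {Ω : Type*} [MeasurableSpace Ω] {P : Measure Ω}
      {ξ : (Fin D → ℕ) → Ω → ℝ}, IsIIDStdNormal ξ P → ∀ κ : ℝ, 0 < κ → ∀ K : Fin D → ℕ,
      IsAdmissible L ρ K → meshSize L K ≤ c ∧
        meanSqError P 2 L s κ K ξ
          ≤ ENNReal.ofReal (C * κ ^ (2 * s - D)) * scaleSum c (2 * s - D) (meshSize L K) := by
  have hs0 : 0 < s := lt_of_le_of_lt (by positivity) hs
  obtain ⟨C₀, hC₀, hcoef⟩ := coef_bounds hL hs0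
  obtain ⟨c, hc, hscale⟩ := scale_bounds hD hL ρ
  -- The L² norm of the constant 1, which turns pointwise bounds on the error functions into L²
  -- bounds.
  set W : ℝ := (measureUnivNNReal (domainMeasure L) : ℝ) ^ (2 : ENNReal).toReal⁻¹ with hW
  have hW0 : 0 ≤ W := by positivity
  refine ⟨2 ^ D * (W ^ 2 * (C₀ * (D + 1)) ^ 2 + 1), c, by positivity, hc, ?_⟩
  intro Ω _ P ξ hξ κ hκ K hK
  obtain ⟨hhc, hsc⟩ := hscale K hK
  refine ⟨hhc, (meanSqError_two_le hL hξ hs κ hK.1).trans ?_⟩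
  set h := meshSize L K with hh
  have hh0 : 0 < h := meshSize_pos hD hL hK.1
  have hnorm : ∀ i : Fin D → ℕ, ∀ b : ℝ, 0 ≤ b → (∀ x ∈ domain L, |errorFun L s κ K i x| ≤ b) →
      ENNReal.ofReal (‖κ ^ (s - (D : ℝ) / 2) •
        (errorFun_memLp hL hK.1 s κ i).toLp (errorFun L s κ K i)‖ ^ 2)
        ≤ ENNReal.ofReal (κ ^ (2 * s - D) * (W ^ 2 * b ^ 2)) := by
    intro i b hb hib
    refine ENNReal.ofReal_le_ofReal ?_
    rw [norm_smul, mul_pow, Real.norm_eq_abs, sq_abs, rpow_sq_eq hκ, ← mul_pow]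
    refine mul_le_mul_of_nonneg_left (pow_le_pow_left₀ (norm_nonneg _) ?_ 2) (by positivity)
    refine Lp.norm_le_of_ae_bound hb ?_
    filter_upwards [(errorFun_memLp hL hK.1 s κ i).coeFn_toLp,
      ae_restrict_mem (measurableSet_domain L)] with x hx1 hx2
    rw [hx1]
    exact hib x hx2
  have hκ0 : 0 < κ ^ (2 * s - D) := by positivity
  set A : ℝ := κ ^ (2 * s - D) * (W ^ 2 * (C₀ * (D + 1)) ^ 2) with hA
  have hA0 : 0 ≤ A := by positivity
  refine (tsum_le_tsum_dyadicBlock _ (fun n => ENNReal.ofReal A *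
    ((if (2 : ℝ) ^ n ≤ c / h then ENNReal.ofReal ((h ^ 2 * 2 ^ ((n : ℝ) * (2 - s))) ^ 2) else 0)
      + if (c * h)⁻¹ ≤ (2 : ℝ) ^ n then ENNReal.ofReal ((2 ^ ((n : ℝ) * (-s))) ^ 2) else 0))
    ?_ ?_).trans ?_
  · have := hnorm 0 0 le_rfl fun x hx => by rw [errorFun_zero hL hK.1 s κ hx, abs_zero]
    simpa using this
  · intro n i hi
    by_cases hg : i ∈ gridIndices K
    · have hlow := mem_gridIndices.1 hg
      have h1 := (hsc n i hi).1 hlow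
      rw [if_pos ((le_div_iff₀ hh0).2 h1)]
      obtain ⟨h2, h3⟩ := (hcoef κ n i hi).2.2 K hK.1 hlow
      refine (hnorm i (C₀ * (D + 1) * (h ^ 2 * 2 ^ ((n : ℝ) * (2 - s)))) (by positivity)
        fun x hx => (abs_errorFun_low_le hL hK.1 s κ hg hx).trans ?_).trans ?_
      · refine (add_le_add h2 (Finset.sum_le_sum fun d _ => h3 d)).trans_eq ?_
        simp
        ring
      · refine le_trans (le_of_eq ?_) (mul_le_mul_right le_self_add _)
        rw [← ENNReal.ofReal_mul hA0]
        congr 1; rw [hA]; ring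
    · have htail : ∃ d, K d < i d := by
        rw [mem_gridIndices] at hg
        push Not at hg
        exact hg
      have h1 := (hsc n i hi).2 htail
      have h1' : (c * h)⁻¹ ≤ 2 ^ n := by
        rw [inv_le_iff_one_le_mul₀ (by positivity)]
        linarith
      rw [if_pos h1']
      have h2 := (hcoef κ n i hi).1
      refine (hnorm i (C₀ * (D + 1) * 2 ^ ((n : ℝ) * (-s))) (by positivity)
        fun x _ => ?_).trans ?_
      · rw [errorFun, if_neg hg, zero_sub, abs_neg, abs_mul]
        refine (mul_le_of_le_one_right (abs_nonneg _) (abs_cosProd_le_one L i x)).trans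
          (h2.trans ?_)
        gcongr
        have : (0 : ℝ) ≤ D := Nat.cast_nonneg D
        nlinarith
      · refine le_trans (le_of_eq ?_) (mul_le_mul_right le_add_self _)
        rw [← ENNReal.ofReal_mul hA0]
        congr 1; rw [hA]; ring
  · rw [scaleSum, ← ENNReal.tsum_mul_left]
    refine ENNReal.tsum_le_tsum fun n => ?_
    have hcard : ((dyadicBlock D n).card : ENNReal) ≤ ENNReal.ofReal (2 ^ D * 2 ^ ((n : ℝ) * D)) := by
      rw [← ENNReal.ofReal_natCast]
      exact ENNReal.ofReal_le_ofReal (card_dyadicBlock_le D n)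
    have hconst : 2 ^ D * A ≤ 2 ^ D * (W ^ 2 * (C₀ * (D + 1)) ^ 2 + 1) * κ ^ (2 * s - D) := by
      rw [hA, mul_assoc, mul_comm (κ ^ (2 * s - D))]
      gcongr
      linarith
    -- Multiplying the squared bound for one mode by the size 2^(nD) of the block produces the
    -- exponents of `scaleSum` with a = 2s - D.
    have e1 : (2 : ℝ) ^ ((n : ℝ) * D) * (h ^ 2 * 2 ^ ((n : ℝ) * (2 - s))) ^ 2
        = h ^ 4 * 2 ^ ((n : ℝ) * (4 - (2 * s - D))) := by
      have : (2 : ℝ) ^ ((n : ℝ) * (4 - (2 * s - D)))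
          = 2 ^ ((n : ℝ) * D) * (2 ^ ((n : ℝ) * (2 - s))) ^ 2 := by
        rw [← Real.rpow_natCast (2 ^ ((n : ℝ) * (2 - s))) 2, ← Real.rpow_mul (by norm_num),
          ← Real.rpow_add (by norm_num)]
        congr 1; push_cast; ring
      rw [this]; ring
    have e2 : (2 : ℝ) ^ ((n : ℝ) * D) * (2 ^ ((n : ℝ) * (-s))) ^ 2
        = 2 ^ (-(n : ℝ) * (2 * s - D)) := by
      rw [← Real.rpow_natCast (2 ^ ((n : ℝ) * (-s))) 2, ← Real.rpow_mul (by norm_num),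
        ← Real.rpow_add (by norm_num)]
      congr 1; push_cast; ring
    calc _ ≤ ENNReal.ofReal (2 ^ D * 2 ^ ((n : ℝ) * D)) * (ENNReal.ofReal A *
          ((if (2 : ℝ) ^ n ≤ c / h then ENNReal.ofReal ((h ^ 2 * 2 ^ ((n : ℝ) * (2 - s))) ^ 2) else 0)
          + if (c * h)⁻¹ ≤ (2 : ℝ) ^ n then ENNReal.ofReal ((2 ^ ((n : ℝ) * (-s))) ^ 2) else 0)) := by
          gcongr
      _ = ENNReal.ofReal (2 ^ D * A) * (ENNReal.ofReal (2 ^ ((n : ℝ) * D)) *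
          ((if (2 : ℝ) ^ n ≤ c / h then ENNReal.ofReal ((h ^ 2 * 2 ^ ((n : ℝ) * (2 - s))) ^ 2) else 0)
          + if (c * h)⁻¹ ≤ (2 : ℝ) ^ n then ENNReal.ofReal ((2 ^ ((n : ℝ) * (-s))) ^ 2) else 0)) := by
          rw [ENNReal.ofReal_mul (show (0 : ℝ) ≤ 2 ^ D by positivity) (q := A),
            ENNReal.ofReal_mul (show (0 : ℝ) ≤ 2 ^ D by positivity) (q := 2 ^ ((n : ℝ) * D))]
          ring
      _ = ENNReal.ofReal (2 ^ D * A) *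
          ((if (2 : ℝ) ^ n ≤ c / h then ENNReal.ofReal (h ^ 4 * 2 ^ ((n : ℝ) * (4 - (2 * s - D))))
            else 0)
          + if (c * h)⁻¹ ≤ (2 : ℝ) ^ n then ENNReal.ofReal (2 ^ (-(n : ℝ) * (2 * s - D)))
            else 0) := by
          rw [mul_add, mul_ite, mul_ite, ← ENNReal.ofReal_mul (by positivity),
            ← ENNReal.ofReal_mul (by positivity), e1, e2, mul_zero]
      _ ≤ _ := by
          gcongr

theorem meanSqError_two_le_rate (hD : 1 ≤ D) (hL : ∀ d, 0 < L d) {s : ℝ}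
    (hs : (D : ℝ) / 2 < s) (ρ : ℝ) :
    ∃ C : ℝ, 0 ≤ C ∧ ∀ {Ω : Type*} [MeasurableSpace Ω] {P : Measure Ω}
      {ξ : (Fin D → ℕ) → Ω → ℝ}, IsIIDStdNormal ξ P → ∀ κ : ℝ, 0 < κ → ∀ K : Fin D → ℕ,
      IsAdmissible L ρ K →
      (s ≠ (D : ℝ) / 2 + 2 → meanSqError P 2 L s κ K ξ
        ≤ ENNReal.ofReal (C * κ ^ (2 * s - D) * meshSize L K ^ (min (2 * s - D) 4))) ∧
      (s = (D : ℝ) / 2 + 2 → meanSqError P 2 L s κ K ξ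
        ≤ ENNReal.ofReal (C * κ ^ (2 * s - D) * meshSize L K ^ (min (2 * s - D) 4)
          * (1 + |Real.log (meshSize L K)|))) := by
  obtain ⟨C, c, hC, hc, hmain⟩ := meanSqError_two_le_scaleSum hD hL hs ρ
  by_cases h4 : s = (D : ℝ) / 2 + 2
  · obtain ⟨C', hC', hsc⟩ := scaleSum_four_le hc
    refine ⟨C * C', by positivity, fun hξ κ hκ K hK => ⟨fun hne => absurd h4 hne, fun _ => ?_⟩⟩
    obtain ⟨hhc, hle⟩ := hmain hξ κ hκ K hK
    have e : 2 * s - D = 4 := by rw [h4]; ring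
    have hh := meshSize_pos hD hL hK.1
    refine hle.trans ?_
    rw [e, min_self]
    refine (mul_le_mul_right (hsc _ hh hhc) _).trans ?_
    rw [← ENNReal.ofReal_mul (by positivity)]
    exact ENNReal.ofReal_le_ofReal (le_of_eq (by ring))
  · obtain ⟨C', hC', hsc⟩ := scaleSum_le_of_ne (a := 2 * s - D) (by linarith)
      (fun h => h4 (by linarith)) hc
    refine ⟨C * C', by positivity, fun hξ κ hκ K hK => ⟨fun _ => ?_, fun h => absurd h h4⟩⟩
    obtain ⟨hhc, hle⟩ := hmain hξ κ hκ K hK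
    have hh := meshSize_pos hD hL hK.1
    refine hle.trans ((mul_le_mul_right (hsc _ hh hhc) _).trans ?_)
    rw [← ENNReal.ofReal_mul (by positivity)]
    exact ENNReal.ofReal_le_ofReal (le_of_eq (by ring))

end MeanSquare


/-! ### The rate in L^∞ -/

section Uniform

variable {D : ℕ} {L : Fin D → ℝ}

/-- The coefficients of the cosine sums that control the error uniformly: the differences of the
coefficients (`none`), and the interpolation error in direction `d` (`some d`). -/
def errorCoef (L : Fin D → ℝ) (s κ : ℝ) (K : Fin D → ℕ) : Option (Fin D) → (Fin D → ℕ) → ℝ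
  | none, i => (if i ∈ gridIndices K then feCoef L s κ K i else 0) - specCoef L s κ i
  | some d, i => if i ∈ gridIndices K then
      feCoef L s κ K i * (i d * π / L d) ^ 2 * width L K d ^ 2 else 0

theorem errorCoef_zero (hL : ∀ d, 0 < L d) {K : Fin D → ℕ} (hK : ∀ d, 1 ≤ K d) (s κ : ℝ)
    (k : Option (Fin D)) : errorCoef L s κ K k 0 = 0 := by
  have h0 : (0 : Fin D → ℕ) ∈ gridIndices K := mem_gridIndices.2 fun d => Nat.zero_le _
  cases k with
  | none => rw [errorCoef, if_pos h0, specCoef_zero_eq hL hK, sub_self]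
  | some d => simp [errorCoef]

/-- For resolved modes h² 2^(n(2-s)) is (2^n h)^(2-e) times the claimed quantity, with 2^n h ≤ c;
for unresolved ones 2^(-ns) is multiplied by (c 2^n h)^e ≥ 1. Any order e between 0 and 2 is
therefore available on all blocks at once. -/
theorem abs_errorCoef_le (hD : 1 ≤ D) (hL : ∀ d, 0 < L d) {s : ℝ} (hs : 0 < s) (ρ : ℝ) {e : ℝ}
    (he0 : 0 ≤ e) (he2 : e ≤ 2) :
    ∃ C : ℝ, 0 < C ∧ ∀ κ : ℝ, ∀ K : Fin D → ℕ, IsAdmissible L ρ K → ∀ k n,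
      ∀ i ∈ dyadicBlock D n,
        |errorCoef L s κ K k i| ≤ C * (meshSize L K ^ e * 2 ^ ((n : ℝ) * (e - s))) := by
  obtain ⟨C₀, hC₀, hcoef⟩ := coef_bounds hL hs
  obtain ⟨c, hc, hscale⟩ := scale_bounds hD hL ρ
  refine ⟨C₀ * (c ^ (2 - e) + c ^ e), by positivity, ?_⟩
  intro κ K hK k n i hi
  obtain ⟨h1, -, h2⟩ := hcoef κ n i hi
  have hsc := (hscale K hK).2 n i hi
  have hh : 0 < meshSize L K := meshSize_pos hD hL hK.1
  replace h2 := h2 K hK.1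
  generalize meshSize L K = h at *
  set X : ℝ := h ^ e * 2 ^ ((n : ℝ) * (e - s)) with hX
  have hX0 : 0 < X := by positivity
  have hN : ∀ r : ℝ, ((2 : ℝ) ^ n) ^ r = 2 ^ ((n : ℝ) * r) := fun r => by
    rw [← Real.rpow_natCast, ← Real.rpow_mul (by norm_num)]
  by_cases hg : i ∈ gridIndices K
  · have hlow := mem_gridIndices.1 hg
    have h3 := hsc.1 hlow
    obtain ⟨h4, h5⟩ := h2 hlow
    have h6 : h ^ 2 * 2 ^ ((n : ℝ) * (2 - s)) ≤ c ^ (2 - e) * X := by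
      have e1 : h ^ 2 * 2 ^ ((n : ℝ) * (2 - s)) = (2 ^ n * h) ^ (2 - e) * X := by
        rw [Real.mul_rpow (by positivity) hh.le, hN, hX]
        have e2 : h ^ (2 : ℕ) = h ^ (2 - e) * h ^ e := by
          rw [← Real.rpow_add hh, ← Real.rpow_natCast]; congr 1; push_cast; ring
        have e3 : (2 : ℝ) ^ ((n : ℝ) * (2 - s)) = 2 ^ ((n : ℝ) * (2 - e)) * 2 ^ ((n : ℝ) * (e - s)) := by
          rw [← Real.rpow_add (by norm_num)]; congr 1; ring
        rw [e2, e3]; ring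
      rw [e1]
      gcongr
    have h7 : C₀ * (h ^ 2 * 2 ^ ((n : ℝ) * (2 - s))) ≤ C₀ * (c ^ (2 - e) + c ^ e) * X := by
      rw [mul_assoc]
      refine mul_le_mul_of_nonneg_left (h6.trans ?_) hC₀.le
      have : 0 ≤ c ^ e := by positivity
      nlinarith
    cases k with
    | none =>
      rw [errorCoef, if_pos hg]
      exact h4.trans h7
    | some d =>
      rw [errorCoef, if_pos hg, abs_mul, abs_of_nonneg (sq_nonneg (width L K d))]
      exact (h5 d).trans h7
  · have htail : ∃ d, K d < i d := by
      rw [mem_gridIndices] at hg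
      push Not at hg
      exact hg
    have h3 := hsc.2 htail
    have h6 : (2 : ℝ) ^ ((n : ℝ) * (-s)) ≤ c ^ e * X := by
      have e1 : c ^ e * X = (c * (2 ^ n * h)) ^ e * 2 ^ ((n : ℝ) * (-s)) := by
        rw [Real.mul_rpow hc.le (by positivity), Real.mul_rpow (by positivity) hh.le, hN, hX]
        have e3 : (2 : ℝ) ^ ((n : ℝ) * (e - s)) = 2 ^ ((n : ℝ) * e) * 2 ^ ((n : ℝ) * (-s)) := by
          rw [← Real.rpow_add (by norm_num)]; congr 1; ring
        rw [e3]; ring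
      rw [e1]
      exact le_mul_of_one_le_left (by positivity) (Real.one_le_rpow h3 he0)
    cases k with
    | none =>
      rw [errorCoef, if_neg hg, zero_sub, abs_neg, mul_assoc]
      refine h1.trans (mul_le_mul_of_nonneg_left (h6.trans ?_) hC₀.le)
      have : 0 ≤ c ^ (2 - e) := by positivity
      nlinarith
    | some d =>
      rw [errorCoef, if_neg hg, abs_zero]
      positivity

/-- The error of a partial sum of the field, bounded by the suprema over the blocks. -/
theorem abs_feField_sub_partialSum_le {Ω : Type*} (hL : ∀ d, 0 < L d) {s κ : ℝ} (hκ : 0 < κ)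
    {K : Fin D → ℕ} (hK : ∀ d, 1 ≤ K d) {ξ : (Fin D → ℕ) → Ω → ℝ} {ω : Ω}
    {q : Option (Fin D) → ℕ → ℝ}
    (hq : ∀ k n x, |∑ i ∈ dyadicBlock D n, errorCoef L s κ K k i * ξ i ω * cosProd L i x| ≤ q k n)
    {m : ℕ} (hm : gridIndices K ⊆ dyadicBox D m) {x : Fin D → ℝ} (hx : x ∈ domain L) :
    |feField L s κ K ξ ω x - κ ^ (s - (D : ℝ) / 2)
        * ∑ i ∈ dyadicBox D m, specCoef L s κ i * ξ i ω * cosProd L i x|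
      ≤ κ ^ (s - (D : ℝ) / 2) * ∑ k, ∑ n ∈ Finset.range m, q k n := by
  have hbox : ∀ k y, |∑ i ∈ dyadicBox D m, errorCoef L s κ K k i * ξ i ω * cosProd L i y|
      ≤ ∑ n ∈ Finset.range m, q k n := by
    intro k y
    rw [sum_dyadicBox, errorCoef_zero hL hK, zero_mul, zero_mul, zero_add]
    exact (Finset.abs_sum_le_sum_abs _ _).trans (Finset.sum_le_sum fun n _ => hq k n y)
  have hgrid : ∀ f : (Fin D → ℕ) → ℝ, ∑ i ∈ gridIndices K, f i
      = ∑ i ∈ dyadicBox D m, if i ∈ gridIndices K then f i else 0 := by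
    intro f
    rw [← Finset.sum_filter, Finset.filter_mem_eq_inter, Finset.inter_eq_right.2 hm]
  -- The coefficients `some d` already contain the squared width, so it is divided out here and
  -- restored by the interpolation estimate.
  have hinterp := abs_sum_mixedProd_sub_le hL hK (F := gridIndices K)
    (β := fun i => feCoef L s κ K i * ξ i ω)
    (M := fun d => (∑ n ∈ Finset.range m, q (some d) n) / width L K d ^ 2) (fun d y => by
      have hw := width_pos hL hK d
      rw [le_div_iff₀ (by positivity)]
      refine le_trans (le_of_eq ?_) (hbox (some d) y)
      rw [← abs_of_nonneg (sq_nonneg (width L K d)), ← abs_mul, hgrid, Finset.sum_mul]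
      congr 1
      refine Finset.sum_congr rfl fun i _ => ?_
      rw [errorCoef]
      split_ifs <;> ring) Finset.univ x (fun d _ => mem_Icc_of_mem_domain hx d)
  rw [feField_eq, ← mul_sub, abs_mul, abs_of_nonneg (by positivity)]
  refine mul_le_mul_of_nonneg_left ?_ (by positivity)
  have e : ∑ i ∈ gridIndices K, feCoef L s κ K i * ξ i ω * mixedProd L K Finset.univ i x
        - ∑ i ∈ dyadicBox D m, specCoef L s κ i * ξ i ω * cosProd L i x
      = ∑ i ∈ dyadicBox D m, errorCoef L s κ K none i * ξ i ω * cosProd L i x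
        + (∑ i ∈ gridIndices K, feCoef L s κ K i * ξ i ω * mixedProd L K Finset.univ i x
          - ∑ i ∈ gridIndices K, feCoef L s κ K i * ξ i ω * cosProd L i x) := by
    have h1 : ∑ i ∈ dyadicBox D m, errorCoef L s κ K none i * ξ i ω * cosProd L i x
        = ∑ i ∈ gridIndices K, feCoef L s κ K i * ξ i ω * cosProd L i x
          - ∑ i ∈ dyadicBox D m, specCoef L s κ i * ξ i ω * cosProd L i x := by
      rw [hgrid, ← Finset.sum_sub_distrib]
      refine Finset.sum_congr rfl fun i _ => ?_
      rw [errorCoef]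
      split_ifs <;> ring
    rw [h1]; ring
  rw [e, Fintype.sum_option]
  refine (abs_add_le _ _).trans (add_le_add (hbox none x) (hinterp.trans_eq ?_))
  refine Finset.sum_congr rfl fun d _ => ?_
  have hw := (width_pos hL hK d).ne'
  field_simp

/-- Cauchy–Schwarz with geometric weights: the square of a sum over scales becomes a sum of squares,
at the price of 2^(nη). -/
theorem sq_sum_le_weighted {η Cw : ℝ} (m : ℕ) (Q : ℕ → ℝ) (hQ : ∀ n, 0 ≤ Q n)
    (hCw : ∑ n ∈ Finset.range m, (2 : ℝ) ^ (-(n : ℝ) * η) ≤ Cw) :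
    (∑ n ∈ Finset.range m, √(Q n)) ^ 2
      ≤ Cw * ∑ n ∈ Finset.range m, 2 ^ ((n : ℝ) * η) * Q n := by
  have h := Finset.sum_sq_le_sum_mul_sum_of_sq_le_mul (Finset.range m)
    (r := fun n => √(Q n)) (f := fun n => (2 : ℝ) ^ (-(n : ℝ) * η))
    (g := fun n => 2 ^ ((n : ℝ) * η) * Q n) (fun n _ => by positivity)
    (fun n _ => mul_nonneg (by positivity) (hQ n)) (fun n _ => le_of_eq <| by
      rw [sq_sqrt (hQ n), ← mul_assoc, ← Real.rpow_add (by norm_num)]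
      simp)
  refine h.trans (mul_le_mul_of_nonneg_right hCw ?_)
  exact Finset.sum_nonneg fun n _ => mul_nonneg (by positivity) (hQ n)

theorem eLpNorm_top_sq_le {α : Type*} [MeasurableSpace α] {μ : Measure α} {f : α → ℝ}
    {Z : ENNReal} (h : ∀ᵐ x ∂μ, ENNReal.ofReal (f x ^ 2) ≤ Z) : eLpNorm f ⊤ μ ^ 2 ≤ Z := by
  have hZ : (Z ^ (1 / 2 : ℝ)) ^ (2 : ℕ) = Z := by
    rw [← ENNReal.rpow_natCast, ← ENNReal.rpow_mul]; norm_num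
  rw [← hZ, eLpNorm_exponent_top]
  refine pow_le_pow_left₀ (zero_le) (essSup_le_of_ae_le _ ?_) 2
  filter_upwards [h] with x hx
  have h2 : ‖f x‖ₑ = (‖f x‖ₑ ^ (2 : ℕ)) ^ (1 / 2 : ℝ) := by
    rw [← ENNReal.rpow_natCast, ← ENNReal.rpow_mul]; norm_num
  rw [h2]
  refine ENNReal.rpow_le_rpow ?_ (by norm_num)
  rw [← ofReal_norm, ← ENNReal.ofReal_pow (norm_nonneg _), Real.norm_eq_abs, sq_abs]
  exact hx

/-- With e = min (s - D) 2, block n contributes h^(2e) 2^(n(2e - 2s + D + ε + η)). Since 2e - 2s ≤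
-2D, the choice ε = D/2, η = D/4 leaves the summable factor 2^(-nD/4). -/
theorem meanSqError_top_le (hD : 1 ≤ D) (hL : ∀ d, 0 < L d) {s : ℝ} (hs : (D : ℝ) < s) (ρ : ℝ) :
    ∃ C : ℝ, 0 ≤ C ∧ ∀ {Ω : Type*} [MeasurableSpace Ω] {P : Measure Ω} [IsProbabilityMeasure P]
      {ξ : (Fin D → ℕ) → Ω → ℝ}, IsIIDStdNormal ξ P → ∀ κ : ℝ, 0 < κ → ∀ K : Fin D → ℕ,
      IsAdmissible L ρ K → meanSqError P ⊤ L s κ K ξ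
        ≤ ENNReal.ofReal (C * κ ^ (2 * s - D) * meshSize L K ^ (min (2 * s - 2 * D) 4)) := by
  have hD0 : (0 : ℝ) < D := by exact_mod_cast hD
  have hs0 : 0 < s := hD0.trans hs
  have hs2 : (D : ℝ) / 2 < s := by linarith
  set e : ℝ := min (s - D) 2 with he
  have he0 : 0 ≤ e := le_min (by linarith) (by norm_num)
  have he2 : e ≤ 2 := min_le_right _ _
  have hes : e ≤ s - D := min_le_left _ _
  have h2e : min (2 * s - 2 * D) 4 = e + e := by
    rw [he, ← two_mul, mul_min_of_nonneg _ _ zero_le_two]; congr 1 <;> ring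
  obtain ⟨C₁, hC₁, hcoef⟩ := abs_errorCoef_le hD hL hs0 ρ he0 he2
  obtain ⟨C₂, hC₂, hsup⟩ := exists_block_sup_bound D (ε := D / 2) (by positivity)
  obtain ⟨C₃, hC₃, hgeo⟩ := tsum_ofReal_two_rpow_neg (a := (D : ℝ) / 4) (by positivity)
  have hCw := summable_two_rpow_neg (a := (D : ℝ) / 4) (by positivity)
  set Cw : ℝ := ∑' n : ℕ, (2 : ℝ) ^ (-(n : ℝ) * ((D : ℝ) / 4)) with hCwdef
  have hCw0 : 0 ≤ Cw := tsum_nonneg fun n => by positivity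
  have hCwm : ∀ m, ∑ n ∈ Finset.range m, (2 : ℝ) ^ (-(n : ℝ) * ((D : ℝ) / 4)) ≤ Cw := fun m =>
    hCw.sum_le_tsum _ fun n _ => by positivity
  refine ⟨(D + 1) * Cw * ((D + 1) * (C₂ * C₁ ^ 2 * C₃)), by positivity, ?_⟩
  intro Ω _ P _ ξ hξ κ hκ K hK
  set h := meshSize L K with hh
  have hh0 : 0 < h := meshSize_pos hD hL hK.1
  have hex : ∀ k : Option (Fin D), ∀ n : ℕ, ∃ Q : Ω → ℝ, Measurable Q ∧ (∀ ω, 0 ≤ Q ω) ∧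
      (∀ ω x, (∑ i ∈ dyadicBlock D n, errorCoef L s κ K k i * ξ i ω * cosProd L i x) ^ 2 ≤ Q ω) ∧
      ∫⁻ ω, ENNReal.ofReal (Q ω) ∂P ≤ ENNReal.ofReal
        (C₂ * ((C₁ * (h ^ e * 2 ^ ((n : ℝ) * (e - s)))) ^ 2 * 2 ^ ((n : ℝ) * (D + D / 2)))) :=
    fun k n => hsup hξ hL (g := fun _ => cos) (fun _ => isWave_cos) n (errorCoef L s κ K k)
      (C₁ * (h ^ e * 2 ^ ((n : ℝ) * (e - s)))) (by positivity) (hcoef κ K hK k n)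
  choose Q hQm hQ0 hQ hQint using hex
  set Y : Ω → ENNReal := fun ω => ∑ k, ∑' n : ℕ,
    ENNReal.ofReal (2 ^ ((n : ℝ) * ((D : ℝ) / 4)) * Q k n ω) with hY
  set A : ℝ := κ ^ (2 * s - D) * ((D + 1) * Cw) with hA
  have hA0 : 0 ≤ A := by positivity
  obtain ⟨m₀, hm₀⟩ := exists_subset_dyadicBox (gridIndices K)
  have hpath : ∀ᵐ ω ∂P,
      eLpNorm (fun x => feField L s κ K ξ ω x - field L s κ ξ ω x) ⊤ (domainMeasure L) ^ 2
        ≤ ENNReal.ofReal A * Y ω := by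
    -- The bound holds for all late partial sums with a majorant independent of their length, and
    -- passes to u at almost every x along an almost everywhere convergent subsequence.
    filter_upwards [summable_fieldTerm hL hξ hs2 κ] with ω hω
    obtain ⟨ns, hns, hlim⟩ := exists_subseq_tendsto_field hω
    refine eLpNorm_top_sq_le ?_
    filter_upwards [hlim, ae_restrict_mem (measurableSet_domain L)] with x hx hxd
    have ht : Filter.Tendsto (fun j => ENNReal.ofReal ((feField L s κ K ξ ω x
        - κ ^ (s - (D : ℝ) / 2) * ∑ i ∈ dyadicBox D (ns j), specCoef L s κ i * ξ i ω * cosProd L i x)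
          ^ 2)) Filter.atTop (nhds (ENNReal.ofReal ((feField L s κ K ξ ω x
            - field L s κ ξ ω x) ^ 2))) :=
      ENNReal.tendsto_ofReal ((tendsto_const_nhds.sub hx).pow 2)
    refine le_of_tendsto ht ?_
    filter_upwards [Filter.eventually_ge_atTop m₀] with j hj
    have hsub : gridIndices K ⊆ dyadicBox D (ns j) :=
      hm₀.trans (dyadicBox_mono D (hj.trans (hns.id_le j)))
    have h1 := abs_feField_sub_partialSum_le hL hκ hK.1 (s := s) (ξ := ξ) (ω := ω)
      (q := fun k n => √(Q k n ω)) (fun k n y => abs_le_sqrt (hQ k n ω y)) hsub hxd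
    have h2 : (∑ k : Option (Fin D), ∑ n ∈ Finset.range (ns j), √(Q k n ω)) ^ 2
        ≤ (D + 1) * Cw * ∑ k, ∑ n ∈ Finset.range (ns j),
          2 ^ ((n : ℝ) * ((D : ℝ) / 4)) * Q k n ω := by
      refine sq_sum_le_card_mul_sum_sq.trans ?_
      rw [Finset.card_univ, Fintype.card_option, Fintype.card_fin, mul_assoc, Finset.mul_sum Finset.univ _ Cw]
      push_cast
      refine mul_le_mul_of_nonneg_left (Finset.sum_le_sum fun k _ => ?_) (by positivity)
      exact sq_sum_le_weighted _ _ (fun n => hQ0 k n ω) (hCwm _)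
    calc _ ≤ ENNReal.ofReal (A * ∑ k, ∑ n ∈ Finset.range (ns j),
          2 ^ ((n : ℝ) * ((D : ℝ) / 4)) * Q k n ω) := by
          refine ENNReal.ofReal_le_ofReal ?_
          rw [← sq_abs]
          refine (pow_le_pow_left₀ (abs_nonneg _) h1 2).trans ?_
          rw [mul_pow, rpow_sq_eq hκ, hA, mul_assoc]
          exact mul_le_mul_of_nonneg_left h2 (by positivity)
      _ = ENNReal.ofReal A * ∑ k, ∑ n ∈ Finset.range (ns j),
          ENNReal.ofReal (2 ^ ((n : ℝ) * ((D : ℝ) / 4)) * Q k n ω) := by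
          have h0 : ∀ k, ∀ n : ℕ, 0 ≤ 2 ^ ((n : ℝ) * ((D : ℝ) / 4)) * Q k n ω := fun k n =>
            mul_nonneg (by positivity) (hQ0 k n ω)
          rw [ENNReal.ofReal_mul hA0,
            ENNReal.ofReal_sum_of_nonneg fun k _ => Finset.sum_nonneg fun n _ => h0 k n]
          congr 1
          exact Finset.sum_congr rfl fun k _ => ENNReal.ofReal_sum_of_nonneg fun n _ => h0 k n
      _ ≤ ENNReal.ofReal A * Y ω := by
          refine mul_le_mul_right (Finset.sum_le_sum fun k _ => ?_) _
          exact ENNReal.sum_le_tsum _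
  have hYm : ∀ k, ∀ n : ℕ, Measurable fun ω =>
      ENNReal.ofReal (2 ^ ((n : ℝ) * ((D : ℝ) / 4)) * Q k n ω) := fun k n =>
    ENNReal.measurable_ofReal.comp ((hQm k n).const_mul _)
  have hterm : ∀ k, ∀ n : ℕ, ∫⁻ ω, ENNReal.ofReal (2 ^ ((n : ℝ) * ((D : ℝ) / 4)) * Q k n ω) ∂P
      ≤ ENNReal.ofReal (C₂ * C₁ ^ 2 * h ^ (e + e)) * ENNReal.ofReal (2 ^ (-(n : ℝ) * ((D : ℝ) / 4))) := by
    intro k n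
    simp_rw [ENNReal.ofReal_mul (show (0 : ℝ) ≤ 2 ^ ((n : ℝ) * ((D : ℝ) / 4)) by positivity)]
    rw [lintegral_const_mul' _ _ ENNReal.ofReal_ne_top]
    refine (mul_le_mul_right (hQint k n) _).trans ?_
    rw [← ENNReal.ofReal_mul (by positivity), ← ENNReal.ofReal_mul (by positivity)]
    refine ENNReal.ofReal_le_ofReal ?_
    have e1 : (2 : ℝ) ^ ((n : ℝ) * ((D : ℝ) / 4)) * (C₂ * ((C₁ * (h ^ e * 2 ^ ((n : ℝ) * (e - s)))) ^ 2
          * 2 ^ ((n : ℝ) * (D + D / 2))))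
        = C₂ * C₁ ^ 2 * h ^ (e + e) * 2 ^ ((n : ℝ) * (D / 4 + (e - s) + (e - s) + (D + D / 2))) := by
      have e2 : (2 : ℝ) ^ ((n : ℝ) * (D / 4 + (e - s) + (e - s) + (D + D / 2)))
          = 2 ^ ((n : ℝ) * ((D : ℝ) / 4)) * 2 ^ ((n : ℝ) * (e - s)) * 2 ^ ((n : ℝ) * (e - s))
            * 2 ^ ((n : ℝ) * (D + D / 2)) := by
        rw [← Real.rpow_add (by norm_num), ← Real.rpow_add (by norm_num),
          ← Real.rpow_add (by norm_num)]
        congr 1; ring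
      rw [e2, Real.rpow_add hh0]
      ring
    rw [e1]
    refine mul_le_mul_of_nonneg_left (Real.rpow_le_rpow_of_exponent_le (by norm_num) ?_)
      (by positivity)
    have : (0 : ℝ) ≤ n := Nat.cast_nonneg n
    nlinarith
  calc meanSqError P ⊤ L s κ K ξ ≤ ∫⁻ ω, ENNReal.ofReal A * Y ω ∂P := lintegral_mono_ae hpath
    _ = ENNReal.ofReal A * ∑ k, ∑' n : ℕ,
          ∫⁻ ω, ENNReal.ofReal (2 ^ ((n : ℝ) * ((D : ℝ) / 4)) * Q k n ω) ∂P := by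
        rw [lintegral_const_mul' _ _ ENNReal.ofReal_ne_top, hY,
          lintegral_finsetSum _ fun k _ => Measurable.tsum fun n => hYm k n]
        congr 1
        exact Finset.sum_congr rfl fun k _ => lintegral_tsum fun n => (hYm k n).aemeasurable
    _ ≤ ENNReal.ofReal A * ∑ k : Option (Fin D),
          ENNReal.ofReal (C₂ * C₁ ^ 2 * h ^ (e + e)) * ENNReal.ofReal C₃ := by
        refine mul_le_mul_right (Finset.sum_le_sum fun k _ => ?_) _
        refine (ENNReal.tsum_le_tsum fun n => hterm k n).trans ?_
        rw [ENNReal.tsum_mul_left]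
        exact mul_le_mul_right hgeo _
    _ = _ := by
        rw [Finset.sum_const, Finset.card_univ, Fintype.card_option, Fintype.card_fin, nsmul_eq_mul,
          ← ENNReal.ofReal_natCast, ← ENNReal.ofReal_mul (by positivity),
          ← ENNReal.ofReal_mul (by positivity), ← ENNReal.ofReal_mul (by positivity), h2e, hA]
        congr 1
        push_cast
        ring

end Uniform


/-! ### Hölder regularity of the field -/

section Hoelder

variable {D : ℕ} {L : Fin D → ℝ}

/-- Almost surely, the blocks of a Gaussian wave series with coefficients of order `2 ^ (n * r)` are
of order `2 ^ (n * (r + D / 2 + ε))`. -/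
theorem ae_exists_block_bound {Ω : Type*} [MeasurableSpace Ω] {P : Measure Ω}
    [IsProbabilityMeasure P] (hL : ∀ d, 0 < L d) {ξ : (Fin D → ℕ) → Ω → ℝ}
    (hξ : IsIIDStdNormal ξ P) {g : Fin D → ℝ → ℝ} (hg : ∀ d, IsWave (g d))
    {b : (Fin D → ℕ) → ℝ} {C r : ℝ} (hC : 0 < C)
    (hb : ∀ n, ∀ i ∈ dyadicBlock D n, |b i| ≤ C * 2 ^ ((n : ℝ) * r)) {ε : ℝ} (hε : 0 < ε) :
    ∀ᵐ ω ∂P, ∃ M : ℝ, 0 ≤ M ∧ ∀ n : ℕ, ∀ x,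
      |∑ i ∈ dyadicBlock D n, b i * ξ i ω * waveProd g L i x|
        ≤ M * 2 ^ ((n : ℝ) * (r + D / 2 + ε)) := by
  obtain ⟨C₁, hC₁, hsup⟩ := exists_block_sup_bound D hε
  obtain ⟨C₂, hC₂, hgeo⟩ := tsum_ofReal_two_rpow_neg hε
  have hex : ∀ n : ℕ, ∃ Q : Ω → ℝ, Measurable Q ∧ (∀ ω, 0 ≤ Q ω) ∧
      (∀ ω x, (∑ i ∈ dyadicBlock D n, b i * ξ i ω * waveProd g L i x) ^ 2 ≤ Q ω) ∧
      ∫⁻ ω, ENNReal.ofReal (Q ω) ∂P ≤ ENNReal.ofReal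
        (C₁ * ((C * 2 ^ ((n : ℝ) * r)) ^ 2 * 2 ^ ((n : ℝ) * (D + ε)))) :=
    fun n => hsup hξ hL hg n b (C * 2 ^ ((n : ℝ) * r)) (by positivity) (hb n)
  choose Q hQm hQ0 hQ hQint using hex
  have hYm : ∀ n : ℕ, Measurable fun ω =>
      ENNReal.ofReal (2 ^ (-((n : ℝ) * (2 * (r + D / 2 + ε)))) * Q n ω) := fun n =>
    ENNReal.measurable_ofReal.comp ((hQm n).const_mul _)
  have hterm : ∀ n : ℕ,
      ∫⁻ ω, ENNReal.ofReal (2 ^ (-((n : ℝ) * (2 * (r + D / 2 + ε)))) * Q n ω) ∂P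
        ≤ ENNReal.ofReal (C₁ * C ^ 2) * ENNReal.ofReal (2 ^ (-(n : ℝ) * ε)) := by
    intro n
    simp_rw [ENNReal.ofReal_mul
      (show (0 : ℝ) ≤ 2 ^ (-((n : ℝ) * (2 * (r + D / 2 + ε)))) by positivity)]
    rw [lintegral_const_mul' _ _ ENNReal.ofReal_ne_top]
    refine (mul_le_mul_right (hQint n) _).trans (le_of_eq ?_)
    rw [← ENNReal.ofReal_mul (by positivity), ← ENNReal.ofReal_mul (by positivity)]
    congr 1
    have e : (2 : ℝ) ^ (-(n : ℝ) * ε) = 2 ^ (-((n : ℝ) * (2 * (r + D / 2 + ε))))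
        * 2 ^ ((n : ℝ) * r) * 2 ^ ((n : ℝ) * r) * 2 ^ ((n : ℝ) * (D + ε)) := by
      rw [← Real.rpow_add (by norm_num), ← Real.rpow_add (by norm_num),
        ← Real.rpow_add (by norm_num)]
      congr 1; ring
    rw [e]
    ring
  -- With the weights 2^(-2n(r + D/2 + ε)) the majorants have expectation O(2^(-nε)), so their sum
  -- is almost surely finite and bounds every single term.
  have hfin : ∫⁻ ω, ∑' n : ℕ,
      ENNReal.ofReal (2 ^ (-((n : ℝ) * (2 * (r + D / 2 + ε)))) * Q n ω) ∂P ≠ ⊤ := by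
    rw [lintegral_tsum fun n => (hYm n).aemeasurable]
    refine ((ENNReal.tsum_le_tsum hterm).trans_lt ?_).ne
    rw [ENNReal.tsum_mul_left]
    exact ENNReal.mul_lt_top ENNReal.ofReal_lt_top (hgeo.trans_lt ENNReal.ofReal_lt_top)
  filter_upwards [ae_lt_top (Measurable.tsum fun n => hYm n) hfin] with ω hω
  obtain ⟨Y, hY⟩ : ∃ Y : ℝ, Y = (∑' n : ℕ,
    ENNReal.ofReal (2 ^ (-((n : ℝ) * (2 * (r + D / 2 + ε)))) * Q n ω)).toReal := ⟨_, rfl⟩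
  have hY0 : 0 ≤ Y := hY ▸ ENNReal.toReal_nonneg
  refine ⟨√Y, sqrt_nonneg _, fun n x => ?_⟩
  have h1 : 2 ^ (-((n : ℝ) * (2 * (r + D / 2 + ε)))) * Q n ω ≤ Y := by
    rw [hY, ← ENNReal.ofReal_le_iff_le_toReal hω.ne]
    exact ENNReal.le_tsum (f := fun n : ℕ =>
      ENNReal.ofReal (2 ^ (-((n : ℝ) * (2 * (r + D / 2 + ε)))) * Q n ω)) n
  rw [Real.rpow_neg (by norm_num), inv_mul_le_iff₀ (by positivity)] at h1
  refine abs_le_of_sq_le_sq ((hQ n ω x).trans (h1.trans (le_of_eq ?_))) (by positivity)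
  rw [mul_pow, sq_sqrt hY0, ← Real.rpow_natCast (2 ^ ((n : ℝ) * (r + D / 2 + ε))) 2,
    ← Real.rpow_mul (by norm_num), mul_comm]
  congr 2; push_cast; ring

/-- A partial derivative turns one cosine into a sine; this is why the supremum bounds are stated
for general waves. -/
theorem hasDerivAt_cosProd_line (L : Fin D → ℝ) (i : Fin D → ℕ) (x y : Fin D → ℝ) (t : ℝ) :
    HasDerivAt (fun t : ℝ => cosProd L i (fun d => y d + t * (x d - y d)))
      (-∑ d, (x d - y d) * ((i d * π / L d)
        * waveProd (Function.update (fun _ => cos) d sin) L i (fun d => y d + t * (x d - y d)))) t := by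
  have hω : ∀ d, HasDerivAt (fun t : ℝ => (i d : ℝ) * π * (y d + t * (x d - y d)) / L d)
      (i d * π / L d * (x d - y d)) t := by
    intro d
    have := ((hasDerivAt_id t).mul_const (x d - y d)).const_add (y d)
    have h2 := this.const_mul ((i d : ℝ) * π / L d)
    refine (h2.congr_of_eventuallyEq (Filter.Eventually.of_forall fun r => ?_)).congr_deriv
      (by ring)
    simp only [id]; ring
  have h := HasDerivAt.fun_finsetProd (u := Finset.univ) fun d _ => (hω d).cos
  refine h.congr_deriv ?_
  rw [← Finset.sum_neg_distrib]
  refine Finset.sum_congr rfl fun d _ => ?_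
  rw [waveProd, ← Finset.mul_prod_erase _ _ (Finset.mem_univ d), Function.update_self, smul_eq_mul]
  have e : ∏ j ∈ Finset.univ.erase d, Function.update (fun _ => cos) d sin j
        ((i j : ℝ) * π * (y j + t * (x j - y j)) / L j)
      = ∏ j ∈ Finset.univ.erase d, cos ((i j : ℝ) * π * (y j + t * (x j - y j)) / L j) :=
    Finset.prod_congr rfl fun j hj => by rw [Function.update_of_ne (Finset.ne_of_mem_erase hj)]
  rw [e]
  ring

/-- A cosine sum whose partial derivatives are bounded by `B` is Lipschitz. -/
theorem abs_sum_cosProd_sub_le {F : Finset (Fin D → ℕ)} {β : (Fin D → ℕ) → ℝ} {B : ℝ}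
    (hB : ∀ d y, |∑ i ∈ F, β i * (i d * π / L d)
      * waveProd (Function.update (fun _ => cos) d sin) L i y| ≤ B) (x y : Fin D → ℝ) :
    |∑ i ∈ F, β i * cosProd L i x - ∑ i ∈ F, β i * cosProd L i y|
      ≤ D * B * √(∑ d, (x d - y d) ^ 2) := by
  have hderiv : ∀ t : ℝ, HasDerivAt
      (fun t : ℝ => ∑ i ∈ F, β i * cosProd L i (fun d => y d + t * (x d - y d)))
      (-∑ d, (x d - y d) * ∑ i ∈ F, β i * (i d * π / L d)
        * waveProd (Function.update (fun _ => cos) d sin) L i (fun d => y d + t * (x d - y d))) t := by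
    intro t
    have h := HasDerivAt.fun_sum (u := F) fun i _ =>
      (hasDerivAt_cosProd_line L i x y t).const_mul (β i)
    refine h.congr_deriv ?_
    simp_rw [mul_neg, Finset.sum_neg_distrib, Finset.mul_sum]
    rw [Finset.sum_comm]
    congr 1
    refine Finset.sum_congr rfl fun d _ => Finset.sum_congr rfl fun i _ => ?_
    ring
  have hdist : ∀ d, |x d - y d| ≤ √(∑ d, (x d - y d) ^ 2) := fun d =>
    abs_le_sqrt (Finset.single_le_sum (f := fun d => (x d - y d) ^ 2)
      (fun _ _ => sq_nonneg _) (Finset.mem_univ d))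
  have h := Convex.norm_image_sub_le_of_norm_hasDerivWithin_le (s := Set.univ)
    (C := D * B * √(∑ d, (x d - y d) ^ 2)) (fun t _ => (hderiv t).hasDerivWithinAt)
    (fun t _ => by
      rw [norm_neg, Real.norm_eq_abs]
      refine (Finset.abs_sum_le_sum_abs _ _).trans ((Finset.sum_le_card_nsmul _ _
        (√(∑ d, (x d - y d) ^ 2) * B) fun d _ => ?_).trans_eq ?_)
      · rw [abs_mul]
        exact mul_le_mul (hdist d) (hB d _) (abs_nonneg _) (sqrt_nonneg _)
      · simp; ring) convex_univ (mem_univ 0) (mem_univ 1)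
  simpa using h

theorem min_one_le_rpow {t β : ℝ} (ht : 0 ≤ t) (hβ0 : 0 ≤ β) (hβ1 : β ≤ 1) : min 1 t ≤ t ^ β := by
  rcases le_total 1 t with h | h
  · rw [min_eq_left h]
    exact Real.one_le_rpow h hβ0
  · rw [min_eq_right h]
    exact Real.self_le_rpow_of_le_one ht h hβ1

/-- Interpolation between a supremum bound and a Lipschitz bound on each block. -/
theorem isHolderOn_of_blocks {f : ℕ → (Fin D → ℝ) → ℝ} {M σ β : ℝ} (hM : 0 ≤ M) (hβ0 : 0 < β)
    (hβ1 : β ≤ 1) (hβσ : β < σ) (hsup : ∀ (n : ℕ) x, |f n x| ≤ M * 2 ^ (-(n : ℝ) * σ))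
    (hlip : ∀ (n : ℕ) x y, |f n x - f n y|
      ≤ M * 2 ^ (-(n : ℝ) * (σ - 1)) * √(∑ d, (x d - y d) ^ 2)) (S : Set (Fin D → ℝ)) :
    IsHolderOn β (fun x => ∑' n, f n x) S := by
  have hsum := summable_two_rpow_neg (a := σ - β) (by linarith)
  have hfs : ∀ x, Summable fun n => f n x := fun x =>
    Summable.of_norm_bounded ((summable_two_rpow_neg (hβ0.trans hβσ)).mul_left M) fun n => hsup n x
  refine ⟨2 * M * ∑' n : ℕ, (2 : ℝ) ^ (-(n : ℝ) * (σ - β)), fun x _ y _ => ?_⟩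
  obtain ⟨r, hr⟩ : ∃ r, r = √(∑ d, (x d - y d) ^ 2) := ⟨_, rfl⟩
  have hr0 : 0 ≤ r := hr ▸ sqrt_nonneg _
  rw [← (hfs x).tsum_sub (hfs y), ← hr, ← Real.norm_eq_abs]
  have hbound := (hsum.hasSum.mul_left (2 * M)).mul_right (r ^ β)
  refine tsum_of_norm_bounded hbound fun n => ?_
  have h1 : |f n x - f n y| ≤ 2 * M * 2 ^ (-(n : ℝ) * σ) := by
    refine (abs_sub _ _).trans ?_
    linarith [hsup n x, hsup n y]
  have h2 := hlip n x y
  rw [← hr] at h2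
  have e1 : (2 : ℝ) ^ (-(n : ℝ) * (σ - 1)) = 2 ^ (-(n : ℝ) * σ) * 2 ^ n := by
    rw [← Real.rpow_natCast, ← Real.rpow_add (by norm_num)]; congr 1; ring
  have e2 : (2 : ℝ) ^ (-(n : ℝ) * (σ - β)) = 2 ^ (-(n : ℝ) * σ) * (2 ^ n) ^ β := by
    rw [← Real.rpow_natCast, ← Real.rpow_mul (by norm_num), ← Real.rpow_add (by norm_num)]
    congr 1; ring
  -- The minimum is at most (2^n r)^β, which leaves 2^(-n(σ-β)) r^β, summable in n because β < σ.
  have h3 : |f n x - f n y| ≤ 2 * M * 2 ^ (-(n : ℝ) * σ) * min 1 (2 ^ n * r) := by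
    rw [mul_min_of_nonneg _ _ (by positivity), mul_one]
    refine le_min h1 (h2.trans ?_)
    rw [e1]
    have : 0 ≤ M * (2 ^ (-(n : ℝ) * σ) * 2 ^ n) * r := by positivity
    nlinarith
  calc ‖f n x - f n y‖ ≤ 2 * M * 2 ^ (-(n : ℝ) * σ) * min 1 (2 ^ n * r) := h3
    _ ≤ 2 * M * 2 ^ (-(n : ℝ) * σ) * (2 ^ n * r) ^ β := by
        gcongr
        exact min_one_le_rpow (by positivity) hβ0.le hβ1
    _ = 2 * M * 2 ^ (-(n : ℝ) * (σ - β)) * r ^ β := by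
        rw [e2, Real.mul_rpow (by positivity) hr0]; ring

/-- For every σ < s - D/2 the blocks are almost surely O(2^(-nσ)) and their gradients
O(2^(-n(σ-1))). The blockwise sum is one version of u, the same for all β. -/
theorem ae_exists_holder {Ω : Type*} [MeasurableSpace Ω] {P : Measure Ω}
    [IsProbabilityMeasure P] (hL : ∀ d, 0 < L d) {ξ : (Fin D → ℕ) → Ω → ℝ}
    (hξ : IsIIDStdNormal ξ P) {s : ℝ} (hs : (D : ℝ) / 2 < s) (κ : ℝ) :
    ∀ᵐ ω ∂P, ∃ v : (Fin D → ℝ) → ℝ,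
      (field L s κ ξ ω : (Fin D → ℝ) → ℝ) =ᵐ[domainMeasure L] v ∧
      ∀ β : ℝ, 0 < β → β < min 1 (s - (D : ℝ) / 2) → IsHolderOn β v (domain L) := by
  have hs0 : 0 < s := lt_of_le_of_lt (by positivity) hs
  obtain ⟨C, hC, hcoef⟩ := coef_bounds hL hs0
  -- The loss ε runs through the countable family 1/(k+1), so a single null set serves every β.
  have h1 : ∀ᵐ ω ∂P, ∀ k : ℕ, ∃ M : ℝ, 0 ≤ M ∧ ∀ n : ℕ, ∀ x,
      |∑ i ∈ dyadicBlock D n, specCoef L s κ i * ξ i ω * cosProd L i x|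
        ≤ M * 2 ^ ((n : ℝ) * (-s + D / 2 + 1 / ((k : ℝ) + 1))) :=
    ae_all_iff.2 fun k => ae_exists_block_bound hL hξ (g := fun _ => cos) (fun _ => isWave_cos) hC
      (fun n i hi => (hcoef κ n i hi).1) (by positivity)
  have h2 : ∀ᵐ ω ∂P, ∀ k : ℕ, ∀ d : Fin D, ∃ M : ℝ, 0 ≤ M ∧ ∀ n : ℕ, ∀ x,
      |∑ i ∈ dyadicBlock D n, specCoef L s κ i * (i d * π / L d) * ξ i ω
          * waveProd (Function.update (fun _ => cos) d sin) L i x|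
        ≤ M * 2 ^ ((n : ℝ) * (1 - s + D / 2 + 1 / ((k : ℝ) + 1))) := by
    refine ae_all_iff.2 fun k => ae_all_iff.2 fun d => ae_exists_block_bound hL hξ (fun j => ?_) hC
      (fun n i hi => (hcoef κ n i hi).2.1 d) (by positivity)
    rcases eq_or_ne j d with rfl | hj
    · rw [Function.update_self]; exact isWave_sin
    · rw [Function.update_of_ne hj]; exact isWave_cos
  filter_upwards [h1, h2, summable_fieldTerm hL hξ hs κ] with ω hω1 hω2 hω3
  set c := κ ^ (s - (D : ℝ) / 2) with hc
  set f : ℕ → (Fin D → ℝ) → ℝ := fun n x =>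
    ∑ i ∈ dyadicBlock D n, specCoef L s κ i * ξ i ω * cosProd L i x with hf
  have hblocks : ∀ τ : ℝ, τ < s - D / 2 → ∃ M σ : ℝ, 0 ≤ M ∧ τ < σ ∧
      (∀ (n : ℕ) x, |f n x| ≤ M * 2 ^ (-(n : ℝ) * σ)) ∧
      ∀ (n : ℕ) x y, |f n x - f n y|
        ≤ M * 2 ^ (-(n : ℝ) * (σ - 1)) * √(∑ d, (x d - y d) ^ 2) := by
    intro τ hτ
    obtain ⟨k, hk⟩ := exists_nat_one_div_lt (sub_pos.2 hτ)
    obtain ⟨M₁, hM₁, hsup⟩ := hω1 k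
    choose M₂ hM₂ hder using hω2 k
    have hS : ∀ d, M₂ d ≤ ∑ d, M₂ d := fun d =>
      Finset.single_le_sum (fun d _ => hM₂ d) (Finset.mem_univ d)
    have hS0 : 0 ≤ ∑ d, M₂ d := Finset.sum_nonneg fun d _ => hM₂ d
    refine ⟨M₁ + D * ∑ d, M₂ d, s - D / 2 - 1 / ((k : ℝ) + 1), by positivity, by linarith, ?_, ?_⟩
    · intro n x
      refine (hsup n x).trans ?_
      have e : (n : ℝ) * (-s + D / 2 + 1 / ((k : ℝ) + 1))
          = -(n : ℝ) * (s - D / 2 - 1 / ((k : ℝ) + 1)) := by ring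
      rw [e]
      gcongr
      have : 0 ≤ D * ∑ d, M₂ d := by positivity
      linarith
    · intro n x y
      have h := abs_sum_cosProd_sub_le (L := L) (F := dyadicBlock D n)
        (β := fun i => specCoef L s κ i * ξ i ω)
        (B := (∑ d, M₂ d) * 2 ^ ((n : ℝ) * (1 - s + D / 2 + 1 / ((k : ℝ) + 1)))) (fun d z => by
          refine le_trans (le_of_eq ?_) ((hder d n z).trans ?_)
          · congr 1
            exact Finset.sum_congr rfl fun i _ => by ring
          · gcongr
            exact hS d) x y
      refine h.trans ?_
      have e : (n : ℝ) * (1 - s + D / 2 + 1 / ((k : ℝ) + 1))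
          = -(n : ℝ) * (s - D / 2 - 1 / ((k : ℝ) + 1) - 1) := by ring
      rw [e, ← mul_assoc]
      gcongr
      linarith
  obtain ⟨M₀, σ₀, hM₀, hσ₀, hsup₀, -⟩ := hblocks 0 (by linarith)
  have hfs : ∀ x, Summable fun n => f n x := fun x =>
    Summable.of_norm_bounded ((summable_two_rpow_neg hσ₀).mul_left M₀) fun n => hsup₀ n x
  refine ⟨fun x => c * (specCoef L s κ 0 * ξ 0 ω + ∑' n, f n x), ?_, fun β hβ0 hβ => ?_⟩
  · obtain ⟨ns, hns, hlim⟩ := exists_subseq_tendsto_field hω3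
    filter_upwards [hlim] with x hx
    -- Partial sums over boxes converge to u along a subsequence almost everywhere, and to v at
    -- every point.
    refine tendsto_nhds_unique hx ?_
    have hpart : ∀ m, ∑ i ∈ dyadicBox D m, specCoef L s κ i * ξ i ω * cosProd L i x
        = specCoef L s κ 0 * ξ 0 ω + ∑ n ∈ Finset.range m, f n x := by
      intro m
      rw [sum_dyadicBox]
      congr 1
      simp [cosProd]
    simp_rw [hpart]
    exact (((hfs x).hasSum.tendsto_sum_nat.comp hns.tendsto_atTop).const_add _).const_mul _
  · obtain ⟨hβ1, hβs⟩ := lt_min_iff.1 hβ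
    obtain ⟨M, σ, hM, hσ, hsup, hlip⟩ := hblocks β hβs
    obtain ⟨H, hH⟩ := isHolderOn_of_blocks hM hβ0 hβ1.le hσ hsup hlip (domain L)
    refine ⟨|c| * H, fun x hx y hy => ?_⟩
    have e : c * (specCoef L s κ 0 * ξ 0 ω + ∑' n, f n x)
        - c * (specCoef L s κ 0 * ξ 0 ω + ∑' n, f n y) = c * (∑' n, f n x - ∑' n, f n y) := by ring
    rw [e, abs_mul, mul_assoc]
    exact mul_le_mul_of_nonneg_left (hH x hx y hy) (abs_nonneg _)

end Hoelder

end MaternFEM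
end

theorem mainTheorem2 {Ω : Type*} [MeasurableSpace Ω] (P : Measure Ω) [IsProbabilityMeasure P]
    (D : ℕ) (hD : 1 ≤ D) (L : Fin D → ℝ) (hL : ∀ d, 0 < L d)
    (ξ : (Fin D → ℕ) → Ω → ℝ) (hξ : MaternFEM.IsIIDStdNormal ξ P)
    (s : ℝ) (hs : (D : ℝ) / 2 < s) :
    -- the series defining the field converges almost surely in `L²`
    (∀ κ : ℝ, 0 < κ → ∀ᵐ ω ∂P, Summable (MaternFEM.fieldTerm L s κ ξ ω)) ∧
    -- mean-square error in `L²`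
    (∀ ρ : ℝ, ∃ C : ℝ, ∀ κ : ℝ, 0 < κ → ∀ K : Fin D → ℕ, MaternFEM.IsAdmissible L ρ K →
      (s ≠ (D : ℝ) / 2 + 2 →
        MaternFEM.meanSqError P 2 L s κ K ξ ≤ ENNReal.ofReal
          (C * κ ^ (2 * s - D) * MaternFEM.meshSize L K ^ (min (2 * s - D) 4))) ∧
      (s = (D : ℝ) / 2 + 2 →
        MaternFEM.meanSqError P 2 L s κ K ξ ≤ ENNReal.ofReal
          (C * κ ^ (2 * s - D) * MaternFEM.meshSize L K ^ (min (2 * s - D) 4)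
            * (1 + |Real.log (MaternFEM.meshSize L K)|)))) ∧
    -- Hölder regularity of the field
    (∀ κ : ℝ, 0 < κ → ∀ᵐ ω ∂P, ∃ v : (Fin D → ℝ) → ℝ,
      (MaternFEM.field L s κ ξ ω : (Fin D → ℝ) → ℝ) =ᵐ[MaternFEM.domainMeasure L] v ∧
      ∀ β : ℝ, 0 < β → β < min 1 (s - (D : ℝ) / 2) →
        MaternFEM.IsHolderOn β v (MaternFEM.domain L)) ∧
    -- mean-square error in `L^∞`
    ((D : ℝ) < s → ∀ ρ : ℝ, ∃ C : ℝ, ∀ κ : ℝ, 0 < κ → ∀ K : Fin D → ℕ,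
      MaternFEM.IsAdmissible L ρ K →
        MaternFEM.meanSqError P ⊤ L s κ K ξ ≤ ENNReal.ofReal
          (C * κ ^ (2 * s - D) * MaternFEM.meshSize L K ^ (min (2 * s - 2 * D) 4))) := by
  refine ⟨fun κ _ => MaternFEM.summable_fieldTerm hL hξ hs κ, fun ρ => ?_,
    fun κ _ => MaternFEM.ae_exists_holder hL hξ hs κ, fun hsD ρ => ?_⟩
  · obtain ⟨C, -, h⟩ := MaternFEM.meanSqError_two_le_rate hD hL hs ρ
    exact ⟨C, fun κ hκ K hK => h hξ κ hκ K hK⟩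
  · obtain ⟨C, -, h⟩ := MaternFEM.meanSqError_top_le hD hL hsD ρ
    exact ⟨C, fun κ hκ K hK => h hξ κ hκ K hK⟩
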